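/- Lemma. Let $\lambda\ge 0$ and $\beta\ge 0$. Let $B=(B_t)_{t\ge 0}$ be a standard real Brownian motion and $N=(N_t)_{t\ge 0}$ a Poisson process with intensity $\lambda$, independent of $B$, on a probability space. Let $T_1=\inf\{t\ge 0: N_t\ge 1\}$ be the first jump time of $N$ ($T_1=\infty$ if there is no jump), and let $$L^{a}_t=\lim_{\varepsilon\downarrow 0}\frac1{2\varepsilon}\,\mathrm{Leb}\{s\in[0,t]: |B_s-a|<\varepsilon\}$$ be the local time of $B$ at the level $a$. Let $\mathcal T_{0,1}$ be the set of stopping times of the natural filtration of $(N_t,B_t)_{t\ge0}$ with values in $[0,1]$, put $f_a(x)=x+a x^+$, and for $y\in\mathbb R$ define $$v_{\lambda,\beta}(y)=\sup_{\tau\in\mathcal T_{0,1}}\mathbb E\left[e^{\lambda\tau}\mathbf 1_{\{N_\tau=0\}}\int_0^\tau f_{\lambda\beta}(y+B_s)\,ds+\frac\beta2\, e^{\lambda\tau}\mathbf 1_{\{N_\tau=1\}}\left(L^{-y}_\tau-L^{-y}_{T_1}\right)\right].$$ For every $y$ the random variables under the expectation are integrable and the supremum is finite. The threshold $$y_{\lambda,\beta}=-\inf\{x\in\mathbb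 R: v_{\lambda,\beta}(x)>0\}$$ satisfies $$0<y_{\lambda,\beta}<1+\lambda\beta(2+e^{\lambda}),$$ and $v_{\lambda,\beta}(y)=0$ for all $y<-y_{\lambda,\beta}$. -/

import Mathlib

open MeasureTheory ProbabilityTheory Filter Topology
open scoped NNReal ENNReal

/-- `N` is a (homogeneous) Poisson process with intensity `r ≥ 0` under `P`: it starts at `0`, has
independent increments, `N (s + h) - N s` has the Poisson law of parameter `r * h`, and almost all
paths are nondecreasing and right-continuous. (As the paths are nondecreasing, the subtraction of
natural numbers in `law_increment` is almost surely the usual one.) -/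
structure IsPoissonProcess {Ω : Type*} [MeasurableSpace Ω] (N : ℝ≥0 → Ω → ℕ) (r : ℝ≥0)
    (P : Measure Ω) : Prop where
  zero : ∀ᵐ ω ∂P, N 0 ω = 0
  indep_increments : HasIndepIncrements (fun t ω => (N t ω : ℝ)) P
  law_increment : ∀ s h : ℝ≥0, HasLaw (fun ω => N (s + h) ω - N s ω) (poissonMeasure (r * h)) P
  mono : ∀ᵐ ω ∂P, Monotone fun t => N t ω
  right_cont : ∀ᵐ ω ∂P, ∀ t, ContinuousWithinAt (fun s => N s ω) (Set.Ici t) t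

/-- The first jump time `inf {t | N t ≥ 1}` of a counting process started at `0`; it is `∞` on the
event that there is no jump. -/
noncomputable def firstJumpTime {Ω : Type*} (N : ℝ≥0 → Ω → ℕ) (ω : Ω) : ℝ≥0∞ :=
  ⨅ (s : ℝ≥0) (_ : 1 ≤ N s ω), (s : ℝ≥0∞)

/-- The local time at level `a` and time `t` of the path `X`,
`lim_{ε ↓ 0} (1 / 2ε) * Leb {s ∈ [0, t] : |X s - a| < ε}`.
For Brownian motion and a fixed level `a` this limit almost surely exists for all `t`; taking the
lower limit makes the expression meaningful for every path. The normalisation is that of Tanaka's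
formula `(B t - a)⁺ = (B 0 - a)⁺ + ∫ 1_{B s > a} dB s + (1 / 2) L t`. -/
noncomputable def localTime (X : ℝ≥0 → ℝ) (a : ℝ) (t : ℝ≥0∞) : ℝ≥0∞ :=
  liminf (fun ε : ℝ =>
    volume {s : ℝ | 0 ≤ s ∧ ENNReal.ofReal s ≤ t ∧ |X s.toNNReal - a| < ε} /
      ENNReal.ofReal (2 * ε)) (𝓝[>] (0 : ℝ))

/-- The natural filtration of the pair `(N, B)`. -/
noncomputable def pairFiltration {Ω : Type*} [MeasurableSpace Ω] (N : ℝ≥0 → Ω → ℕ)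
    (B : ℝ≥0 → Ω → ℝ) (hN : ∀ t, Measurable (N t)) (hB : ∀ t, Measurable (B t)) :
    Filtration ℝ≥0 ‹MeasurableSpace Ω› :=
  Filtration.natural (fun t ω => (N t ω, B t ω))
    (fun t => ((hN t).prodMk (hB t)).stronglyMeasurable)

/-- The stopping times of the filtration `F` with values in `[0, 1]`. -/
def stoppingTimesUnit {Ω : Type*} {m : MeasurableSpace Ω} (F : Filtration ℝ≥0 m) :
    Set (Ω → ℝ≥0) :=
  {τ | IsStoppingTime F (fun ω => (τ ω : WithTop ℝ≥0)) ∧ ∀ ω, τ ω ≤ 1}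

/-- The function `f_a (x) = x + a x⁺`. -/
noncomputable def fAux (a x : ℝ) : ℝ := x + a * max x 0

/-- The random variable
`e^{lτ} 1_{N_τ = 0} ∫₀^τ f_{l b} (y + B_s) ds + (b / 2) e^{lτ} 1_{N_τ = 1} (L_τ - L_{T₁})`
with `L` the local time of `B` at `-y` and `T₁` the first jump time of `N`. On the event `N_τ = 1`
one has `T₁ ≤ τ < ∞`. -/
noncomputable def payoff {Ω : Type*} (l b : ℝ≥0) (N : ℝ≥0 → Ω → ℕ) (B : ℝ≥0 → Ω → ℝ)
    (y : ℝ) (τ : Ω → ℝ≥0) (ω : Ω) : ℝ :=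
  Real.exp (l * τ ω) * (if N (τ ω) ω = 0 then 1 else 0) *
      (∫ s in (0 : ℝ)..(τ ω : ℝ), fAux (l * b) (y + B s.toNNReal ω)) +
    (b : ℝ) / 2 * Real.exp (l * τ ω) * (if N (τ ω) ω = 1 then 1 else 0) *
      ((localTime (fun t => B t ω) (-y) (τ ω : ℝ≥0∞)).toReal -
        (localTime (fun t => B t ω) (-y) (firstJumpTime N ω)).toReal)

/-- The set of expected payoffs over all admissible stopping times. -/
noncomputable def expectedPayoffs {Ω : Type*} [MeasurableSpace Ω] (P : Measure Ω) (l b : ℝ≥0)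
    (N : ℝ≥0 → Ω → ℕ) (B : ℝ≥0 → Ω → ℝ) (hN : ∀ t, Measurable (N t))
    (hB : ∀ t, Measurable (B t)) (y : ℝ) : Set ℝ :=
  (fun τ => ∫ ω, payoff l b N B y τ ω ∂P) '' stoppingTimesUnit (pairFiltration N B hN hB)

/-- The value function `v_{l,b}` of the auxiliary optimal stopping problem. -/
noncomputable def vAux {Ω : Type*} [MeasurableSpace Ω] (P : Measure Ω) (l b : ℝ≥0)
    (N : ℝ≥0 → Ω → ℕ) (B : ℝ≥0 → Ω → ℝ) (hN : ∀ t, Measurable (N t))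
    (hB : ∀ t, Measurable (B t)) (y : ℝ) : ℝ :=
  sSup (expectedPayoffs P l b N B hN hB y)

/-- The threshold `y_{l,b} = - inf {x | v_{l,b} (x) > 0}`. -/
noncomputable def yThreshold {Ω : Type*} [MeasurableSpace Ω] (P : Measure Ω) (l b : ℝ≥0)
    (N : ℝ≥0 → Ω → ℕ) (B : ℝ≥0 → Ω → ℝ) (hN : ∀ t, Measurable (N t))
    (hB : ∀ t, Measurable (B t)) : ℝ :=
  -sInf {x : ℝ | 0 < vAux P l b N B hN hB x}

/-! Let Q be P conditioned on N_1 = 0. The process e^{λt} 1_{N_t = 0} is the density of Q with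
respect to P on the past of t, and B is still a Brownian motion under Q. Hence the running part of
the payoff has expectation E_Q ∫₀^τ f(y + B_s) ds with f = f_{λβ}, and the jumps disappear from it.

Upper bound for the threshold. Put c = -y ≥ 19/20; every term is compared with E_Q τ. If p(t, x)
satisfies ∂_t p + p_xx / 2 = F, p(0, 0) = 0 and p(t, x) ≤ κ t on [0, 1], then Dynkin's formula gives
E_Q ∫₀^τ F(B_s) ds ≤ κ E_Q τ (`sum_setIntegral_le_of_heat`). Explicit choices of p give κ = 19/20
for F = x and κ = 1 for F = x². As f(x - c) ≤ x - c + (3/10) λβ x², the running part is at most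
(19/20 - c + (3/10) λβ) E_Q τ.

In the local time part, L_τ - L_{T₁} ≤ L_1, and a jump in a short interval before τ has probability
at most λ dt, independently of the past and of the whole path of B. This part is therefore at most
(β/2) e^λ λ E_Q[τ L_1]. The local time before τ is controlled by a convex function whose second
derivative is a smoothed delta at c, which contributes E_Q τ / c. The local time after a time t ≤ τ
is controlled by the Gaussian density, with constant √(2/π) < 4/5. As 4/5 + 1/c ≤ 2, the total is at
most (19/20 - c + (3/10) λβ + λβ e^λ) E_Q τ, which is nonpositive once c ≥ 19/20 + λβ(2 + e^λ)
(`integral_payoff_gridCeil_nonpos`). The gap between 19/20 and 1 makes the inequality for the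
threshold strict.

Positivity of the threshold. At y = -1/16 the rule "continue after time 1/2 only if B_{1/2} ≥ 0" has
positive expected payoff (`integral_payoff_halfwayTime_pos`).

All estimates are made for stopping times on a grid, where optional stopping is a finite telescoping
sum. A general τ is approximated from the right; since local time increases, a one-sided comparison
suffices and its continuity is never used (`tendsto_payoff_sub_gridCeil`). Nor is the existence of
the local time limit: for a lower limit, monotonicity in t and Fatou's lemma are enough. -/

set_option linter.unusedSectionVars false

/-! ### Gaussian moments and the heat equation. -/

lemma integrable_pow_gaussianReal (v : ℝ≥0) (n : ℕ) :
    Integrable (fun x : ℝ => x ^ n) (gaussianReal 0 v) := by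
  have h := (memLp_id_gaussianReal (μ := 0) (v := v) (n : ℝ≥0)).integrable_norm_pow'
  refine h.mono' (by fun_prop) (ae_of_all _ fun x => ?_)
  simp

/-- Gaussian integration by parts. -/
lemma integral_id_mul_stdGaussian {f f' : ℝ → ℝ} (hf : ∀ x, HasDerivAt f (f' x) x)
    (h0 : Integrable f (gaussianReal 0 1)) (h1 : Integrable f' (gaussianReal 0 1))
    (h2 : Integrable (fun x => x * f x) (gaussianReal 0 1)) :
    ∫ x, x * f x ∂gaussianReal 0 1 = ∫ x, f' x ∂gaussianReal 0 1 := by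
  have hd : ∀ x, HasDerivAt (gaussianPDFReal 0 1) (-x * gaussianPDFReal 0 1 x) x := by
    intro x
    rw [gaussianPDFReal_def]
    have h : HasDerivAt (fun x : ℝ => -(x - 0) ^ 2 / (2 * ((1 : ℝ≥0) : ℝ))) (-x) x := by
      refine (((((hasDerivAt_id' x).sub_const 0).fun_pow 2).fun_neg).div_const _).congr_deriv ?_
      simp
      ring
    refine ((h.exp).const_mul (√(2 * Real.pi * ((1 : ℝ≥0) : ℝ)))⁻¹).congr_deriv ?_
    ring
  have hint : ∀ {g : ℝ → ℝ}, Integrable g (gaussianReal 0 1) →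
      Integrable (fun x => gaussianPDFReal 0 1 x * g x) := by
    intro g hg
    rw [gaussianReal_of_var_ne_zero _ one_ne_zero,
      integrable_withDensity_iff_integrable_smul' (measurable_gaussianPDF _ _)
        (ae_of_all _ fun _ => gaussianPDF_lt_top)] at hg
    simpa [toReal_gaussianPDF] using hg
  rw [integral_gaussianReal_eq_integral_smul one_ne_zero,
    integral_gaussianReal_eq_integral_smul one_ne_zero]
  have key := integral_mul_deriv_eq_deriv_mul_of_integrable
    (u := gaussianPDFReal 0 1) (v := f) (u' := fun x => -x * gaussianPDFReal 0 1 x) (v' := f')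
    (fun x _ => hd x) (fun x _ => hf x) (hint h1)
    ((hint h2).neg.congr (ae_of_all _ fun x => by simp; ring)) (hint h0)
  simp only [smul_eq_mul]
  rw [key, ← integral_neg]
  congr 1 with x
  ring

lemma integral_pow_add_two_stdGaussian (n : ℕ) :
    ∫ x, x ^ (n + 2) ∂gaussianReal 0 1 = (n + 1) * ∫ x, x ^ n ∂gaussianReal 0 1 := by
  have h := integral_id_mul_stdGaussian (f := fun x => x ^ (n + 1))
    (f' := fun x => ((n + 1 : ℕ) : ℝ) * x ^ n) (fun x => by simpa using hasDerivAt_pow (n + 1) x)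
    (integrable_pow_gaussianReal 1 (n + 1)) ((integrable_pow_gaussianReal 1 n).const_mul _)
    ((integrable_pow_gaussianReal 1 (n + 2)).congr (ae_of_all _ fun x => by ring))
  rw [integral_const_mul] at h
  rw [← Nat.cast_succ, ← h]
  congr 1 with x
  ring

lemma integral_add_gaussianReal (g : ℝ → ℝ) (x : ℝ) {r : ℝ} (hr : 0 ≤ r) :
    ∫ w, g (x + w) ∂gaussianReal 0 r.toNNReal = ∫ w, g (x + √r * w) ∂gaussianReal 0 1 := by
  have h := gaussianReal_map_const_mul (μ := 0) (v := 1) (√r)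
  have h2 : NNReal.mk (√r ^ 2) (sq_nonneg _) * 1 = r.toNNReal := by
    ext; simp [Real.sq_sqrt hr, hr]
  rw [h2, mul_zero] at h
  rw [← h]
  by_cases h0 : √r = 0
  · have : (fun w : ℝ => √r * w) = fun _ => 0 := by ext; simp [h0]
    rw [this, Measure.map_const, h0]
    simp
  · exact (MeasurableEquiv.mulLeft₀ (√r) h0).measurableEmbedding.integral_map
      (fun w => g (x + w))

/-- The integrals of polynomials of degree at most four against a centred Gaussian law. -/
lemma integral_quartic_gaussianReal (a₀ a₁ a₂ a₃ a₄ : ℝ) {r : ℝ} (hr : 0 ≤ r) :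
    ∫ w, (a₀ + a₁ * w + a₂ * w ^ 2 + a₃ * w ^ 3 + a₄ * w ^ 4) ∂gaussianReal 0 r.toNNReal =
      a₀ + a₂ * r + 3 * a₄ * r ^ 2 := by
  have h := integral_add_gaussianReal
    (fun w => a₀ + a₁ * w + a₂ * w ^ 2 + a₃ * w ^ 3 + a₄ * w ^ 4) 0 hr
  simp only [zero_add] at h
  rw [h]
  have i : ∀ (n : ℕ) (a : ℝ), Integrable (fun w : ℝ => a * (√r * w) ^ n) (gaussianReal 0 1) := by
    intro n a
    simp_rw [mul_pow]
    exact ((integrable_pow_gaussianReal 1 n).const_mul _).const_mul _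
  have i1 : Integrable (fun w : ℝ => a₁ * (√r * w)) (gaussianReal 0 1) := by simpa using i 1 a₁
  have m0 : ∫ x : ℝ, x ^ 0 ∂gaussianReal 0 1 = 1 := by simp
  have m1 : ∫ x : ℝ, x ^ 1 ∂gaussianReal 0 1 = 0 := by simp
  have m2 := integral_pow_add_two_stdGaussian 0
  have m3 := integral_pow_add_two_stdGaussian 1
  have m4 := integral_pow_add_two_stdGaussian 2
  norm_num at m2 m3 m4
  rw [m2] at m4
  rw [integral_add (by fun_prop (disch := simp)), integral_add, integral_add, integral_add]
  · simp only [mul_pow, integral_const_mul, m2, m3, m4]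
    have h4 : √r ^ 4 = r ^ 2 := by
      rw [show √r ^ 4 = (√r ^ 2) ^ 2 by ring, Real.sq_sqrt hr]
    have e1 : ∫ w : ℝ, √r * w ∂gaussianReal 0 1 = 0 := by
      rw [integral_const_mul]; simp
    simp [h4, Real.sq_sqrt hr, e1]
    ring
  all_goals first
    | exact integrable_const _
    | exact i1
    | exact i _ _
    | exact (integrable_const _).add i1
    | exact ((integrable_const _).add i1).add (i _ _)

/-- The heat equation `∂_r E φ(x + W_r) = E φ''(x + W_r) / 2`, integrated over `[0, h]`. -/
lemma integral_heat {f f' f'' : ℝ → ℝ} (h1 : ∀ x, HasDerivAt f (f' x) x)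
    (h2 : ∀ x, HasDerivAt f' (f'' x) x) {M : ℝ} (hf' : ∀ x, |f' x| ≤ M) (hf'' : ∀ x, |f'' x| ≤ M)
    (hc : Continuous f'') (x : ℝ) {h : ℝ} (hh : 0 ≤ h) :
    ∫ w, f (x + w) ∂gaussianReal 0 h.toNNReal =
      f x + ∫ r in (0 : ℝ)..h, ∫ w, f'' (x + w) / 2 ∂gaussianReal 0 r.toNNReal := by
  have hM : 0 ≤ M := (abs_nonneg _).trans (hf' 0)
  have hcf : Continuous f := continuous_iff_continuousAt.2 fun x => (h1 x).continuousAt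
  have hcf' : Continuous f' := continuous_iff_continuousAt.2 fun x => (h2 x).continuousAt
  have hlip : ∀ a b, |f a - f b| ≤ M * |a - b| := by
    intro a b
    have := Convex.norm_image_sub_le_of_norm_hasDerivWithin_le (s := Set.univ)
      (fun x _ => (h1 x).hasDerivWithinAt) (fun x _ => hf' x) convex_univ (Set.mem_univ b)
      (Set.mem_univ a)
    simpa using this
  have iabs : Integrable (fun w : ℝ => |w|) (gaussianReal 0 1) := by
    simpa using (integrable_pow_gaussianReal 1 1).abs
  have hbd : ∀ s w : ℝ, |f (x + √s * w)| ≤ |f x| + M * √s * |w| := by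
    intro s w
    have := hlip (x + √s * w) x
    rw [add_sub_cancel_left, abs_mul, abs_of_nonneg (Real.sqrt_nonneg s)] at this
    have h3 := abs_sub_abs_le_abs_sub (f (x + √s * w)) (f x)
    linarith
  have iF : ∀ s, Integrable (fun w => f (x + √s * w)) (gaussianReal 0 1) := fun s =>
    (((integrable_const (|f x|)).add (iabs.const_mul (M * √s)))).mono'
      (by fun_prop) (ae_of_all _ fun w => by simpa using hbd s w)
  have iF'' : ∀ s, Integrable (fun w => f'' (x + √s * w)) (gaussianReal 0 1) := fun s =>
    (integrable_const M).mono' (by fun_prop) (ae_of_all _ fun w => hf'' _)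
  have iwF' : ∀ s, Integrable (fun w => w * f' (x + √s * w)) (gaussianReal 0 1) := fun s =>
    (iabs.mul_const M).mono' (by fun_prop) (ae_of_all _ fun w => by
      rw [Real.norm_eq_abs, abs_mul]; exact mul_le_mul_of_nonneg_left (hf' _) (abs_nonneg _))
  have iF' : ∀ s, Integrable (fun w => f' (x + √s * w)) (gaussianReal 0 1) := fun s =>
    (integrable_const M).mono' (by fun_prop) (ae_of_all _ fun w => hf' _)
  have hder : ∀ s ∈ Set.Ioo 0 h, HasDerivAt (fun s => ∫ w, f (x + √s * w) ∂gaussianReal 0 1)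
      (∫ w, f'' (x + √s * w) / 2 ∂gaussianReal 0 1) s := by
    intro s hs
    have hs0 : 0 < s := hs.1
    have hsq : 0 < √s := Real.sqrt_pos.2 hs0
    -- The derivative in t of f(x + √t w) has the factor 1 / (2√t), singular at 0. On t > s/4 it is
    -- at most 1/√s, which gives an integrable bound.
    have hd := (hasDerivAt_integral_of_dominated_loc_of_deriv_le (μ := gaussianReal 0 1)
      (F := fun s w => f (x + √s * w)) (F' := fun s w => f' (x + √s * w) * (1 / (2 * √s) * w))
      (x₀ := s) (s := Set.Ioi (s / 4)) (bound := fun w => M * (1 / √s * |w|))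
      (Ioi_mem_nhds (by linarith)) (.of_forall fun t => by fun_prop) (iF s) (by fun_prop)
      (ae_of_all _ fun w t ht => ?_) ((iabs.const_mul _).const_mul _)
      (ae_of_all _ fun w t ht => ?_)).2
    · have hs' : ∫ w, f' (x + √s * w) * (1 / (2 * √s) * w) ∂gaussianReal 0 1 =
          ∫ w, f'' (x + √s * w) / 2 ∂gaussianReal 0 1 := by
        -- Integration by parts turns the factor w into a second derivative and a factor √s, which
        -- cancels the 1/√s.
        have hst := integral_id_mul_stdGaussian (f := fun w => f' (x + √s * w))
          (f' := fun w => f'' (x + √s * w) * √s)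
          (fun w => by
            have := (h2 (x + √s * w)).comp w (((hasDerivAt_id w).const_mul (√s)).const_add x)
            simpa [Function.comp_def] using! this)
          (iF' s) ((iF'' s).mul_const _) (iwF' s)
        rw [integral_mul_const] at hst
        rw [integral_div]
        have : ∫ w, f' (x + √s * w) * (1 / (2 * √s) * w) ∂gaussianReal 0 1 =
            1 / (2 * √s) * ∫ w, w * f' (x + √s * w) ∂gaussianReal 0 1 := by
          rw [← integral_const_mul]; congr 1 with w; ring
        rw [this, hst]
        field_simp
      rw [← hs']
      exact hd
    · have ht' : s / 4 < t := ht
      have h5 : √s ≤ 2 * √t := by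
        rw [show (2 : ℝ) = √4 by rw [show (4 : ℝ) = 2 ^ 2 by norm_num]; simp,
          ← Real.sqrt_mul (by norm_num)]
        exact Real.sqrt_le_sqrt (by linarith)
      rw [Real.norm_eq_abs, abs_mul, abs_mul, abs_of_nonneg (by positivity : 0 ≤ 1 / (2 * √t))]
      have : 1 / (2 * √t) ≤ 1 / √s := one_div_le_one_div_of_le hsq h5
      gcongr
      exact hf' _
    · have ht0 : 0 < t := lt_trans (by positivity) (show s / 4 < t from ht)
      exact (h1 (x + √t * w)).comp t
        (((Real.hasDerivAt_sqrt ht0.ne').mul_const w).const_add x)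
  -- At s = 0 only continuity is available; the fundamental theorem of calculus needs the derivative
  -- in the open interval only.
  have hcont : Continuous (fun s => ∫ w, f (x + √s * w) ∂gaussianReal 0 1) := by
    refine continuous_iff_continuousAt.2 fun s₀ => ?_
    refine continuousAt_of_dominated (bound := fun w => |f x| + M * √(s₀ + 1) * |w|)
      (.of_forall fun s => by fun_prop) ?_ ((integrable_const _).add (iabs.const_mul _))
      (ae_of_all _ fun w => by fun_prop)
    filter_upwards [Iio_mem_nhds (show s₀ < s₀ + 1 by linarith)] with s hs
    refine ae_of_all _ fun w => (hbd s w).trans ?_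
    gcongr
    exact le_of_lt hs
  have hcont2 : Continuous (fun s => ∫ w, f'' (x + √s * w) / 2 ∂gaussianReal 0 1) := by
    refine continuous_iff_continuousAt.2 fun s₀ => ?_
    refine continuousAt_of_dominated (bound := fun w => M / 2)
      (.of_forall fun s => by fun_prop) (.of_forall fun s => ae_of_all _ fun w => ?_)
      (integrable_const _) (ae_of_all _ fun w => by fun_prop)
    rw [Real.norm_eq_abs, abs_div, abs_two]
    exact div_le_div_of_nonneg_right (hf'' _) (by norm_num)
  have hftc := intervalIntegral.integral_eq_sub_of_hasDerivAt_of_le hh hcont.continuousOn hder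
    (hcont2.intervalIntegrable _ _)
  have hcongr : ∫ r in (0 : ℝ)..h, ∫ w, f'' (x + w) / 2 ∂gaussianReal 0 r.toNNReal =
      ∫ r in (0 : ℝ)..h, ∫ w, f'' (x + √r * w) / 2 ∂gaussianReal 0 1 := by
    refine intervalIntegral.integral_congr fun r hr => ?_
    rw [Set.uIcc_of_le hh] at hr
    exact integral_add_gaussianReal (fun y => f'' y / 2) x hr.1
  rw [hcongr, hftc, integral_add_gaussianReal f x hh]
  simp

/-! ### Dynkin's formula along grid stopping times. -/

/-- Integration of a function of two independent variables. -/
lemma ProbabilityTheory.IndepFun.integral_comp_prod {Ω α β : Type*} [MeasurableSpace Ω]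
    [MeasurableSpace α]
    [MeasurableSpace β] {Q : Measure Ω} [IsProbabilityMeasure Q] {X : Ω → α} {Y : Ω → β}
    {ν : Measure β} [IsProbabilityMeasure ν] (h : IndepFun X Y Q) (hX : AEMeasurable X Q)
    (hY : HasLaw Y ν Q) {f : α × β → ℝ} (hf : Measurable f)
    (hi : Integrable (fun ω => f (X ω, Y ω)) Q) :
    Integrable (fun ω => ∫ w, f (X ω, w) ∂ν) Q ∧
      ∫ ω, f (X ω, Y ω) ∂Q = ∫ ω, (∫ w, f (X ω, w) ∂ν) ∂Q := by
  have hlaw := h.map_prod_eq_prod_map_map hX hY.aemeasurable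
  rw [hY.map_eq] at hlaw
  have hXY : AEMeasurable (fun ω => (X ω, Y ω)) Q := hX.prodMk hY.aemeasurable
  have : IsProbabilityMeasure (Q.map X) := Measure.isProbabilityMeasure_map hX
  have hi' : Integrable f ((Q.map X).prod ν) := by
    rw [← hlaw, integrable_map_measure hf.aestronglyMeasurable hXY]
    exact hi
  have hm : StronglyMeasurable fun x => ∫ w, f (x, w) ∂ν := hf.stronglyMeasurable.integral_prod_right'
  constructor
  · exact (integrable_map_measure hm.aestronglyMeasurable hX).1 hi'.integral_prod_left
  · rw [← integral_map (φ := fun ω => (X ω, Y ω)) hXY (f := f) hf.aestronglyMeasurable, hlaw,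
      integral_prod _ hi', integral_map hX hm.aestronglyMeasurable]

/-- A Brownian motion indexed by real times (only nonnegative times matter) all of whose paths are
continuous. -/
structure IsContBrownian {Ω : Type*} [MeasurableSpace Ω] (W : ℝ → Ω → ℝ) (Q : Measure Ω) :
    Prop where
  meas : ∀ t, Measurable (W t)
  cont : ∀ ω, Continuous fun t => W t ω
  zero : ∀ᵐ ω ∂Q, W 0 ω = 0
  law_sub : ∀ s t, 0 ≤ s → s ≤ t →
    HasLaw (fun ω => W t ω - W s ω) (gaussianReal 0 (t - s).toNNReal) Q

/-- The event `A` and the position at time `t` are independent of every later increment. -/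
structure IndepOfFuture {Ω : Type*} [MeasurableSpace Ω] (W : ℝ → Ω → ℝ) (Q : Measure Ω)
    (A : Set Ω) (t : ℝ) : Prop where
  meas : MeasurableSet A
  indep : ∀ s, t ≤ s → IndepFun (fun ω => (A.indicator (1 : Ω → ℝ) ω, W t ω))
    (fun ω => W s ω - W t ω) Q

section Core

variable {Ω : Type*} [MeasurableSpace Ω] {W : ℝ → Ω → ℝ} {Q : Measure Ω} [IsProbabilityMeasure Q]

lemma IsContBrownian.law (hW : IsContBrownian W Q) {s : ℝ} (hs : 0 ≤ s) :
    HasLaw (W s) (gaussianReal 0 s.toNNReal) Q := by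
  have := hW.law_sub 0 s le_rfl hs
  rw [sub_zero] at this
  refine this.congr ?_
  filter_upwards [hW.zero] with ω h
  simp [h]

lemma IsContBrownian.measurable_uncurry (hW : IsContBrownian W Q) :
    Measurable (Function.uncurry W) :=
  measurable_uncurry_of_continuous_of_measurable hW.cont hW.meas

lemma IsContBrownian.integrable_pow (hW : IsContBrownian W Q) {s : ℝ} (hs : 0 ≤ s) (n : ℕ) :
    Integrable (fun ω => W s ω ^ n) Q := by
  have h := integrable_pow_gaussianReal s.toNNReal n
  rw [← (hW.law hs).map_eq] at h
  exact h.comp_aemeasurable (hW.law hs).aemeasurable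

lemma IsContBrownian.integral_pow_four (hW : IsContBrownian W Q) {s : ℝ} (hs : 0 ≤ s) :
    ∫ ω, W s ω ^ 4 ∂Q = 3 * s ^ 2 := by
  have h := (hW.law hs).integral_comp (f := fun x : ℝ => x ^ 4) (by fun_prop)
  have h2 := integral_quartic_gaussianReal 0 0 0 0 1 hs
  simp only [zero_add, zero_mul, one_mul, mul_one] at h2
  rw [h2] at h
  exact h

lemma IsContBrownian.integrable_comp (hW : IsContBrownian W Q) {s : ℝ} (hs : 0 ≤ s)
    {g : ℝ → ℝ} (hg : Measurable g) {C : ℝ} (hC : ∀ x, |g x| ≤ C * (1 + x ^ 4)) :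
    Integrable (fun ω => g (W s ω)) Q :=
  (((integrable_const 1).add (hW.integrable_pow hs 4)).const_mul C).mono'
    (hg.comp (hW.meas s)).aestronglyMeasurable (ae_of_all _ fun _ => hC _)

/-- Fubini in (s, ω) for functions of quartic growth. This class contains all test functions used
below, and the fourth moment 3 s² is bounded on bounded time intervals. -/
lemma IsContBrownian.integrable_prod (hW : IsContBrownian W Q) {a b : ℝ} (ha : 0 ≤ a)
    {g : ℝ → ℝ} (hg : Measurable g) {C : ℝ} (hC : ∀ x, |g x| ≤ C * (1 + x ^ 4)) :
    Integrable (fun p : ℝ × Ω => g (W p.1 p.2)) ((volume.restrict (Set.Ioc a b)).prod Q) := by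
  have hC0 : 0 ≤ C := by simpa using (abs_nonneg _).trans (hC 0)
  have hm : Measurable fun p : ℝ × Ω => g (W p.1 p.2) := hg.comp hW.measurable_uncurry
  rw [integrable_prod_iff hm.aestronglyMeasurable]
  constructor
  · filter_upwards [ae_restrict_mem measurableSet_Ioc] with s hs
    exact hW.integrable_comp (ha.trans hs.1.le) hg hC
  · refine (integrable_const (C * (1 + 3 * b ^ 2))).mono'
      hm.norm.stronglyMeasurable.integral_prod_right'.aestronglyMeasurable ?_
    filter_upwards [ae_restrict_mem measurableSet_Ioc] with s hs
    have hs0 : 0 ≤ s := ha.trans hs.1.le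
    rw [Real.norm_of_nonneg (integral_nonneg fun _ => norm_nonneg _)]
    calc ∫ ω, ‖g (W s ω)‖ ∂Q ≤ ∫ ω, C * (1 + W s ω ^ 4) ∂Q :=
          integral_mono (hW.integrable_comp hs0 hg hC).norm
            (((integrable_const 1).add (hW.integrable_pow hs0 4)).const_mul C) fun ω => hC _
      _ = C * (1 + 3 * s ^ 2) := by
          rw [integral_const_mul, integral_add (integrable_const 1) (hW.integrable_pow hs0 4),
            hW.integral_pow_four hs0]
          simp
      _ ≤ C * (1 + 3 * b ^ 2) := by gcongr; exact hs.2

/-- The Markov property at time t: the increment is integrated out with W_t frozen. The indicator of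
A is carried along as a second coordinate of the past. -/
lemma IndepOfFuture.setIntegral_comp {A : Set Ω} {t : ℝ} (hA : IndepOfFuture W Q A t)
    (hW : IsContBrownian W Q) (ht : 0 ≤ t) {s : ℝ} (hs : t ≤ s) {g : ℝ → ℝ} (hg : Measurable g)
    (hi : Integrable (fun ω => g (W s ω)) Q) :
    ∫ ω in A, g (W s ω) ∂Q =
      ∫ ω in A, (∫ w, g (W t ω + w) ∂gaussianReal 0 (s - t).toNNReal) ∂Q := by
  have hm : Measurable (fun ω => (A.indicator (1 : Ω → ℝ) ω, W t ω)) :=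
    ((measurable_one).indicator hA.meas).prodMk (hW.meas t)
  have e : ∀ ω, A.indicator (fun ω => g (W s ω)) ω =
      A.indicator (1 : Ω → ℝ) ω * g (W t ω + (W s ω - W t ω)) := by
    intro ω
    by_cases h : ω ∈ A <;> simp [h]
  have h := ((hA.indep s hs).integral_comp_prod hm.aemeasurable (hW.law_sub t s ht hs)
    (f := fun p => p.1.1 * g (p.1.2 + p.2)) (by fun_prop) (by
      refine (hi.indicator hA.meas).congr (ae_of_all _ fun ω => ?_)
      exact e ω)).2
  rw [← integral_indicator hA.meas, ← integral_indicator hA.meas]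
  refine Eq.trans ?_ (h.trans ?_)
  · congr 1 with ω; exact e ω
  · congr 1 with ω
    by_cases h : ω ∈ A <;> simp [h]

/-- This justifies the exchange of integrals after the increment has been integrated out. The bound
comes from (x + z)⁴ ≤ 8 (x⁴ + z⁴). -/
lemma IndepOfFuture.integrable_prod_heat (hW : IsContBrownian W Q) {t : ℝ} (ht : 0 ≤ t) {h : ℝ}
    {g : ℝ → ℝ} (hg : Measurable g) {C : ℝ} (hC : ∀ x, |g x| ≤ C * (1 + x ^ 4)) (A : Set Ω) :
    Integrable (fun p : ℝ × Ω => ∫ w, g (W t p.2 + √p.1 * w) ∂gaussianReal 0 1)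
      ((volume.restrict (Set.Ioc 0 h)).prod (Q.restrict A)) := by
  have hC0 : 0 ≤ C := by simpa using (abs_nonneg _).trans (hC 0)
  have hm : Measurable fun q : (ℝ × Ω) × ℝ => g (W t q.1.2 + √q.1.1 * q.2) := by
    have := hW.meas t
    fun_prop
  have hm' := hm.stronglyMeasurable.integral_prod_right' (ν := gaussianReal 0 1)
  have i4 := integrable_pow_gaussianReal 1 4
  have hb : ∀ (r x w : ℝ), r ∈ Set.Ioc 0 h →
      |g (x + √r * w)| ≤ C * (1 + 8 * (x ^ 4 + h ^ 2 * w ^ 4)) := by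
    intro r x w hr
    refine (hC _).trans ?_
    have h4 : (√r * w) ^ 4 ≤ h ^ 2 * w ^ 4 := by
      rw [mul_pow, show √r ^ 4 = (√r ^ 2) ^ 2 by ring, Real.sq_sqrt hr.1.le]
      have := hr.1.le
      have := hr.2
      gcongr
    have : (x + √r * w) ^ 4 ≤ 8 * (x ^ 4 + (√r * w) ^ 4) := by
      nlinarith [sq_nonneg (x - √r * w), sq_nonneg (x ^ 2 - (√r * w) ^ 2),
        sq_nonneg ((x - √r * w) * (x + √r * w)), sq_nonneg ((x - √r * w) ^ 2)]
    gcongr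
    linarith
  have ib : Integrable (fun p : ℝ × Ω => C * (1 + 8 * (W t p.2 ^ 4 + h ^ 2 *
      ∫ w, w ^ 4 ∂gaussianReal 0 1))) ((volume.restrict (Set.Ioc 0 h)).prod (Q.restrict A)) := by
    have := (hW.integrable_pow ht 4).restrict (s := A)
    have := this.comp_snd (volume.restrict (Set.Ioc 0 h))
    exact ((integrable_const _).add ((this.add (integrable_const _)).const_mul _)).const_mul _
  refine ib.mono' hm'.aestronglyMeasurable ?_
  have hae : ∀ᵐ p ∂(volume.restrict (Set.Ioc 0 h)).prod (Q.restrict A), p.1 ∈ Set.Ioc 0 h :=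
    Measure.quasiMeasurePreserving_fst.ae (ae_restrict_mem measurableSet_Ioc)
  filter_upwards [hae] with p hp
  have i5 : Integrable (fun w : ℝ => h ^ 2 * w ^ 4) (gaussianReal 0 1) := i4.const_mul _
  have i6 : Integrable (fun w : ℝ => 8 * (W t p.2 ^ 4 + h ^ 2 * w ^ 4)) (gaussianReal 0 1) :=
    ((integrable_const _).add i5).const_mul _
  refine (norm_integral_le_of_norm_le ?_ (ae_of_all _ fun w => hb p.1 (W t p.2) w hp)).trans ?_
  · exact ((integrable_const _).add i6).const_mul _
  · apply le_of_eq
    rw [integral_const_mul, integral_add (integrable_const _) i6, integral_const_mul,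
      integral_add (integrable_const _) i5, integral_const_mul]
    simp

/-- The Dynkin formula over a time interval, on an event decided at its beginning. -/
lemma IndepOfFuture.dynkin_step {A : Set Ω} {t : ℝ} (hA : IndepOfFuture W Q A t)
    (hW : IsContBrownian W Q) (ht : 0 ≤ t) {h : ℝ} (hh : 0 ≤ h) {F p q : ℝ → ℝ}
    (hF : Measurable F) (hp : Measurable p) (hq : Measurable q) {C : ℝ}
    (hFC : ∀ x, |F x| ≤ C * (1 + x ^ 4)) (hpC : ∀ x, |p x| ≤ C * (1 + x ^ 4))
    (hqC : ∀ x, |q x| ≤ C * (1 + x ^ 4))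
    (heat : ∀ x, ∫ w, q (x + w) ∂gaussianReal 0 h.toNNReal =
      p x + ∫ r in (0 : ℝ)..h, ∫ w, F (x + w) ∂gaussianReal 0 r.toNNReal) :
    ∫ ω in A, (∫ s in t..(t + h), F (W s ω)) ∂Q =
      ∫ ω in A, (q (W (t + h) ω) - p (W t ω)) ∂Q := by
  have hth : t ≤ t + h := by linarith
  have hsw : ∫ ω in A, (∫ s in t..(t + h), F (W s ω)) ∂Q =
      ∫ s in t..(t + h), ∫ ω in A, F (W s ω) ∂Q := by
    simp_rw [intervalIntegral.integral_of_le hth]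
    refine integral_integral_swap (f := fun ω s => F (W s ω)) ?_
    have := (hW.integrable_prod (b := t + h) ht hF hFC).swap
    refine this.mono_measure ?_
    exact Measure.prod_mono Measure.restrict_le_self le_rfl
  rw [hsw]
  have e1 : ∫ s in t..(t + h), ∫ ω in A, F (W s ω) ∂Q =
      ∫ s in t..(t + h), ∫ ω in A, (∫ w, F (W t ω + √(s - t) * w) ∂gaussianReal 0 1) ∂Q := by
    refine intervalIntegral.integral_congr fun s hs => ?_
    rw [Set.uIcc_of_le hth] at hs
    rw [hA.setIntegral_comp hW ht hs.1 hF (hW.integrable_comp (ht.trans hs.1) hF hFC)]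
    congr 1 with ω
    exact integral_add_gaussianReal F _ (sub_nonneg.2 hs.1)
  have e2 : ∫ s in t..(t + h), ∫ ω in A, (∫ w, F (W t ω + √(s - t) * w) ∂gaussianReal 0 1) ∂Q =
      ∫ r in (0 : ℝ)..h, ∫ ω in A, (∫ w, F (W t ω + √r * w) ∂gaussianReal 0 1) ∂Q := by
    rw [intervalIntegral.integral_comp_sub_right
      (fun r => ∫ ω in A, (∫ w, F (W t ω + √r * w) ∂gaussianReal 0 1) ∂Q) t]
    simp
  have e3 : ∫ r in (0 : ℝ)..h, ∫ ω in A, (∫ w, F (W t ω + √r * w) ∂gaussianReal 0 1) ∂Q =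
      ∫ ω in A, (∫ r in (0 : ℝ)..h, ∫ w, F (W t ω + √r * w) ∂gaussianReal 0 1) ∂Q := by
    simp_rw [intervalIntegral.integral_of_le hh]
    exact integral_integral_swap
      (f := fun r ω => ∫ w, F (W t ω + √r * w) ∂gaussianReal 0 1)
      (IndepOfFuture.integrable_prod_heat hW ht hF hFC A)
  rw [e1, e2, e3]
  have iq := hW.integrable_comp (by linarith : 0 ≤ t + h) hq hqC
  have ip := hW.integrable_comp ht hp hpC
  have eq := hA.setIntegral_comp hW ht hth hq iq
  have e4 : ∀ x, ∫ r in (0 : ℝ)..h, ∫ w, F (x + √r * w) ∂gaussianReal 0 1 =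
      (∫ w, q (x + w) ∂gaussianReal 0 h.toNNReal) - p x := by
    intro x
    rw [heat x, add_sub_cancel_left]
    refine intervalIntegral.integral_congr fun r hr => ?_
    rw [Set.uIcc_of_le hh] at hr
    exact (integral_add_gaussianReal F x hr.1).symm
  simp_rw [e4]
  have ig : IntegrableOn (fun ω => ∫ w, q (W t ω + w) ∂gaussianReal 0 h.toNNReal) A Q := by
    have h0 : IndepFun (W t) (fun ω => W (t + h) ω - W t ω) Q :=
      (hA.indep _ hth).comp (φ := Prod.snd) (ψ := id) measurable_snd measurable_id
    have hl := hW.law_sub t (t + h) ht hth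
    rw [add_sub_cancel_left] at hl
    refine (h0.integral_comp_prod (hW.meas t).aemeasurable hl
      (f := fun p => q (p.1 + p.2)) (by fun_prop) ?_).1.integrableOn
    exact iq.congr (ae_of_all _ fun ω => by simp)
  rw [add_sub_cancel_left] at eq
  rw [integral_sub ig ip.integrableOn, ← eq, integral_sub iq.integrableOn ip.integrableOn]

-- As the sets decrease, ω belongs to exactly the first K of them for some K ≤ n, so the left side
-- telescopes to p K - p 0 and the sum on the right equals K. This is optional stopping, pathwise.
omit [MeasurableSpace Ω] in
lemma sum_indicator_sub_le {A : ℕ → Set Ω} (hA : Antitone A) (n : ℕ) {p : ℕ → ℝ} {κ : ℝ}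
    (hp : ∀ k ≤ n, p k - p 0 ≤ κ * k) (ω : Ω) :
    ∑ k ∈ Finset.range n, (A k).indicator (fun _ => p (k + 1) - p k) ω ≤
      κ * ∑ k ∈ Finset.range n, (A k).indicator (fun _ => (1 : ℝ)) ω := by
  have key : ∀ m, ∃ K ≤ m, ∑ k ∈ Finset.range m, (A k).indicator (fun _ => p (k + 1) - p k) ω =
      p K - p 0 ∧ ∑ k ∈ Finset.range m, (A k).indicator (fun _ => (1 : ℝ)) ω = K ∧
      (K < m → ω ∉ A m) := by
    intro m
    induction m with
    | zero => exact ⟨0, le_rfl, by simp, by simp, by simp⟩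
    | succ m ih =>
      obtain ⟨K, hK, h1, h2, h3⟩ := ih
      simp only [Finset.sum_range_succ, h1, h2]
      by_cases hm : ω ∈ A m
      · have : K = m := by
          by_contra hne
          exact h3 (lt_of_le_of_ne hK hne) hm
        subst this
        exact ⟨K + 1, le_rfl, by simp [hm], by simp [hm], by simp⟩
      · exact ⟨K, hK.trans m.le_succ, by simp [hm], by simp [hm],
          fun _ h => hm (hA m.le_succ h)⟩
  obtain ⟨K, hK, h1, h2, -⟩ := key n
  rw [h1, h2]
  exact hp K hK

/-- A bound for `E ∫₀^τ F(W_s) ds` for a stopping time `τ = n⁻¹ ∑ 1_{A k}` on a grid. -/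
theorem sum_setIntegral_le_of_heat (hW : IsContBrownian W Q) {n : ℕ} (hn : 0 < n) {A : ℕ → Set Ω}
    (hA : Antitone A) (hI : ∀ k < n, IndepOfFuture W Q (A k) (k / n)) {F : ℝ → ℝ}
    {p : ℝ → ℝ → ℝ} (hF : Measurable F) (hp : ∀ t, Measurable (p t)) {C κ : ℝ}
    (hFC : ∀ x, |F x| ≤ C * (1 + x ^ 4))
    (hpC : ∀ t x, 0 ≤ t → t ≤ 1 → |p t x| ≤ C * (1 + x ^ 4))
    (heat : ∀ t h x, 0 ≤ t → 0 ≤ h → ∫ w, p (t + h) (x + w) ∂gaussianReal 0 h.toNNReal =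
      p t x + ∫ r in (0 : ℝ)..h, ∫ w, F (x + w) ∂gaussianReal 0 r.toNNReal)
    (hp0 : p 0 0 = 0) (hle : ∀ t x, 0 ≤ t → t ≤ 1 → p t x ≤ κ * t) :
    ∑ k ∈ Finset.range n, ∫ ω in A k, (∫ s in ((k : ℝ) / n)..((k + 1 : ℝ) / n), F (W s ω)) ∂Q ≤
      κ * (1 / n * ∑ k ∈ Finset.range n, Q.real (A k)) := by
  have hn' : (0 : ℝ) < n := by exact_mod_cast hn
  have e : ∀ k : ℕ, ((k + 1 : ℝ) / n) = k / n + 1 / n := fun k => by ring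
  have e' : ∀ k : ℕ, (((k + 1 : ℕ) : ℝ) / n) = k / n + 1 / n := fun k => by push_cast; ring
  have hk1 : ∀ k : ℕ, k ≤ n → (k : ℝ) / n ≤ 1 := fun k hk => by
    rw [div_le_one hn']; exact_mod_cast hk
  have hint : ∀ k : ℕ, k ≤ n → Integrable (fun ω => p (k / n) (W (k / n) ω)) Q := fun k hk =>
    hW.integrable_comp (by positivity) (hp _) fun x => hpC _ x (by positivity) (hk1 k hk)
  have hstep : ∀ k ∈ Finset.range n,
      ∫ ω in A k, (∫ s in ((k : ℝ) / n)..((k + 1 : ℝ) / n), F (W s ω)) ∂Q =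
        ∫ ω, (A k).indicator (fun ω => p ((k + 1 : ℕ) / n) (W ((k + 1 : ℕ) / n) ω) -
          p (k / n) (W (k / n) ω)) ω ∂Q := by
    intro k hk
    have hk := Finset.mem_range.1 hk
    rw [integral_indicator (hI k hk).meas, e, e']
    refine (hI k hk).dynkin_step hW (by positivity) (by positivity) hF (hp _) (hp _) hFC
      (fun x => hpC _ x (by positivity) (hk1 k hk.le)) (fun x => hpC _ x (by positivity) ?_)
      fun x => heat _ _ x (by positivity) (by positivity)
    rw [← e']
    exact hk1 _ hk
  rw [Finset.sum_congr rfl hstep, ← integral_finsetSum]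
  · have : κ * (1 / n * ∑ k ∈ Finset.range n, Q.real (A k)) =
        ∫ ω, κ / n * ∑ k ∈ Finset.range n, (A k).indicator (fun _ => (1 : ℝ)) ω ∂Q := by
      rw [integral_const_mul, integral_finsetSum]
      · rw [← mul_assoc, mul_one_div]
        congr 1
        refine Finset.sum_congr rfl fun k hk => ?_
        rw [integral_indicator_const _ (hI k (Finset.mem_range.1 hk)).meas]
        simp
      · intro k hk
        exact (integrable_const _).indicator (hI k (Finset.mem_range.1 hk)).meas
    rw [this]
    refine integral_mono_ae ?_ ?_ ?_
    · refine integrable_finsetSum _ fun k hk => ?_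
      have hk := Finset.mem_range.1 hk
      exact ((hint (k + 1) hk).sub (hint k hk.le)).indicator (hI k hk).meas
    · refine (integrable_finsetSum _ fun k hk => ?_).const_mul _
      exact (integrable_const _).indicator (hI k (Finset.mem_range.1 hk)).meas
    · filter_upwards [hW.zero] with ω h0
      refine sum_indicator_sub_le hA n (p := fun k => p (k / n) (W (k / n) ω)) (fun k hk => ?_) ω
      have := hle (k / n) (W (k / n) ω) (by positivity) (hk1 k hk)
      simp only [Nat.cast_zero, zero_div, h0, hp0]
      calc _ ≤ κ * (k / n) := by linarith
        _ = _ := by ring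
  · intro k hk
    have hk := Finset.mem_range.1 hk
    exact ((hint (k + 1) hk).sub (hint k hk.le)).indicator (hI k hk).meas

end Core

/-! ### Quartic polynomials, and windows around a level. -/

lemma integral_quartic_add_gaussianReal (c₀ c₁ c₂ c₃ c₄ x : ℝ) {r : ℝ} (hr : 0 ≤ r) :
    ∫ w, (c₀ + c₁ * (x + w) + c₂ * (x + w) ^ 2 + c₃ * (x + w) ^ 3 + c₄ * (x + w) ^ 4)
        ∂gaussianReal 0 r.toNNReal =
      c₀ + c₁ * x + c₂ * x ^ 2 + c₃ * x ^ 3 + c₄ * x ^ 4 +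
        (c₂ + 3 * c₃ * x + 6 * c₄ * x ^ 2) * r + 3 * c₄ * r ^ 2 := by
  rw [← integral_quartic_gaussianReal _ (c₁ + 2 * c₂ * x + 3 * c₃ * x ^ 2 + 4 * c₄ * x ^ 3) _
    (c₃ + 4 * c₄ * x) _ hr]
  congr 1 with w
  ring

lemma abs_quartic_le {c₀ c₁ c₂ c₃ c₄ M : ℝ} (h₀ : |c₀| ≤ M) (h₁ : |c₁| ≤ M) (h₂ : |c₂| ≤ M)
    (h₃ : |c₃| ≤ M) (h₄ : |c₄| ≤ M) (x : ℝ) :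
    |c₀ + c₁ * x + c₂ * x ^ 2 + c₃ * x ^ 3 + c₄ * x ^ 4| ≤ 5 * M * (1 + x ^ 4) := by
  have hM : 0 ≤ M := (abs_nonneg _).trans h₀
  have k : ∀ {c y : ℝ}, |c| ≤ M → |y| ≤ 1 + x ^ 4 → |c * y| ≤ M * (1 + x ^ 4) := by
    intro c y h h'
    rw [abs_mul]
    exact mul_le_mul h h' (abs_nonneg _) hM
  have p4 : 0 ≤ x ^ 4 := by positivity
  have x1 : |x| ≤ 1 + x ^ 4 := by
    rw [abs_le]
    constructor <;> nlinarith [sq_nonneg (x ^ 2 - 1 / 2), sq_nonneg (x - 1 / 2),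
      sq_nonneg (x + 1 / 2)]
  have x2 : |x ^ 2| ≤ 1 + x ^ 4 := by
    rw [abs_le]
    constructor <;> nlinarith [sq_nonneg (x ^ 2 - 1)]
  have x3 : |x ^ 3| ≤ 1 + x ^ 4 := by
    rw [abs_le]
    constructor <;> nlinarith [sq_nonneg (x ^ 2 - 1), sq_nonneg (x ^ 2 - x), sq_nonneg (x ^ 2 + x)]
  have x4 : |x ^ 4| ≤ 1 + x ^ 4 := by rw [abs_of_nonneg p4]; linarith
  have x0 : |c₀| ≤ M * (1 + x ^ 4) := h₀.trans (le_mul_of_one_le_right hM (by linarith))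
  refine (abs_add_le _ _).trans ?_
  have a1 := abs_add_le (c₀ + c₁ * x + c₂ * x ^ 2) (c₃ * x ^ 3)
  have a2 := abs_add_le (c₀ + c₁ * x) (c₂ * x ^ 2)
  have a3 := abs_add_le c₀ (c₁ * x)
  linarith [k h₁ x1, k h₂ x2, k h₃ x3, k h₄ x4]

/-- The density of the occupation measure of a path in the interval of radius `ε` about `c`. -/
noncomputable def windowDensity (c ε x : ℝ) : ℝ := if |x - c| < ε then 1 / (2 * ε) else 0

lemma windowDensity_nonneg {c ε : ℝ} (hε : 0 < ε) (x : ℝ) : 0 ≤ windowDensity c ε x := by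
  unfold windowDensity
  split_ifs <;> positivity

lemma windowDensity_le {c ε : ℝ} (hε : 0 < ε) (x : ℝ) : windowDensity c ε x ≤ 1 / (2 * ε) := by
  unfold windowDensity
  split_ifs
  · exact le_rfl
  · positivity

lemma measurable_windowDensity (c ε : ℝ) : Measurable (windowDensity c ε) :=
  Measurable.ite (measurableSet_lt (by fun_prop) measurable_const) measurable_const
    measurable_const

lemma intervalIntegrable_windowDensity (c : ℝ) {ε : ℝ} (hε : 0 < ε) {u : ℝ → ℝ}
    (hu : Measurable u) (a b : ℝ) :
    IntervalIntegrable (fun s => windowDensity c ε (u s)) volume a b := by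
  refine (intervalIntegrable_const (c := 1 / (2 * ε))).mono_fun'
    ((measurable_windowDensity c ε).comp hu).aestronglyMeasurable (ae_of_all _ fun s => ?_)
  show ‖windowDensity c ε (u s)‖ ≤ 1 / (2 * ε)
  rw [Real.norm_of_nonneg (windowDensity_nonneg hε _)]
  exact windowDensity_le hε _

/-- A continuous majorant of `windowDensity`. -/
noncomputable def trapezoid (c ε x : ℝ) : ℝ := 1 / (2 * ε) * max 0 (min 1 (2 - |x - c| / ε))

lemma continuous_trapezoid (c ε : ℝ) : Continuous (trapezoid c ε) := by
  unfold trapezoid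
  fun_prop

lemma trapezoid_nonneg {c ε : ℝ} (hε : 0 < ε) (x : ℝ) : 0 ≤ trapezoid c ε x :=
  mul_nonneg (by positivity) (le_max_left _ _)

lemma trapezoid_le {c ε : ℝ} (hε : 0 < ε) (x : ℝ) : trapezoid c ε x ≤ 1 / (2 * ε) := by
  unfold trapezoid
  exact mul_le_of_le_one_right (by positivity) (max_le zero_le_one (min_le_left _ _))

lemma trapezoid_eq_zero {c ε : ℝ} (hε : 0 < ε) {x : ℝ} (hx : 2 * ε ≤ |x - c|) :
    trapezoid c ε x = 0 := by
  unfold trapezoid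
  have : 2 ≤ |x - c| / ε := by rwa [le_div_iff₀ hε]
  rw [max_eq_left ((min_le_right _ _).trans (by linarith)), mul_zero]

lemma windowDensity_le_trapezoid {c ε : ℝ} (hε : 0 < ε) (x : ℝ) :
    windowDensity c ε x ≤ trapezoid c ε x := by
  unfold windowDensity
  split_ifs with h
  · unfold trapezoid
    have : |x - c| / ε ≤ 1 := by rw [div_le_one hε]; exact h.le
    rw [min_eq_left (by linarith), max_eq_right zero_le_one, mul_one]
  · exact trapezoid_nonneg hε x

/-- A convex function, flat to the left of `c - 2ε`, whose second derivative is `trapezoid`. -/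
lemma exists_trapezoid_primitive {c ε : ℝ} (hε : 0 < ε) (hc : 2 * ε < c) :
    ∃ f f' : ℝ → ℝ, (∀ x, HasDerivAt f (f' x) x) ∧
      (∀ x, HasDerivAt f' (trapezoid c ε x) x) ∧ (∀ x, 0 ≤ f' x) ∧ (∀ x, f' x ≤ 2) ∧ f 0 = 0 ∧
      (∀ x, 0 ≤ f x) ∧ ∀ x, f x ≤ x ^ 2 / (2 * (c - 2 * ε)) := by
  have hcont := continuous_trapezoid c ε
  set g := trapezoid c ε with hg
  set f' : ℝ → ℝ := fun x => ∫ y in (0 : ℝ)..x, g y with hf'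
  set f : ℝ → ℝ := fun x => ∫ y in (0 : ℝ)..x, f' y with hf
  have hd' : ∀ x, HasDerivAt f' (g x) x := fun x =>
    intervalIntegral.integral_hasDerivAt_right (hcont.intervalIntegrable _ _)
      (hcont.stronglyMeasurableAtFilter _ _) hcont.continuousAt
  have hcont' : Continuous f' := continuous_iff_continuousAt.2 fun x => (hd' x).continuousAt
  have hd : ∀ x, HasDerivAt f (f' x) x := fun x =>
    intervalIntegral.integral_hasDerivAt_right (hcont'.intervalIntegrable _ _)
      (hcont'.stronglyMeasurableAtFilter _ _) hcont'.continuousAt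
  have hg0 : ∀ x, x ≤ c - 2 * ε → g x = 0 := fun x hx =>
    trapezoid_eq_zero hε <| by
      have := neg_le_abs (x - c)
      linarith
  have hz' : ∀ x, x ≤ c - 2 * ε → f' x = 0 := by
    intro x hx
    refine intervalIntegral.integral_zero_ae (ae_of_all _ fun y hy => hg0 y ?_)
    rw [Set.mem_uIoc] at hy
    rcases hy with h | h
    · linarith [h.2]
    · linarith [h.2]
  have hmono : Monotone f' := monotone_of_deriv_nonneg (fun x => (hd' x).differentiableAt)
    fun x => by rw [(hd' x).deriv]; exact trapezoid_nonneg hε x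
  have hnn' : ∀ x, 0 ≤ f' x := by
    intro x
    rcases le_total x (c - 2 * ε) with h | h
    · rw [hz' x h]
    · rw [← hz' (c - 2 * ε) le_rfl]; exact hmono h
  have hle' : ∀ x, f' x ≤ 2 := by
    intro x
    rcases le_total x (c - 2 * ε) with h | h
    · rw [hz' x h]; norm_num
    · have hx0 : 0 ≤ x := by linarith
      -- A rectangle of width 4ε and height 1 / (2ε) has area 2; the final constants leave room for
      -- this crude bound.
      have hb : ∀ y, g y ≤ (Set.Icc (c - 2 * ε) (c + 2 * ε)).indicator (fun _ => 1 / (2 * ε)) y := by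
        intro y
        by_cases hy : y ∈ Set.Icc (c - 2 * ε) (c + 2 * ε)
        · rw [Set.indicator_of_mem hy]; exact trapezoid_le hε y
        · rw [Set.indicator_of_notMem hy]
          refine (trapezoid_eq_zero hε ?_).le
          by_contra hlt
          have := abs_lt.1 (not_le.1 hlt)
          exact hy ⟨by linarith, by linarith⟩
      have hint : Integrable ((Set.Icc (c - 2 * ε) (c + 2 * ε)).indicator
          (fun _ => 1 / (2 * ε))) := by
        rw [integrable_indicator_iff measurableSet_Icc]
        exact integrableOn_const (by simp)
      calc f' x = ∫ y in Set.Ioc 0 x, g y := intervalIntegral.integral_of_le hx0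
        _ ≤ ∫ y in Set.Ioc 0 x, (Set.Icc (c - 2 * ε) (c + 2 * ε)).indicator
              (fun _ => 1 / (2 * ε)) y :=
            setIntegral_mono_on (hcont.integrableOn_Ioc) hint.integrableOn measurableSet_Ioc
              fun y _ => hb y
        _ ≤ ∫ y, (Set.Icc (c - 2 * ε) (c + 2 * ε)).indicator (fun _ => 1 / (2 * ε)) y :=
            setIntegral_le_integral hint (ae_of_all _ fun y =>
              Set.indicator_nonneg (fun _ _ => by positivity) y)
        _ = 2 := by
            rw [integral_indicator measurableSet_Icc, setIntegral_const]
            simp only [measureReal_def, Real.volume_Icc, smul_eq_mul]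
            rw [ENNReal.toReal_ofReal (by linarith)]
            field_simp
            ring
  have hz : ∀ x, x ≤ c - 2 * ε → f x = 0 := by
    intro x hx
    refine intervalIntegral.integral_zero_ae (ae_of_all _ fun y hy => hz' y ?_)
    rw [Set.mem_uIoc] at hy
    rcases hy with h | h
    · linarith [h.2]
    · linarith [h.2]
  have hfmono : Monotone f := monotone_of_deriv_nonneg (fun x => (hd x).differentiableAt)
    fun x => by rw [(hd x).deriv]; exact hnn' x
  refine ⟨f, f', hd, hd', hnn', hle', by simp [hf], fun x => ?_, fun x => ?_⟩
  · rcases le_total x (c - 2 * ε) with h | h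
    · rw [hz x h]
    · rw [← hz (c - 2 * ε) le_rfl]; exact hfmono h
  · have hcpos : 0 < c - 2 * ε := by linarith
    rcases le_total x (c - 2 * ε) with h | h
    · rw [hz x h]; positivity
    · have h1 := (convex_univ (𝕜 := ℝ)).norm_image_sub_le_of_norm_hasDerivWithin_le (C := 2)
        (fun x _ => (hd x).hasDerivWithinAt)
        (fun x _ => by rw [Real.norm_of_nonneg (hnn' x)]; exact hle' x)
        (Set.mem_univ (c - 2 * ε)) (Set.mem_univ x)
      rw [hz _ le_rfl, sub_zero, Real.norm_eq_abs, Real.norm_eq_abs,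
        abs_of_nonneg (by linarith : 0 ≤ x - (c - 2 * ε))] at h1
      refine (le_abs_self _).trans (h1.trans ?_)
      -- With d = c - 2ε the claim is 4 d (x - d) ≤ x², that is, (x - 2d)² ≥ 0.
      rw [le_div_iff₀ (by positivity)]
      nlinarith [sq_nonneg (x - 2 * (c - 2 * ε))]

/-- The Gaussian density is at most 1 / √(2πr), and the window has total mass one. The bound is
uniform in ε and integrable in r near 0. -/
lemma integral_windowDensity_gaussianReal_le (c x : ℝ) {ε r : ℝ} (hε : 0 < ε) (hr : 0 < r) :
    ∫ w, windowDensity c ε (x + w) ∂gaussianReal 0 r.toNNReal ≤ (√(2 * Real.pi))⁻¹ * r ^ (-(1 / 2) : ℝ) := by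
  have hr0 : r.toNNReal ≠ 0 := by simpa using hr
  have e : (fun w => windowDensity c ε (x + w)) =
      (Set.Ioo (c - x - ε) (c - x + ε)).indicator (fun _ => 1 / (2 * ε)) := by
    ext w
    unfold windowDensity
    by_cases h : |x + w - c| < ε
    · rw [if_pos h, Set.indicator_of_mem]
      have := abs_lt.1 h
      exact ⟨by linarith, by linarith⟩
    · rw [if_neg h, Set.indicator_of_notMem]
      rintro ⟨h1, h2⟩
      exact h (abs_lt.2 ⟨by linarith, by linarith⟩)
  rw [e, integral_indicator measurableSet_Ioo, setIntegral_const, smul_eq_mul]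
  have hb : (gaussianReal 0 r.toNNReal).real (Set.Ioo (c - x - ε) (c - x + ε)) ≤
      (√(2 * Real.pi * r))⁻¹ * (2 * ε) := by
    rw [measureReal_def]
    refine ENNReal.toReal_le_of_le_ofReal (by positivity) ?_
    rw [gaussianReal_apply _ hr0]
    calc ∫⁻ y in Set.Ioo (c - x - ε) (c - x + ε), gaussianPDF 0 r.toNNReal y
        ≤ ∫⁻ _ in Set.Ioo (c - x - ε) (c - x + ε), ENNReal.ofReal (√(2 * Real.pi * r))⁻¹ := by
          refine lintegral_mono fun y => ENNReal.ofReal_le_ofReal ?_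
          rw [gaussianPDFReal_def]
          simp only [Real.coe_toNNReal r hr.le]
          refine mul_le_of_le_one_right (by positivity) (Real.exp_le_one_iff.2 ?_)
          rw [neg_div]
          exact neg_nonpos.2 (by positivity)
      _ = _ := by
          rw [setLIntegral_const, Real.volume_Ioo, ← ENNReal.ofReal_mul (by positivity)]
          congr 2
          ring
  calc _ ≤ (√(2 * Real.pi * r))⁻¹ * (2 * ε) * (1 / (2 * ε)) := by gcongr
    _ = (√(2 * Real.pi))⁻¹ * r ^ (-(1 / 2) : ℝ) := by
      rw [Real.sqrt_mul (by positivity), Real.rpow_neg hr.le, ← Real.sqrt_eq_rpow]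
      field_simp

/-! ### Expectations bounded by multiples of E τ. -/

section Core

variable {Ω : Type*} [MeasurableSpace Ω] {W : ℝ → Ω → ℝ} {Q : Measure Ω} [IsProbabilityMeasure Q]

/-- `E ∫₀^τ W_s ds ≤ (19/20) E τ` for grid stopping times. -/
lemma sum_setIntegral_id_le (hW : IsContBrownian W Q) {n : ℕ} (hn : 0 < n) {A : ℕ → Set Ω}
    (hA : Antitone A) (hI : ∀ k < n, IndepOfFuture W Q (A k) (k / n)) :
    ∑ k ∈ Finset.range n, ∫ ω in A k, (∫ s in ((k : ℝ) / n)..((k + 1 : ℝ) / n), W s ω) ∂Q ≤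
      19 / 20 * (1 / n * ∑ k ∈ Finset.range n, Q.real (A k)) := by
  -- The natural choice t x - (x² - t)/2 gives only κ = 1, with equality at t = x = 1. Here p adds
  -- to it the martingale polynomials (3/25)(x³ - 3 t x) and -(1/50)(x⁴ - 6 t x² + 3 t²), which
  -- lowers κ to 19/20.
  refine sum_setIntegral_le_of_heat hW hn hA hI (F := fun x => x) (C := 5)
    (p := fun t x => (t / 2 - 3 / 50 * t ^ 2) + (16 / 25 * t) * x + (3 / 25 * t - 1 / 2) * x ^ 2 +
      3 / 25 * x ^ 3 + -(1 / 50) * x ^ 4)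
    measurable_id (fun t => by fun_prop) (fun x => ?_) (fun t x h0 h1 => ?_)
    (fun t h x _ hh => ?_) (by norm_num) (fun t x h0 h1 => ?_)
  · have := abs_quartic_le (c₀ := 0) (c₁ := 1) (c₂ := 0) (c₃ := 0) (c₄ := 0) (M := 1)
      (by simp) (by simp) (by simp) (by simp) (by simp) x
    simpa using this
  · have := abs_quartic_le (c₀ := t / 2 - 3 / 50 * t ^ 2) (c₁ := 16 / 25 * t)
      (c₂ := 3 / 25 * t - 1 / 2) (c₃ := 3 / 25) (c₄ := -(1 / 50)) (M := 1)
      (by rw [abs_le]; constructor <;> nlinarith) (by rw [abs_le]; constructor <;> nlinarith)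
      (by rw [abs_le]; constructor <;> nlinarith) (by rw [abs_le]; constructor <;> norm_num)
      (by rw [abs_le]; constructor <;> norm_num) x
    simpa using this
  · rw [integral_quartic_add_gaussianReal _ _ _ _ _ _ hh]
    have e : ∫ r in (0 : ℝ)..h, ∫ w, (x + w) ∂gaussianReal 0 r.toNNReal =
        ∫ _ in (0 : ℝ)..h, x := by
      refine intervalIntegral.integral_congr fun r hr => ?_
      rw [Set.uIcc_of_le hh] at hr
      have := integral_quartic_add_gaussianReal 0 1 0 0 0 x hr.1
      simpa using this
    rw [e, intervalIntegral.integral_const, smul_eq_mul]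
    ring
  -- The difference (19/20) t - p(t, x) equals (1 - t) x² q0 + t q1 + (3/50) t², with q0 and q1 the
  -- two polynomials below.
  · have q0 : 0 ≤ 1 / 2 - 3 / 25 * x + 1 / 50 * x ^ 2 := by nlinarith [sq_nonneg (x - 3)]
    have q1 : 0 ≤ 9 / 20 - 16 / 25 * x + 19 / 50 * x ^ 2 - 3 / 25 * x ^ 3 + 1 / 50 * x ^ 4 := by
      nlinarith [sq_nonneg (x ^ 2 - 3 * x + 2), sq_nonneg (x - 3 / 2), sq_nonneg (x - 2),
        sq_nonneg (x ^ 2 - 3 * x + 5 / 2)]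
    nlinarith [mul_nonneg (sub_nonneg.2 h1) (mul_nonneg (sq_nonneg x) q0), mul_nonneg h0 q1,
      sq_nonneg t]

/-- `E ∫₀^τ W_s² ds ≤ E τ` for grid stopping times. -/
lemma sum_setIntegral_sq_le (hW : IsContBrownian W Q) {n : ℕ} (hn : 0 < n) {A : ℕ → Set Ω}
    (hA : Antitone A) (hI : ∀ k < n, IndepOfFuture W Q (A k) (k / n)) :
    ∑ k ∈ Finset.range n, ∫ ω in A k, (∫ s in ((k : ℝ) / n)..((k + 1 : ℝ) / n), W s ω ^ 2) ∂Q ≤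
      1 * (1 / n * ∑ k ∈ Finset.range n, Q.real (A k)) := by
  -- Here p = t x² - t²/2 - (x² - t). Subtracting the martingale x² - t makes the coefficient of x²
  -- nonpositive for t ≤ 1.
  refine sum_setIntegral_le_of_heat hW hn hA hI (F := fun x => x ^ 2) (C := 5)
    (p := fun t x => (t - t ^ 2 / 2) + 0 * x + (t - 1) * x ^ 2 + 0 * x ^ 3 + 0 * x ^ 4)
    (by fun_prop) (fun t => by fun_prop) (fun x => ?_) (fun t x h0 h1 => ?_)
    (fun t h x _ hh => ?_) (by norm_num) (fun t x h0 h1 => ?_)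
  · have := abs_quartic_le (c₀ := 0) (c₁ := 0) (c₂ := 1) (c₃ := 0) (c₄ := 0) (M := 1)
      (by simp) (by simp) (by simp) (by simp) (by simp) x
    simpa using this
  · have := abs_quartic_le (c₀ := t - t ^ 2 / 2) (c₁ := 0) (c₂ := t - 1) (c₃ := 0) (c₄ := 0) (M := 1)
      (by rw [abs_le]; constructor <;> nlinarith) (by simp)
      (by rw [abs_le]; constructor <;> nlinarith) (by simp) (by simp) x
    simpa using this
  · rw [integral_quartic_add_gaussianReal _ _ _ _ _ _ hh]
    have e : ∫ r in (0 : ℝ)..h, ∫ w, (x + w) ^ 2 ∂gaussianReal 0 r.toNNReal =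
        ∫ r in (0 : ℝ)..h, (x ^ 2 + r) := by
      refine intervalIntegral.integral_congr fun r hr => ?_
      rw [Set.uIcc_of_le hh] at hr
      have := integral_quartic_add_gaussianReal 0 0 1 0 0 x hr.1
      simpa using this
    rw [e, intervalIntegral.integral_add (by simp) (by simp), intervalIntegral.integral_const,
      integral_id, smul_eq_mul]
    ring
  · nlinarith [mul_nonneg (sub_nonneg.2 h1) (sq_nonneg x), sq_nonneg t]

/-- The expected occupation density at a level `c > 0` up to a grid stopping time `τ` is at most
`E τ / c`, up to the radius of the window. -/
lemma sum_setIntegral_windowDensity_le (hW : IsContBrownian W Q) {n : ℕ} (hn : 0 < n)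
    {A : ℕ → Set Ω} (hA : Antitone A) (hI : ∀ k < n, IndepOfFuture W Q (A k) (k / n))
    {c ε : ℝ} (hε : 0 < ε) (hc : 2 * ε < c) :
    ∑ k ∈ Finset.range n, ∫ ω in A k,
        (∫ s in ((k : ℝ) / n)..((k + 1 : ℝ) / n), windowDensity c ε (W s ω)) ∂Q ≤
      1 / (c - 2 * ε) * (1 / n * ∑ k ∈ Finset.range n, Q.real (A k)) := by
  obtain ⟨f, f', h1, h2, hnn', hle', hf0, hnn, hle⟩ := exists_trapezoid_primitive hε hc
  have hc' : 0 < c - 2 * ε := by linarith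
  have hcf : Continuous f := continuous_iff_continuousAt.2 fun x => (h1 x).continuousAt
  have hct := continuous_trapezoid c ε
  set d := 1 / (2 * (c - 2 * ε)) with hd
  have hd0 : 0 < d := by positivity
  have hfd : ∀ x, f x ≤ d * x ^ 2 := fun x => (hle x).trans (by rw [hd]; apply le_of_eq; ring)
  set C := 5 * (d + 1 / (2 * ε)) with hC
  have he0 : 0 < 1 / (2 * ε) := by positivity
  have hgrow : ∀ x : ℝ, 1 ≤ 1 + x ^ 4 := fun x => by linarith [show 0 ≤ x ^ 4 by positivity]
  have hx2 : ∀ x : ℝ, x ^ 2 ≤ 1 + x ^ 4 := fun x => by nlinarith [sq_nonneg (x ^ 2 - 1)]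
  -- Here p = f(x) - d (x² - t): the heat operator sends f to f''/2 and annihilates x² - t, and f ≤
  -- d x² gives p ≤ d t.
  have key := sum_setIntegral_le_of_heat hW hn hA hI (F := fun x => trapezoid c ε x / 2) (C := C)
    (κ := d) (p := fun t x => f x + (d * t + 0 * x + (-d) * x ^ 2 + 0 * x ^ 3 + 0 * x ^ 4))
    (by fun_prop) (fun t => by fun_prop) (fun x => ?_) (fun t x h0 h1 => ?_)
    (fun t h x _ hh => ?_) (by simp [hf0]) (fun t x h0 h1 => ?_)
  · have hw : ∀ k ∈ Finset.range n, ∫ ω in A k,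
        (∫ s in ((k : ℝ) / n)..((k + 1 : ℝ) / n), windowDensity c ε (W s ω)) ∂Q ≤
        2 * ∫ ω in A k,
          (∫ s in ((k : ℝ) / n)..((k + 1 : ℝ) / n), trapezoid c ε (W s ω) / 2) ∂Q := by
      intro k _
      have hkk : (k : ℝ) / n ≤ (k + 1 : ℝ) / n := by gcongr; linarith
      rw [← integral_const_mul]
      have hb : ∀ {g : ℝ → ℝ}, Measurable g → (∀ x, |g x| ≤ 1 / (2 * ε)) →
          Integrable (fun ω => ∫ s in ((k : ℝ) / n)..((k + 1 : ℝ) / n), g (W s ω))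
            (Q.restrict (A k)) := by
        intro g hg hgb
        simp_rw [intervalIntegral.integral_of_le hkk]
        have := (hW.integrable_prod (a := (k : ℝ) / n) (b := (k + 1 : ℝ) / n) (by positivity) hg
          (C := 1 / (2 * ε)) fun x => (hgb x).trans (le_mul_of_one_le_right he0.le (hgrow x)))
        exact this.integral_prod_right.restrict
      have hwm := measurable_windowDensity c ε
      have hwb : ∀ x, |windowDensity c ε x| ≤ 1 / (2 * ε) := fun x => by
        rw [abs_of_nonneg (windowDensity_nonneg hε x)]; exact windowDensity_le hε x
      refine integral_mono (hb hwm hwb) ((hb (hct.div_const 2).measurable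
        fun x => ?_).const_mul 2) fun ω => ?_
      · rw [abs_of_nonneg (div_nonneg (trapezoid_nonneg hε x) zero_le_two)]
        linarith [trapezoid_le (c := c) hε x]
      · simp only
        rw [← intervalIntegral.integral_const_mul]
        have hcW := hW.cont ω
        refine intervalIntegral.integral_mono_on hkk ?_ ?_ fun s _ => ?_
        · exact intervalIntegrable_windowDensity c hε hcW.measurable _ _
        · exact Continuous.intervalIntegrable (by fun_prop) _ _
        · linarith [windowDensity_le_trapezoid (c := c) hε (W s ω)]
    refine (Finset.sum_le_sum hw).trans ?_
    rw [← Finset.mul_sum]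
    calc _ ≤ 2 * (d * (1 / n * ∑ k ∈ Finset.range n, Q.real (A k))) := by gcongr
      _ = _ := by rw [hd]; field_simp
  · rw [abs_of_nonneg (div_nonneg (trapezoid_nonneg hε x) zero_le_two)]
    calc _ ≤ 1 / (2 * ε) := by linarith [trapezoid_le (c := c) hε x, trapezoid_nonneg (c := c) hε x]
      _ ≤ C * 1 := by linarith
      _ ≤ C * (1 + x ^ 4) := by gcongr; exact hgrow x
  · have : |f x + (d * t + 0 * x + (-d) * x ^ 2 + 0 * x ^ 3 + 0 * x ^ 4)| ≤ d * (1 + x ^ 4) := by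
      rw [abs_le]
      constructor
      · nlinarith [hnn x, hx2 x, mul_nonneg hd0.le h0]
      · nlinarith [hfd x, hx2 x, hgrow x, mul_nonneg hd0.le (sub_nonneg.2 h1)]
    refine this.trans ?_
    gcongr
    linarith
  · have i1 : Integrable (fun w => f (x + w)) (gaussianReal 0 h.toNNReal) := by
      have := (((integrable_const (x ^ 2)).add (integrable_pow_gaussianReal h.toNNReal 2)).const_mul
        (2 * d))
      refine this.mono' (by fun_prop) (ae_of_all _ fun w => ?_)
      rw [Real.norm_of_nonneg (hnn _)]
      refine (hfd _).trans ?_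
      simp only [Pi.add_apply]
      nlinarith [mul_nonneg hd0.le (sq_nonneg (x - w))]
    have i2 : Integrable (fun w => d * (t + h) + 0 * (x + w) + (-d) * (x + w) ^ 2 +
        0 * (x + w) ^ 3 + 0 * (x + w) ^ 4) (gaussianReal 0 h.toNNReal) := by
      have j1 := integrable_pow_gaussianReal h.toNNReal 1
      have j2 := integrable_pow_gaussianReal h.toNNReal 2
      refine (((integrable_const (d * (t + h) - d * x ^ 2)).sub (j1.const_mul (2 * d * x))).sub
        (j2.const_mul d)).congr (ae_of_all _ fun w => ?_)
      simp only [Pi.sub_apply]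
      ring
    rw [integral_add i1 i2, integral_quartic_add_gaussianReal _ _ _ _ _ _ hh,
      integral_heat h1 h2 (M := max 2 (1 / (2 * ε)))
        (fun x => by rw [abs_of_nonneg (hnn' x)]; exact (hle' x).trans (le_max_left _ _))
        (fun x => by
          rw [abs_of_nonneg (trapezoid_nonneg hε x)]
          exact (trapezoid_le hε x).trans (le_max_right _ _)) hct x hh]
    ring
  · nlinarith [hfd x]

/-- The expected occupation density after time `t`, on an event independent of the future. -/
lemma IndepOfFuture.setIntegral_windowDensity_le {A : Set Ω} {t : ℝ} (hA : IndepOfFuture W Q A t)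
    (hW : IsContBrownian W Q) (ht : 0 ≤ t) (ht1 : t ≤ 1) (c : ℝ) {ε : ℝ} (hε : 0 < ε) :
    ∫ ω in A, (∫ s in t..1, windowDensity c ε (W s ω)) ∂Q ≤ 4 / 5 * Q.real A := by
  have hwm := measurable_windowDensity c ε
  have hC : ∀ x, |windowDensity c ε x| ≤ 1 / (2 * ε) * (1 + x ^ 4) := fun x => by
    rw [abs_of_nonneg (windowDensity_nonneg hε x)]
    refine (windowDensity_le hε x).trans (le_mul_of_one_le_right (by positivity) ?_)
    linarith [show 0 ≤ x ^ 4 by positivity]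
  have hsw : ∫ ω in A, (∫ s in t..1, windowDensity c ε (W s ω)) ∂Q =
      ∫ s in t..1, ∫ ω in A, windowDensity c ε (W s ω) ∂Q := by
    simp_rw [intervalIntegral.integral_of_le ht1]
    refine integral_integral_swap (f := fun ω s => windowDensity c ε (W s ω)) ?_
    refine (hW.integrable_prod (b := 1) ht hwm hC).swap.mono_measure ?_
    exact Measure.prod_mono Measure.restrict_le_self le_rfl
  have hir : IntervalIntegrable (fun s => (√(2 * Real.pi))⁻¹ * (s - t) ^ (-(1 / 2) : ℝ) * Q.real A)
      volume t 1 := by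
    have := (intervalIntegral.intervalIntegrable_rpow' (a := 0) (b := 1 - t)
      (by norm_num : (-1 : ℝ) < -(1 / 2))).comp_sub_right t
    simp only [zero_add, sub_add_cancel] at this
    exact (this.const_mul _).mul_const _
  rw [hsw]
  calc ∫ s in t..1, ∫ ω in A, windowDensity c ε (W s ω) ∂Q
      ≤ ∫ s in t..1, (√(2 * Real.pi))⁻¹ * (s - t) ^ (-(1 / 2) : ℝ) * Q.real A := by
        refine intervalIntegral.integral_mono_on_of_le_Ioo ht1 ?_ hir fun s hs => ?_
        · rw [intervalIntegrable_iff_integrableOn_Ioc_of_le ht1]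
          refine Integrable.integral_prod_left (f := fun p : ℝ × Ω => windowDensity c ε (W p.1 p.2)) ?_
          refine (hW.integrable_prod (b := 1) ht hwm hC).mono_measure ?_
          exact Measure.prod_mono le_rfl Measure.restrict_le_self
        · rw [hA.setIntegral_comp hW ht hs.1.le hwm
            (hW.integrable_comp (ht.trans hs.1.le) hwm hC)]
          have hs' : 0 < s - t := sub_pos.2 hs.1
          calc _ ≤ ∫ _ in A, (√(2 * Real.pi))⁻¹ * (s - t) ^ (-(1 / 2) : ℝ) ∂Q := by
                refine integral_mono_of_nonneg (ae_of_all _ fun ω =>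
                  integral_nonneg fun w => windowDensity_nonneg hε _) (integrable_const _)
                  (ae_of_all _ fun ω => ?_)
                exact integral_windowDensity_gaussianReal_le c _ hε hs'
            _ = _ := by rw [setIntegral_const, smul_eq_mul, mul_comm]
    _ = (√(2 * Real.pi))⁻¹ * (2 * √(1 - t)) * Q.real A := by
        rw [intervalIntegral.integral_mul_const, intervalIntegral.integral_const_mul,
          intervalIntegral.integral_comp_sub_right (fun r => r ^ (-(1 / 2) : ℝ)) t, sub_self,
          integral_rpow (Or.inl (by norm_num)), Real.sqrt_eq_rpow (1 - t),
          show (-(1 / 2) + 1 : ℝ) = 1 / 2 by norm_num, Real.zero_rpow (by norm_num)]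
        ring
    _ ≤ 4 / 5 * Q.real A := by
        -- From π > 3.14 one has 2π > 25/4, so 2 / √(2π) ≤ 4/5.
        have h25 : (5 / 2 : ℝ) ≤ √(2 * Real.pi) :=
          Real.le_sqrt_of_sq_le (by nlinarith [Real.pi_gt_d2])
        have h1 : √(1 - t) ≤ 1 := Real.sqrt_le_one.2 (by linarith)
        have h2 : (√(2 * Real.pi))⁻¹ ≤ 2 / 5 := by
          rw [inv_le_comm₀ (by positivity) (by norm_num)]
          linarith
        have h3 : (√(2 * Real.pi))⁻¹ * (2 * √(1 - t)) ≤ 2 / 5 * (2 * 1) := by gcongr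
        have h4 : 0 ≤ Q.real A := measureReal_nonneg
        nlinarith

/-- The expectation of `τ` times the occupation density at level `c` over `[0, 1]`, for a grid
stopping time `τ`. -/
lemma sum_setIntegral_total_windowDensity_le (hW : IsContBrownian W Q) {n : ℕ} (hn : 0 < n)
    {A : ℕ → Set Ω} (hA : Antitone A) (hI : ∀ k < n, IndepOfFuture W Q (A k) (k / n))
    {c ε : ℝ} (hε : 0 < ε) (hc : 2 * ε < c) :
    1 / n * ∑ k ∈ Finset.range n, ∫ ω in A k,
        (∫ s in (0 : ℝ)..1, windowDensity c ε (W s ω)) ∂Q ≤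
      (4 / 5 + 1 / (c - 2 * ε)) * (1 / n * ∑ k ∈ Finset.range n, Q.real (A k)) := by
  have hn' : (0 : ℝ) < n := by exact_mod_cast hn
  have hwm := measurable_windowDensity c ε
  have hwb : ∀ x, ‖windowDensity c ε x‖ ≤ 1 / (2 * ε) := fun x => by
    rw [Real.norm_of_nonneg (windowDensity_nonneg hε x)]; exact windowDensity_le hε x
  have hii : ∀ (ω : Ω) (a b : ℝ),
      IntervalIntegrable (fun s => windowDensity c ε (W s ω)) volume a b :=
    fun ω a b => intervalIntegrable_windowDensity c hε (hW.cont ω).measurable a b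
  have hio : ∀ (a b : ℝ), 0 ≤ a → a ≤ b → Integrable (fun ω => ∫ s in a..b,
      windowDensity c ε (W s ω)) Q := by
    intro a b ha hab
    simp_rw [intervalIntegral.integral_of_le hab]
    refine (hW.integrable_prod (b := b) ha hwm (C := 1 / (2 * ε)) fun x => ?_).integral_prod_right
    refine (hwb x).trans (le_mul_of_one_le_right (by positivity) ?_)
    linarith [show 0 ≤ x ^ 4 by positivity]
  set S := ∑ k ∈ Finset.range n, ∫ ω in A k,
    (∫ s in ((k : ℝ) / n)..((k + 1 : ℝ) / n), windowDensity c ε (W s ω)) ∂Q with hS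
  have hSle : S ≤ 1 / (c - 2 * ε) * (1 / n * ∑ k ∈ Finset.range n, Q.real (A k)) :=
    sum_setIntegral_windowDensity_le hW hn hA hI hε hc
  have hcell : ∀ (B : Set Ω) (i : ℕ), 0 ≤ ∫ ω in B,
      (∫ s in ((i : ℝ) / n)..((i + 1 : ℝ) / n), windowDensity c ε (W s ω)) ∂Q := fun B i =>
    integral_nonneg fun ω => intervalIntegral.integral_nonneg (by gcongr; linarith)
      fun s _ => windowDensity_nonneg hε _
  -- On A k, that is, for k/n < τ, the interval [0, 1] is cut at k/n. The part before k/n is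
  -- contained in the occupation up to τ, bounded by S; the part after it is bounded through the
  -- independence of the future.
  have hterm : ∀ k ∈ Finset.range n, ∫ ω in A k,
      (∫ s in (0 : ℝ)..1, windowDensity c ε (W s ω)) ∂Q ≤ S + 4 / 5 * Q.real (A k) := by
    intro k hk
    have hkn := Finset.mem_range.1 hk
    have hk1 : (k : ℝ) / n ≤ 1 := by
      rw [div_le_one hn']; exact_mod_cast hkn.le
    have hsplit : ∀ ω, ∫ s in (0 : ℝ)..1, windowDensity c ε (W s ω) =
        (∑ i ∈ Finset.range k, ∫ s in ((i : ℝ) / n)..((i + 1 : ℝ) / n),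
          windowDensity c ε (W s ω)) + ∫ s in ((k : ℝ) / n)..1, windowDensity c ε (W s ω) := by
      intro ω
      have := intervalIntegral.sum_integral_adjacent_intervals (n := k)
        (a := fun i : ℕ => (i : ℝ) / n) (f := fun s => windowDensity c ε (W s ω)) (μ := volume)
        fun i _ => hii ω _ _
      simp only [Nat.cast_add, Nat.cast_one, Nat.cast_zero, zero_div] at this
      rw [this, intervalIntegral.integral_add_adjacent_intervals (hii ω _ _) (hii ω _ _)]
    simp_rw [hsplit]
    have hic : ∀ i : ℕ, Integrable (fun ω => ∫ s in ((i : ℝ) / n)..((i + 1 : ℝ) / n),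
        windowDensity c ε (W s ω)) Q := fun i => hio _ _ (by positivity) (by gcongr; linarith)
    rw [integral_add (integrable_finsetSum _ fun i _ => (hic i).restrict)
      (hio _ _ (by positivity) hk1).restrict, integral_finsetSum _ fun i _ => (hic i).restrict]
    refine add_le_add ?_ ((hI k hkn).setIntegral_windowDensity_le hW (by positivity) hk1 c hε)
    calc _ ≤ ∑ i ∈ Finset.range k, ∫ ω in A i,
          (∫ s in ((i : ℝ) / n)..((i + 1 : ℝ) / n), windowDensity c ε (W s ω)) ∂Q := by
          refine Finset.sum_le_sum fun i hi => ?_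
          refine setIntegral_mono_set (hic i).integrableOn (ae_of_all _ fun ω => ?_)
            (hA (Finset.mem_range.1 hi).le).eventuallyLE
          exact intervalIntegral.integral_nonneg (by gcongr; linarith)
            fun s _ => windowDensity_nonneg hε _
      _ ≤ S := Finset.sum_le_sum_of_subset_of_nonneg
          (Finset.range_subset_range.2 hkn.le) fun i _ _ => hcell _ i
  calc _ ≤ 1 / n * ∑ k ∈ Finset.range n, (S + 4 / 5 * Q.real (A k)) := by
        gcongr with k hk
        exact hterm k hk
    _ = S + 4 / 5 * (1 / n * ∑ k ∈ Finset.range n, Q.real (A k)) := by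
        rw [Finset.sum_add_distrib, ← Finset.mul_sum, Finset.sum_const, Finset.card_range,
          nsmul_eq_mul]
        field_simp
    _ ≤ _ := by linarith

end Core

/-! ### Local time: measurability and expectation. -/

lemma localTime_mono (X : ℝ≥0 → ℝ) (a : ℝ) {t u : ℝ≥0∞} (h : t ≤ u) :
    localTime X a t ≤ localTime X a u := by
  refine liminf_le_liminf (.of_forall fun ε => ?_)
  refine ENNReal.div_le_div_right (measure_mono ?_) _
  rintro s ⟨h1, h2, h3⟩
  exact ⟨h1, h2.trans h, h3⟩

/-- A lower limit at `0+` of a monotone function divided by `2ε` is determined by rational `ε`. -/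
lemma liminf_div_eq_iSup_iInf_rat {g : ℝ → ℝ≥0∞} (hg : Monotone g) :
    liminf (fun ε => g ε / ENNReal.ofReal (2 * ε)) (𝓝[>] (0 : ℝ)) =
      ⨆ n : ℕ, ⨅ q : ℚ, ⨅ _ : 0 < q ∧ (q : ℝ) < 1 / (n + 1), g q / ENNReal.ofReal (2 * q) := by
  rw [(nhdsGT_basis (0 : ℝ)).liminf_eq_iSup_iInf]
  refine le_antisymm (iSup₂_le fun b hb => ?_) (iSup_le fun n => ?_)
  · obtain ⟨n, hn⟩ := exists_nat_one_div_lt hb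
    refine le_iSup_of_le n (le_iInf₂ fun q hq => ?_)
    exact iInf₂_le_of_le (q : ℝ) ⟨by exact_mod_cast hq.1, hq.2.trans hn⟩ le_rfl
  · refine le_iSup₂_of_le (1 / ((n : ℝ) + 1)) (by positivity) (le_iInf₂ fun ε hε => ?_)
    -- Rationals are taken increasing to ε: the numerators stay below g ε by monotonicity and the
    -- denominators converge, so no continuity of g is needed.
    obtain ⟨u, -, hu, hlim⟩ := Real.exists_seq_rat_strictMono_tendsto ε
    have ht : Tendsto (fun k => g ε / ENNReal.ofReal (2 * (u k : ℝ))) atTop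
        (𝓝 (g ε / ENNReal.ofReal (2 * ε))) := by
      refine ENNReal.Tendsto.const_div (ENNReal.tendsto_ofReal (hlim.const_mul 2)) ?_
      exact Or.inl ENNReal.ofReal_ne_top
    refine ge_of_tendsto ht ?_
    filter_upwards [hlim.eventually_const_lt hε.1] with k hk
    refine iInf₂_le_of_le (u k) ⟨by exact_mod_cast hk, (hu k).trans hε.2⟩ ?_
    exact ENNReal.div_le_div_right (hg (hu k).le) _

lemma measurable_localTime {Ω : Type*} [MeasurableSpace Ω] {X : ℝ≥0 → Ω → ℝ}
    (hX : Measurable (Function.uncurry X)) (a : ℝ) {T : Ω → ℝ≥0∞} (hT : Measurable T) :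
    Measurable fun ω => localTime (fun t => X t ω) a (T ω) := by
  have hmono : ∀ ω, Monotone fun ε : ℝ =>
      volume {s : ℝ | 0 ≤ s ∧ ENNReal.ofReal s ≤ T ω ∧ |X s.toNNReal ω - a| < ε} := by
    intro ω ε ε' h
    refine measure_mono ?_
    rintro s ⟨h1, h2, h3⟩
    exact ⟨h1, h2, h3.trans_le h⟩
  have e : (fun ω => localTime (fun t => X t ω) a (T ω)) = fun ω => ⨆ n : ℕ, ⨅ q : ℚ,
      ⨅ _ : 0 < q ∧ (q : ℝ) < 1 / (n + 1),
        volume {s : ℝ | 0 ≤ s ∧ ENNReal.ofReal s ≤ T ω ∧ |X s.toNNReal ω - a| < (q : ℝ)} /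
          ENNReal.ofReal (2 * q) := by
    ext ω
    exact liminf_div_eq_iSup_iInf_rat (hmono ω)
  rw [e]
  refine Measurable.iSup fun n => Measurable.iInf fun q => Measurable.iInf fun _ => ?_
  refine Measurable.div_const ?_ _
  have hXs : Measurable fun p : Ω × ℝ => X p.2.toNNReal p.1 :=
    hX.comp ((measurable_real_toNNReal.comp measurable_snd).prodMk measurable_fst)
  have hs : MeasurableSet {p : Ω × ℝ | 0 ≤ p.2 ∧ ENNReal.ofReal p.2 ≤ T p.1 ∧
      |X p.2.toNNReal p.1 - a| < (q : ℝ)} :=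
    (measurableSet_le measurable_const measurable_snd).inter
      ((measurableSet_le (ENNReal.measurable_ofReal.comp measurable_snd)
        (hT.comp measurable_fst)).inter
      (measurableSet_lt (by simpa using (hXs.sub_const a).abs) measurable_const))
  exact measurable_measure_prodMk_left hs

lemma occupation_eq {u : ℝ → ℝ} (hu : Measurable u) (a : ℝ) {ε : ℝ} (hε : 0 < ε) :
    volume {s : ℝ | 0 ≤ s ∧ ENNReal.ofReal s ≤ 1 ∧ |u s - a| < ε} / ENNReal.ofReal (2 * ε) =
      ENNReal.ofReal (∫ s in (0 : ℝ)..1, windowDensity a ε (u s)) := by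
  have hE : MeasurableSet {s | |u s - a| < ε} :=
    measurableSet_lt (by simpa using (hu.sub_const a).abs) measurable_const
  have hset : {s : ℝ | 0 ≤ s ∧ ENNReal.ofReal s ≤ 1 ∧ |u s - a| < ε} =
      {s | |u s - a| < ε} ∩ Set.Icc 0 1 := by
    ext s
    simp only [Set.mem_ofPred_eq, Set.mem_inter_iff, Set.mem_Icc, ENNReal.ofReal_le_one]
    tauto
  have hind : (fun s => windowDensity a ε (u s)) =
      {s | |u s - a| < ε}.indicator fun _ => 1 / (2 * ε) := by
    ext s
    by_cases h : |u s - a| < ε <;> simp [windowDensity, h]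
  rw [hset, ← Measure.restrict_apply hE, ← Measure.restrict_congr_set Ioc_ae_eq_Icc, hind,
    intervalIntegral.integral_of_le zero_le_one, integral_indicator hE, setIntegral_const,
    smul_eq_mul, ENNReal.ofReal_mul measureReal_nonneg, measureReal_def,
    ENNReal.ofReal_toReal (measure_ne_top _ _), one_div,
    ENNReal.ofReal_inv_of_pos (by positivity), ENNReal.div_eq_inv_mul, mul_comm]

/-- Fatou's lemma for the local time at time `1`. -/
lemma lintegral_localTime_le {Ω : Type*} [MeasurableSpace Ω] {X : ℝ≥0 → Ω → ℝ}
    (hX : Measurable (Function.uncurry X)) (a : ℝ) (μ : Measure Ω) {K : ℝ → ℝ} {K₀ : ℝ}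
    (hK : Tendsto K (𝓝[>] 0) (𝓝 K₀))
    (h : ∀ᶠ ε in 𝓝[>] 0, ∫⁻ ω, ENNReal.ofReal
      (∫ s in (0 : ℝ)..1, windowDensity a ε (X s.toNNReal ω)) ∂μ ≤ ENNReal.ofReal (K ε)) :
    ∫⁻ ω, localTime (fun t => X t ω) a 1 ∂μ ≤ ENNReal.ofReal K₀ := by
  have hXs : Measurable fun p : Ω × ℝ => X p.2.toNNReal p.1 :=
    hX.comp ((measurable_real_toNNReal.comp measurable_snd).prodMk measurable_fst)
  have hm : ∀ ε, Measurable fun ω => ENNReal.ofReal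
      (∫ s in (0 : ℝ)..1, windowDensity a ε (X s.toNNReal ω)) := by
    intro ε
    refine ENNReal.measurable_ofReal.comp ?_
    simp_rw [intervalIntegral.integral_of_le zero_le_one]
    exact (((measurable_windowDensity a ε).comp hXs).stronglyMeasurable.integral_prod_right'
      (ν := volume.restrict (Set.Ioc 0 1))).measurable
  have e : ∀ ω, localTime (fun t => X t ω) a 1 = liminf (fun ε => ENNReal.ofReal
      (∫ s in (0 : ℝ)..1, windowDensity a ε (X s.toNNReal ω))) (𝓝[>] (0 : ℝ)) := by
    intro ω
    refine liminf_congr ?_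
    filter_upwards [self_mem_nhdsWithin] with ε hε
    exact occupation_eq (hXs.comp measurable_prodMk_left) a hε
  simp_rw [e]
  refine (lintegral_liminf_le hm).trans ?_
  rw [← (ENNReal.tendsto_ofReal hK).liminf_eq]
  exact liminf_le_liminf h

lemma firstJumpTime_le {Ω : Type*} {N : ℝ≥0 → Ω → ℕ} {ω : Ω} {t : ℝ≥0} (h : 1 ≤ N t ω) :
    firstJumpTime N ω ≤ t := iInf₂_le t h

/-- For a nondecreasing path the condition persists after its first occurrence, so the infimum may
be taken over rational times. -/
lemma measurable_firstJumpTime {Ω : Type*} [MeasurableSpace Ω] {N : ℝ≥0 → Ω → ℕ}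
    (hN : ∀ t, Measurable (N t)) (hmono : ∀ ω, Monotone fun t => N t ω) :
    Measurable (firstJumpTime N) := by
  have e : firstJumpTime N = fun ω => ⨅ q : ℚ≥0, ⨅ _ : 1 ≤ N (q : ℝ≥0) ω, ((q : ℝ≥0) : ℝ≥0∞) := by
    ext ω
    refine le_antisymm (le_iInf₂ fun q hq => firstJumpTime_le hq) (le_iInf₂ fun s hs => ?_)
    refine le_of_forall_gt fun c hc => ?_
    obtain ⟨c', hc', hcc⟩ := ENNReal.lt_iff_exists_nnreal_btwn.1 hc
    obtain ⟨q, hq1, hq2⟩ := exists_rat_btwn (show (s : ℝ) < c' by exact_mod_cast hc')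
    have hq0 : 0 ≤ q := by
      have : (0 : ℝ) ≤ q := s.2.trans hq1.le
      exact_mod_cast this
    lift q to ℚ≥0 using hq0
    have h1 : s ≤ (q : ℝ≥0) := by
      rw [← NNReal.coe_le_coe]; exact_mod_cast hq1.le
    have h2 : (q : ℝ≥0) < c' := by
      rw [← NNReal.coe_lt_coe]; exact_mod_cast hq2
    refine lt_of_le_of_lt (iInf₂_le q (hs.trans (hmono ω h1))) (lt_trans ?_ hcc)
    exact_mod_cast h2
  rw [e]
  refine Measurable.iInf fun q => ?_
  have : (fun ω => ⨅ _ : 1 ≤ N (q : ℝ≥0) ω, ((q : ℝ≥0) : ℝ≥0∞)) =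
      fun ω => if 1 ≤ N (q : ℝ≥0) ω then ((q : ℝ≥0) : ℝ≥0∞) else ⊤ := by
    ext ω
    by_cases h : 1 ≤ N (q : ℝ≥0) ω <;> simp [h]
  rw [this]
  exact Measurable.ite (measurableSet_le measurable_const (hN _)) measurable_const measurable_const

/-- The local time of a continuous Brownian motion at time `1` has finite expectation. -/
lemma lintegral_localTime_lt_top {Ω : Type*} [MeasurableSpace Ω] {Q : Measure Ω}
    [IsProbabilityMeasure Q] {X : ℝ≥0 → Ω → ℝ} (hX : Measurable (Function.uncurry X))
    (hW : IsContBrownian (fun s => X s.toNNReal) Q) (a : ℝ) :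
    ∫⁻ ω, localTime (fun t => X t ω) a 1 ∂Q < ∞ := by
  -- At time 0 the past is almost surely constant, so the estimate for the occupation after time t
  -- applies with t = 0 and the sure event.
  have hI : IndepOfFuture (fun s => X s.toNNReal) Q Set.univ 0 := by
    refine ⟨MeasurableSet.univ, fun s _ => ?_⟩
    refine (indepFun_const_left (μ := Q) ((1 : ℝ), (0 : ℝ))
      (fun ω => X s.toNNReal ω - X (0 : ℝ).toNNReal ω)).congr ?_ .rfl
    filter_upwards [hW.zero] with ω h
    simp only [Set.indicator_univ, h]
    rfl
  refine (lintegral_localTime_le hX a Q (K := fun _ => 4 / 5) tendsto_const_nhds ?_).trans_lt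
    ENNReal.ofReal_lt_top
  filter_upwards [self_mem_nhdsWithin] with ε hε
  have hε : 0 < ε := hε
  have h := hI.setIntegral_windowDensity_le hW le_rfl zero_le_one a hε
  rw [← ofReal_integral_eq_lintegral_ofReal]
  · refine ENNReal.ofReal_le_ofReal ?_
    simpa using h
  · simp_rw [intervalIntegral.integral_of_le zero_le_one]
    refine (hW.integrable_prod (b := 1) le_rfl (measurable_windowDensity a ε)
      (C := 1 / (2 * ε)) fun x => ?_).integral_prod_right
    rw [abs_of_nonneg (windowDensity_nonneg hε x)]
    refine (windowDensity_le hε x).trans (le_mul_of_one_le_right (by positivity) ?_)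
    linarith [show 0 ≤ x ^ 4 by positivity]
  · exact ae_of_all _ fun ω => intervalIntegral.integral_nonneg zero_le_one
      fun s _ => windowDensity_nonneg hε _

/-! ### Independence of increments from the joint past of N and B. -/

/-- The law of the triple is the product of the three marginals, and it only has to be bracketed
differently. This adjoins the other, independent process to the past of N or of B. -/
lemma ProbabilityTheory.IndepFun.prodMk_left_of_indepFun {Ω α β γ : Type*} [MeasurableSpace Ω]
    [MeasurableSpace α] [MeasurableSpace β] [MeasurableSpace γ] {P : Measure Ω}
    [IsProbabilityMeasure P] {Y : Ω → α} {X₁ : Ω → β} {X₂ : Ω → γ} (hY : Measurable Y)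
    (h₁ : Measurable X₁) (h₂ : Measurable X₂) (h : IndepFun Y (fun ω => (X₁ ω, X₂ ω)) P)
    (h' : IndepFun X₁ X₂ P) : IndepFun (fun ω => (Y ω, X₁ ω)) X₂ P := by
  have e1 := h.map_prod_eq_prod_map_map hY.aemeasurable (h₁.prodMk h₂).aemeasurable
  rw [h'.map_prod_eq_prod_map_map h₁.aemeasurable h₂.aemeasurable] at e1
  have e2 := (h.comp measurable_id measurable_fst).map_prod_eq_prod_map_map
    hY.aemeasurable h₁.aemeasurable
  rw [indepFun_iff_map_prod_eq_prod_map_map (hY.prodMk h₁).aemeasurable h₂.aemeasurable]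
  have e3 : P.map (fun ω => ((Y ω, X₁ ω), X₂ ω)) =
      (P.map (fun ω => (Y ω, (X₁ ω, X₂ ω)))).map MeasurableEquiv.prodAssoc.symm := by
    rw [Measure.map_map (MeasurableEquiv.measurable _) (hY.prodMk (h₁.prodMk h₂))]
    rfl
  have : IsProbabilityMeasure (P.map Y) := Measure.isProbabilityMeasure_map hY.aemeasurable
  have : IsProbabilityMeasure (P.map X₁) := Measure.isProbabilityMeasure_map h₁.aemeasurable
  have : IsProbabilityMeasure (P.map X₂) := Measure.isProbabilityMeasure_map h₂.aemeasurable
  have e2' : P.map (fun ω => (Y ω, X₁ ω)) = (P.map Y).prod (P.map X₁) := e2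
  rw [e3, e1, e2', ← Measure.prodAssoc_prod,
    Measure.map_map (MeasurableEquiv.measurable _) (MeasurableEquiv.measurable _)]
  simp

/-- A process with independent increments started at `0` has increments independent of the past. -/
lemma ProbabilityTheory.HasIndepIncrements.indepFun_past {Ω : Type*} [MeasurableSpace Ω]
    {P : Measure Ω} [IsProbabilityMeasure P] {X : ℝ≥0 → Ω → ℝ} (hX : HasIndepIncrements X P)
    (hm : ∀ t, Measurable (X t)) (h0 : ∀ᵐ ω ∂P, X 0 ω = 0) {t s : ℝ≥0} (hts : t ≤ s) :
    IndepFun (fun ω (u : Set.Iic t) => X u ω) (fun ω => X s ω - X t ω) P := by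
  classical
  refine IndepFun.process_indepFun (fun u => hm u) ((hm s).sub (hm t)) fun I => ?_
  -- With 0 and t adjoined, the increasing enumeration starts at 0 and its entry of index n is t; s
  -- is appended after it. The values on I are then sums of the increments of index less than n, and
  -- X_s - X_t is the increment of index n.
  set J : Finset ℝ≥0 := insert 0 (insert t (I.image (Subtype.val : Set.Iic t → ℝ≥0))) with hJ
  have hJt : ∀ u ∈ J, u ≤ t := by
    intro u hu
    simp only [hJ, Finset.mem_insert, Finset.mem_image] at hu
    rcases hu with rfl | rfl | ⟨v, -, rfl⟩
    · exact zero_le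
    · exact le_rfl
    · exact v.2
  obtain ⟨n, hn⟩ : ∃ n, J.card = n + 1 :=
    Nat.exists_eq_succ_of_ne_zero (Finset.card_ne_zero_of_mem (Finset.mem_insert_self 0 _))
  set e := J.orderEmbOfFin hn with he
  set τ : ℕ → ℝ≥0 := fun k => if h : k < n + 1 then e ⟨k, h⟩ else s with hτ
  have hτlt : ∀ k (h : k < n + 1), τ k = e ⟨k, h⟩ := fun k h => dif_pos h
  have hτge : ∀ k, n + 1 ≤ k → τ k = s := fun k h => dif_neg (Nat.not_lt.2 h)
  have hmem : ∀ u ∈ J, ∃ k < n + 1, τ k = u := by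
    intro u hu
    have : u ∈ Set.range e := by rw [he, Finset.range_orderEmbOfFin]; exact hu
    obtain ⟨⟨k, hk⟩, rfl⟩ := this
    exact ⟨k, hk, hτlt k hk⟩
  have hmono : Monotone τ := by
    intro a b hab
    by_cases hb : b < n + 1
    · rw [hτlt a (by lia), hτlt b hb]
      exact e.monotone hab
    · rw [hτge b (by lia)]
      by_cases ha : a < n + 1
      · rw [hτlt a ha]
        exact (hJt _ (Finset.orderEmbOfFin_mem J hn _)).trans hts
      · rw [hτge a (by lia)]
  have hτ0 : τ 0 = 0 := by
    obtain ⟨k, -, hk⟩ := hmem 0 (Finset.mem_insert_self _ _)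
    exact le_antisymm ((hmono (Nat.zero_le k)).trans hk.le) (zero_le)
  have hτn : τ n = t := by
    obtain ⟨k, hk, hk'⟩ := hmem t (by simp [hJ])
    refine le_antisymm ?_ (hk'.symm.le.trans (hmono (by lia)))
    rw [hτlt n (by lia)]
    exact hJt _ (Finset.orderEmbOfFin_mem J hn _)
  have hind := (hX.nat hmono).indepFun_finset (Finset.range n) {n} (by simp)
    (fun i => (hm _).sub (hm _))
  have hk : ∀ u : I, ∃ k < n + 1, τ k = u := fun u => hmem u (Finset.mem_insert_of_mem
    (Finset.mem_insert_of_mem (Finset.mem_image_of_mem _ u.2)))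
  choose κ hκ hκ' using hk
  have hφ : Measurable fun (v : Finset.range n → ℝ) (u : I) =>
      ∑ j : Finset.range n, if (j : ℕ) < κ u then v j else 0 := by
    refine measurable_pi_lambda _ fun u => Finset.measurable_sum _ fun j _ => ?_
    split_ifs
    · exact measurable_pi_apply j
    · exact measurable_const
  have hψ : Measurable fun v : ({n} : Finset ℕ) → ℝ => v ⟨n, by simp⟩ := measurable_pi_apply _
  have h2 := hind.comp
    (φ := fun (v : Finset.range n → ℝ) (u : I) => ∑ j : Finset.range n, if (j : ℕ) < κ u then v j else 0) hφ hψ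
  refine h2.congr ?_ ?_
  · filter_upwards [h0] with ω hω
    ext u
    simp only [Function.comp_apply]
    rw [Finset.sum_coe_sort (Finset.range n)
      (fun j => if j < κ u then X (τ (j + 1)) ω - X (τ j) ω else 0), ← Finset.sum_filter]
    have : (Finset.range n).filter (fun j => j < κ u) = Finset.range (κ u) := by
      ext j
      simp only [Finset.mem_filter, Finset.mem_range]
      have := hκ u
      lia
    rw [this, Finset.sum_range_sub (fun j => X (τ j) ω), hκ', hτ0, hω, sub_zero]
  · refine ae_of_all _ fun ω => ?_
    simp only [Function.comp_apply]
    rw [hτn, hτge _ le_rfl]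

lemma IsPoissonProcess.indepFun_past {Ω : Type*} [MeasurableSpace Ω] {P : Measure Ω}
    [IsProbabilityMeasure P] {N : ℝ≥0 → Ω → ℕ} {r : ℝ≥0} (hN : IsPoissonProcess N r P)
    (hm : ∀ t, Measurable (N t)) {t s : ℝ≥0} (hts : t ≤ s) :
    IndepFun (fun ω (u : Set.Iic t) => N u ω) (fun ω => N s ω - N t ω) P := by
  have h := hN.indep_increments.indepFun_past (fun t => measurable_from_top.comp (hm t)) (by
    filter_upwards [hN.zero] with ω h
    simp [h]) hts
  -- The floor `⌊·⌋₊` vanishes on negative numbers, so it carries real differences of naturals to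
  -- truncated ones on every path.
  have h2 := h.comp (φ := fun (v : Set.Iic t → ℝ) u => ⌊v u⌋₊) (ψ := fun x => ⌊x⌋₊)
    (by fun_prop) (by fun_prop)
  refine h2.congr (ae_of_all _ fun ω => ?_) (ae_of_all _ fun ω => ?_)
  · ext u; simp
  · simp

section Pair

variable {Ω : Type*} [MeasurableSpace Ω] {P : Measure Ω} [IsProbabilityMeasure P]
  {l : ℝ≥0} {B : ℝ≥0 → Ω → ℝ} {N : ℝ≥0 → Ω → ℕ} {hBm : ∀ t, Measurable (B t)}
  {hNm : ∀ t, Measurable (N t)}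

/-- An event of the natural filtration is a function of the stopped paths. -/
lemma exists_preimage_of_measurableSet_pairFiltration {t : ℝ≥0} {A : Set Ω}
    (hA : MeasurableSet[pairFiltration N B hNm hBm t] A) :
    ∃ D : Set (Set.Iic t → ℕ × ℝ), MeasurableSet D ∧
      (fun ω (u : Set.Iic t) => (N u ω, B u ω)) ⁻¹' D = A := by
  rw [pairFiltration, Filtration.natural_eq_comap] at hA
  exact hA

/-- An increment of the Brownian motion is independent of the past and of the Poisson process. -/
lemma indepFun_brownian_increment (hB : IsBrownianReal B P)
    (hindep : IndepFun (fun ω t => N t ω) (fun ω t => B t ω) P) {t s : ℝ≥0} (hts : t ≤ s)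
    {A : Set Ω} (hA : MeasurableSet[pairFiltration N B hNm hBm t] A) :
    IndepFun (fun ω => (N 1 ω, (A.indicator (1 : Ω → ℝ) ω, B t ω)))
      (fun ω => B s ω - B t ω) P := by
  obtain ⟨D, hD, rfl⟩ := exists_preimage_of_measurableSet_pairFiltration hA
  have h1 : IndepFun (fun ω (u : Set.Iic t) => B u ω) (fun ω => B s ω - B t ω) P := by
    have h := (hB.toIsPreBrownianReal.indepFun_shift t).symm.comp (φ := id) measurable_id
      (measurable_pi_apply (s - t))
    refine h.congr .rfl (ae_of_all _ fun ω => ?_)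
    simp [add_tsub_cancel_of_le hts]
  have h2 : IndepFun (fun ω t => N t ω)
      (fun ω => ((fun u : Set.Iic t => B u ω), B s ω - B t ω)) P :=
    hindep.comp (φ := id) (ψ := fun b : ℝ≥0 → ℝ => ((fun u : Set.Iic t => b u), b s - b t))
      measurable_id (by fun_prop)
  have h3 := IndepFun.prodMk_left_of_indepFun (measurable_pi_lambda _ hNm)
    (measurable_pi_lambda _ fun u => hBm _) ((hBm s).sub (hBm t)) h2 h1
  have hφ : Measurable (fun p : (ℝ≥0 → ℕ) × (Set.Iic t → ℝ) =>
      (p.1 1, (D.indicator (1 : (Set.Iic t → ℕ × ℝ) → ℝ) (fun u => (p.1 u, p.2 u)), p.2 ⟨t, Set.mem_Iic.2 le_rfl⟩))) := by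
    have hp : Measurable (fun p : (ℝ≥0 → ℕ) × (Set.Iic t → ℝ) =>
        fun u : Set.Iic t => (p.1 u, p.2 u)) := by fun_prop
    have : Measurable (fun p : (ℝ≥0 → ℕ) × (Set.Iic t → ℝ) =>
        D.indicator (1 : (Set.Iic t → ℕ × ℝ) → ℝ) (fun u => (p.1 u, p.2 u))) :=
      (measurable_one.indicator hD).comp hp
    fun_prop
  exact h3.comp hφ measurable_id

/-- An increment of the Poisson process is independent of the past and of the Brownian motion. -/
lemma indepFun_poisson_increment (hN : IsPoissonProcess N l P)
    (hindep : IndepFun (fun ω t => N t ω) (fun ω t => B t ω) P) {t t' : ℝ≥0} (htt : t ≤ t')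
    (s : ℝ≥0) {A : Set Ω} (hA : MeasurableSet[pairFiltration N B hNm hBm t] A) :
    IndepFun (fun ω => ((N t ω, A.indicator (1 : Ω → ℝ) ω), B s ω))
      (fun ω => N t' ω - N t ω) P := by
  obtain ⟨D, hD, rfl⟩ := exists_preimage_of_measurableSet_pairFiltration hA
  have h2 : IndepFun (fun ω t => B t ω)
      (fun ω => ((fun u : Set.Iic t => N u ω), N t' ω - N t ω)) P :=
    hindep.symm.comp (φ := id) (ψ := fun b : ℝ≥0 → ℕ => ((fun u : Set.Iic t => b u), b t' - b t))
      measurable_id (by fun_prop)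
  have h3 := IndepFun.prodMk_left_of_indepFun (measurable_pi_lambda _ hBm)
    (measurable_pi_lambda _ fun u => hNm _) ((hNm t').sub (hNm t)) h2 (hN.indepFun_past hNm htt)
  have hφ : Measurable (fun p : (ℝ≥0 → ℝ) × (Set.Iic t → ℕ) =>
      ((p.2 ⟨t, Set.mem_Iic.2 le_rfl⟩, D.indicator (1 : (Set.Iic t → ℕ × ℝ) → ℝ) (fun u => (p.2 u, p.1 u))), p.1 s)) := by
    have hp : Measurable (fun p : (ℝ≥0 → ℝ) × (Set.Iic t → ℕ) =>
        fun u : Set.Iic t => (p.2 u, p.1 u)) := by fun_prop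
    have : Measurable (fun p : (ℝ≥0 → ℝ) × (Set.Iic t → ℕ) =>
        D.indicator (1 : (Set.Iic t → ℕ × ℝ) → ℝ) (fun u => (p.2 u, p.1 u))) :=
      (measurable_one.indicator hD).comp hp
    fun_prop
  exact h3.comp hφ measurable_id

end Pair

/-! ### Regular versions, and conditioning on the absence of jumps. -/

/-- Conditioning on an event which is independent of `Y` jointly with `X`. -/
lemma ProbabilityTheory.IndepFun.cond_preimage {Ω α β γ : Type*} [MeasurableSpace Ω]
    [MeasurableSpace α] [MeasurableSpace β] [MeasurableSpace γ] {P : Measure Ω}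
    [IsProbabilityMeasure P] {Z : Ω → α} {X : Ω → β} {Y : Ω → γ}
    (h : IndepFun (fun ω => (Z ω, X ω)) Y P) (hZ : Measurable Z) {D : Set α}
    (hD : MeasurableSet D) (h0 : P (Z ⁻¹' D) ≠ 0) :
    IndepFun X Y P[|Z ⁻¹' D] ∧ ∀ V, MeasurableSet V → P[|Z ⁻¹' D] (Y ⁻¹' V) = P (Y ⁻¹' V) := by
  rw [indepFun_iff_measure_inter_preimage_eq_mul] at h
  have key : ∀ U V, MeasurableSet U → MeasurableSet V →
      P[|Z ⁻¹' D] (X ⁻¹' U ∩ Y ⁻¹' V) = P[|Z ⁻¹' D] (X ⁻¹' U) * P (Y ⁻¹' V) := by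
    intro U V hU hV
    rw [cond_apply (hZ hD), cond_apply (hZ hD), ← Set.inter_assoc, mul_assoc]
    congr 1
    exact h (D ×ˢ U) V (hD.prod hU) hV
  have key2 : ∀ V, MeasurableSet V → P[|Z ⁻¹' D] (Y ⁻¹' V) = P (Y ⁻¹' V) := by
    intro V hV
    have := key Set.univ V MeasurableSet.univ hV
    have hp : IsProbabilityMeasure P[|Z ⁻¹' D] := cond_isProbabilityMeasure h0
    simpa using this
  refine ⟨?_, key2⟩
  rw [indepFun_iff_measure_inter_preimage_eq_mul]
  intro U V hU hV
  rw [key U V hU hV, key2 V hV]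

/-- `(X, M)` is indistinguishable from `(B, N)` and has regular paths everywhere. -/
structure IsRegularVersion {Ω : Type*} [MeasurableSpace Ω] (P : Measure Ω) (B : ℝ≥0 → Ω → ℝ)
    (N : ℝ≥0 → Ω → ℕ) (X : ℝ≥0 → Ω → ℝ) (M : ℝ≥0 → Ω → ℕ) : Prop where
  measX : ∀ t, Measurable (X t)
  measM : ∀ t, Measurable (M t)
  cont : ∀ ω, Continuous fun t => X t ω
  zeroM : ∀ ω, M 0 ω = 0
  mono : ∀ ω, Monotone fun t => M t ω
  right_cont : ∀ ω t, ContinuousWithinAt (fun s => M s ω) (Set.Ici t) t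
  eqX : ∀ᵐ ω ∂P, ∀ t, X t ω = B t ω
  eqM : ∀ᵐ ω ∂P, ∀ t, M t ω = N t ω

section Setting

variable {Ω : Type*} [MeasurableSpace Ω] {P : Measure Ω} [IsProbabilityMeasure P]
  {l b : ℝ≥0} {B : ℝ≥0 → Ω → ℝ} {N : ℝ≥0 → Ω → ℕ} {hBm : ∀ t, Measurable (B t)}
  {hNm : ∀ t, Measurable (N t)} {X : ℝ≥0 → Ω → ℝ} {M : ℝ≥0 → Ω → ℕ}

/-- Path regularity holds only almost surely, while the measurability arguments use it on every
path. Off a measurable set of full probability the paths are replaced by zero. Stopping times still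
refer to the filtration of the original pair, and no completeness of the space is needed. -/
lemma exists_isRegularVersion (hBm : ∀ t, Measurable (B t)) (hNm : ∀ t, Measurable (N t))
    (hB : IsBrownianReal B P) (hN : IsPoissonProcess N l P) :
    ∃ X M, IsRegularVersion P B N X M := by
  have hae : ∀ᵐ ω ∂P, Continuous (B · ω) ∧ N 0 ω = 0 ∧ (Monotone fun t => N t ω) ∧
      ∀ t, ContinuousWithinAt (fun s => N s ω) (Set.Ici t) t := by
    filter_upwards [hB.cont, hN.zero, hN.mono, hN.right_cont] with ω h1 h2 h3 h4
    exact ⟨h1, h2, h3, h4⟩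
  obtain ⟨G, hG, hGm, hGP⟩ := hae.exists_measurable_mem
  classical
  refine ⟨fun t ω => if ω ∈ G then B t ω else 0, fun t ω => if ω ∈ G then N t ω else 0, ?_⟩
  refine ⟨fun t => (hBm t).ite hGm measurable_const, fun t => (hNm t).ite hGm measurable_const,
    fun ω => ?_, fun ω => ?_, fun ω => ?_, fun ω t => ?_, ?_, ?_⟩
  · by_cases h : ω ∈ G
    · simpa [h] using (hGP ω h).1
    · simpa [h] using continuous_const
  · by_cases h : ω ∈ G
    · simpa [h] using (hGP ω h).2.1
    · simp [h]
  · by_cases h : ω ∈ G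
    · simpa [h] using (hGP ω h).2.2.1
    · simpa [h] using monotone_const
  · by_cases h : ω ∈ G
    · simpa [h] using (hGP ω h).2.2.2 t
    · simpa [h] using continuousWithinAt_const
  · filter_upwards [hG] with ω h t
    simp [h]
  · filter_upwards [hG] with ω h t
    simp [h]

namespace IsRegularVersion

variable (hV : IsRegularVersion P B N X M)
include hV

lemma payoff_ae_eq (y : ℝ) (τ : Ω → ℝ≥0) : payoff l b N B y τ =ᵐ[P] payoff l b M X y τ := by
  filter_upwards [hV.eqX, hV.eqM] with ω h1 h2
  simp only [payoff, firstJumpTime, h1, h2]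

lemma measurable_uncurry : Measurable (Function.uncurry X) :=
  measurable_uncurry_of_continuous_of_measurable hV.cont hV.measX

lemma isContBrownian (hB : IsBrownianReal B P) :
    IsContBrownian (fun s => X s.toNNReal) P where
  meas t := hV.measX _
  cont ω := (hV.cont ω).comp continuous_real_toNNReal
  zero := by
    filter_upwards [hV.eqX, hB.toIsPreBrownianReal.eval_zero_ae_eq_zero] with ω h1 h2
    simpa [h1] using h2
  law_sub s t hs hst := by
    have h := hB.toIsPreBrownianReal.hasLaw_sub t.toNNReal s.toNNReal
    have e : nndist ((t.toNNReal : ℝ)) (s.toNNReal : ℝ) = (t - s).toNNReal := by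
      ext
      rw [coe_nndist, Real.dist_eq, Real.coe_toNNReal _ hs, Real.coe_toNNReal _ (hs.trans hst),
        Real.coe_toNNReal _ (sub_nonneg.2 hst), abs_of_nonneg (sub_nonneg.2 hst)]
    have h' : HasLaw (B t.toNNReal - B s.toNNReal) (gaussianReal 0 (t - s).toNNReal) P := by
      rw [← e]; exact h
    refine h'.congr ?_
    filter_upwards [hV.eqX] with ω h1
    simp [h1]

lemma prob_increment_eq_zero (hN : IsPoissonProcess N l P) {t t' : ℝ≥0} (h : t ≤ t') :
    P.real {ω | M t' ω - M t ω = 0} = Real.exp (-(l * (t' - t))) := by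
  have hl := hN.law_increment t (t' - t)
  rw [add_tsub_cancel_of_le h] at hl
  have hl' := hl.congr (Y := fun ω => M t' ω - M t ω) (by
    filter_upwards [hV.eqM] with ω h1
    simp [h1])
  have := hl'.measureReal_eq (p := fun k => k = 0) (measurableSet_singleton 0)
  rw [this]
  have h0 : {x : ℕ | x = 0} = {0} := rfl
  rw [h0, poissonMeasure_real_singleton]
  simp [NNReal.coe_sub h]

lemma prob_no_jump (hN : IsPoissonProcess N l P) : P.real {ω | M 1 ω = 0} = Real.exp (-l) := by
  have := hV.prob_increment_eq_zero hN zero_le_one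
  simpa [hV.zeroM] using this

lemma cond_ne_zero (hN : IsPoissonProcess N l P) : P {ω | M 1 ω = 0} ≠ 0 := by
  have := hV.prob_no_jump hN
  intro h
  rw [measureReal_def, h] at this
  exact (Real.exp_pos _).ne this

lemma isProbabilityMeasure_cond (hN : IsPoissonProcess N l P) :
    IsProbabilityMeasure P[|{ω | M 1 ω = 0}] := cond_isProbabilityMeasure (hV.cond_ne_zero hN)

lemma setIntegral_cond (hN : IsPoissonProcess N l P) {A : Set Ω} (hA : MeasurableSet A)
    (f : Ω → ℝ) : ∫ ω in A, f ω ∂P[|{ω | M 1 ω = 0}] =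
      Real.exp l * ∫ ω in A ∩ {ω | M 1 ω = 0}, f ω ∂P := by
  rw [ProbabilityTheory.cond, Measure.restrict_smul, integral_smul_measure,
    Measure.restrict_restrict hA, smul_eq_mul]
  congr 1
  have := hV.prob_no_jump hN
  rw [measureReal_def] at this
  rw [ENNReal.toReal_inv, this, ← Real.exp_neg, neg_neg]

lemma indep_future (hB : IsBrownianReal B P)
    (hindep : IndepFun (fun ω t => N t ω) (fun ω t => B t ω) P) {t s : ℝ≥0} (hts : t ≤ s)
    {A : Set Ω} (hA : MeasurableSet[pairFiltration N B hNm hBm t] A) :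
    IndepFun (fun ω => (M 1 ω, (A.indicator (1 : Ω → ℝ) ω, X t ω)))
      (fun ω => X s ω - X t ω) P := by
  refine (indepFun_brownian_increment hB hindep hts hA).congr ?_ ?_
  · filter_upwards [hV.eqX, hV.eqM] with ω h1 h2
    rw [h1, h2]
  · filter_upwards [hV.eqX] with ω h1
    rw [h1, h1]

/-- Conditionally on the absence of jumps, `X` is still a Brownian motion. -/
lemma isContBrownian_cond (hB : IsBrownianReal B P) (hN : IsPoissonProcess N l P)
    (hindep : IndepFun (fun ω t => N t ω) (fun ω t => B t ω) P)
    (hBm : ∀ t, Measurable (B t)) (hNm : ∀ t, Measurable (N t)) :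
    IsContBrownian (fun s => X s.toNNReal) P[|{ω | M 1 ω = 0}] where
  meas t := hV.measX _
  cont ω := (hV.isContBrownian hB).cont ω
  zero := (cond_absolutelyContinuous).ae_le (hV.isContBrownian hB).zero
  law_sub s t hs hst := by
    have h := ((hV.indep_future hB hindep (Real.toNNReal_le_toNNReal hst)
      (hBm := hBm) (hNm := hNm) (A := Set.univ) MeasurableSet.univ).cond_preimage (hV.measM 1)
      (D := {0}) (measurableSet_singleton 0) (hV.cond_ne_zero hN)).2
    have hm : Measurable fun ω => X t.toNNReal ω - X s.toNNReal ω :=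
      (hV.measX _).sub (hV.measX _)
    refine ⟨hm.aemeasurable, ?_⟩
    rw [← ((hV.isContBrownian hB).law_sub s t hs hst).map_eq]
    ext V hV'
    rw [Measure.map_apply hm hV', Measure.map_apply hm hV']
    exact h V hV'

lemma indepOfFuture_cond (hB : IsBrownianReal B P) (hN : IsPoissonProcess N l P)
    (hindep : IndepFun (fun ω t => N t ω) (fun ω t => B t ω) P) {t : ℝ≥0}
    {A : Set Ω} (hA : MeasurableSet[pairFiltration N B hNm hBm t] A) :
    IndepOfFuture (fun s => X s.toNNReal) P[|{ω | M 1 ω = 0}] A t where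
  meas := (pairFiltration N B hNm hBm).le t A hA
  indep s hs := by
    have hts : t ≤ s.toNNReal := NNReal.le_toNNReal_of_coe_le hs
    have h := ((hV.indep_future hB hindep hts hA).cond_preimage (hV.measM 1)
      (D := {0}) (measurableSet_singleton 0) (hV.cond_ne_zero hN)).1
    simpa using! h

/-- Later jumps of the Poisson process are independent of the past and of integrals along the
Brownian path. -/
lemma setIntegral_jump (hB : IsBrownianReal B P)
    (hN : IsPoissonProcess N l P)
    (hindep : IndepFun (fun ω t => N t ω) (fun ω t => B t ω) P) {t t' : ℝ≥0} (htt : t ≤ t')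
    {A : Set Ω} (hA : MeasurableSet[pairFiltration N B hNm hBm t] A) (D : Set ℕ) {u v : ℝ}
    (hu : 0 ≤ u) (huv : u ≤ v) {g : ℝ → ℝ} (hg : Measurable g) {C : ℝ}
    (hC : ∀ x, |g x| ≤ C * (1 + x ^ 4)) :
    ∫ ω in A ∩ {ω | M t ω = 0} ∩ {ω | M t' ω - M t ω ∈ D},
        (∫ s in u..v, g (X s.toNNReal ω)) ∂P =
      P.real {ω | M t' ω - M t ω ∈ D} *
        ∫ ω in A ∩ {ω | M t ω = 0}, (∫ s in u..v, g (X s.toNNReal ω)) ∂P := by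
  have hW := hV.isContBrownian hB
  have hA' := (pairFiltration N B hNm hBm).le t A hA
  have hA0 : MeasurableSet (A ∩ {ω | M t ω = 0}) :=
    hA'.inter (hV.measM t (measurableSet_singleton 0))
  have hD : MeasurableSet {ω | M t' ω - M t ω ∈ D} :=
    ((hV.measM t').sub (hV.measM t)) (MeasurableSet.of_discrete (s := D))
  have hsw : ∀ E : Set Ω, ∫ ω in E, (∫ s in u..v, g (X s.toNNReal ω)) ∂P =
      ∫ s in u..v, ∫ ω in E, g (X s.toNNReal ω) ∂P := by
    intro E
    simp_rw [intervalIntegral.integral_of_le huv]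
    refine integral_integral_swap (f := fun ω (s : ℝ) => g (X s.toNNReal ω)) ?_
    refine (hW.integrable_prod (b := v) hu hg hC).swap.mono_measure ?_
    exact Measure.prod_mono Measure.restrict_le_self le_rfl
  rw [hsw, hsw, ← intervalIntegral.integral_const_mul]
  -- After Fubini it suffices to treat one s at a time. Since N is independent of the whole path of
  -- B, s may lie after t.
  refine intervalIntegral.integral_congr fun (s : ℝ) _ => ?_
  have hI : IndepFun (fun ω => ((M t ω, A.indicator (1 : Ω → ℝ) ω), X s.toNNReal ω))
      (fun ω => M t' ω - M t ω) P := by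
    refine (indepFun_poisson_increment hN hindep htt s.toNNReal hA).congr ?_ ?_
    · filter_upwards [hV.eqX, hV.eqM] with ω h1 h2
      rw [h1, h2]
    · filter_upwards [hV.eqM] with ω h2
      rw [h2, h2]
  have hφ : Measurable fun p : (ℕ × ℝ) × ℝ =>
      ({0} : Set ℕ).indicator (1 : ℕ → ℝ) p.1.1 * p.1.2 * g p.2 := by
    have : Measurable (({0} : Set ℕ).indicator (1 : ℕ → ℝ)) := measurable_from_top
    fun_prop
  have hI2 := hI.comp hφ (ψ := D.indicator (1 : ℕ → ℝ)) measurable_from_top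
  have e1 : ∀ ω, (A ∩ {ω | M t ω = 0}).indicator (fun ω => g (X s.toNNReal ω)) ω =
      ({0} : Set ℕ).indicator (1 : ℕ → ℝ) (M t ω) * A.indicator (1 : Ω → ℝ) ω *
        g (X s.toNNReal ω) := by
    intro ω
    by_cases h1 : ω ∈ A <;> by_cases h2 : M t ω = 0 <;> simp [h1, h2]
  have e2 : ∀ ω, (A ∩ {ω | M t ω = 0} ∩ {ω | M t' ω - M t ω ∈ D}).indicator
      (fun ω => g (X s.toNNReal ω)) ω =
      (A ∩ {ω | M t ω = 0}).indicator (fun ω => g (X s.toNNReal ω)) ω *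
        D.indicator (1 : ℕ → ℝ) (M t' ω - M t ω) := by
    intro ω
    by_cases h1 : ω ∈ A ∩ {ω | M t ω = 0} <;> by_cases h2 : M t' ω - M t ω ∈ D <;>
      simp [h1, h2]
  have e3 : ∫ ω, D.indicator (1 : ℕ → ℝ) (M t' ω - M t ω) ∂P =
      P.real {ω | M t' ω - M t ω ∈ D} := by
    rw [← integral_indicator_one hD]
    rfl
  show ∫ ω in A ∩ {ω | M t ω = 0} ∩ {ω | M t' ω - M t ω ∈ D}, g (X s.toNNReal ω) ∂P = _
  rw [← integral_indicator (hA0.inter hD), ← integral_indicator hA0, ← e3, mul_comm]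
  simp_rw [e2, e1]
  refine hI2.integral_fun_mul_eq_mul_integral ?_ ?_
  · exact (hφ.comp (((hV.measM t).prodMk (measurable_one.indicator hA')).prodMk
      (hV.measX s.toNNReal))).aestronglyMeasurable
  · exact (measurable_from_top.comp ((hV.measM t').sub (hV.measM t))).aestronglyMeasurable

end IsRegularVersion

end Setting

/-! ### Grid times; measurability and domination of the payoff. -/

lemma continuous_fAux (a : ℝ) : Continuous (fAux a) := by
  unfold fAux
  fun_prop

lemma abs_fAux_le {a : ℝ} (ha : 0 ≤ a) (x : ℝ) : |fAux a x| ≤ (1 + a) * |x| := by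
  unfold fAux
  refine (abs_add_le _ _).trans ?_
  rw [abs_mul, abs_of_nonneg ha, abs_of_nonneg (le_max_right x 0)]
  have : max x 0 ≤ |x| := max_le (le_abs_self x) (abs_nonneg x)
  nlinarith

lemma abs_fAux_add_le {a : ℝ} (ha : 0 ≤ a) (y x : ℝ) :
    |fAux a (y + x)| ≤ (1 + a) * (1 + |y|) * (1 + x ^ 4) := by
  refine (abs_fAux_le ha _).trans ?_
  rw [mul_assoc]
  gcongr
  have h1 := abs_quartic_le (c₀ := 0) (c₁ := 1) (c₂ := 0) (c₃ := 0) (c₄ := 0) (M := 1)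
      (by simp) (by simp) (by simp) (by simp) (by simp) x
  have h2 : |x| ≤ 1 + x ^ 4 := by
    rw [abs_le]
    constructor <;> nlinarith [sq_nonneg (x ^ 2 - 1 / 2), sq_nonneg (x - 1 / 2),
      sq_nonneg (x + 1 / 2)]
  have h3 : 0 ≤ |y| * x ^ 4 := by positivity
  have h4 := abs_add_le y x
  linarith

/-- The first point of the grid of mesh `1 / n` which is not before `t`. -/
noncomputable def gridCeil (n : ℕ) (t : ℝ≥0) : ℝ≥0 := (⌈n * t⌉₊ : ℝ≥0) / n

lemma le_gridCeil {n : ℕ} (hn : 0 < n) (t : ℝ≥0) : t ≤ gridCeil n t := by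
  have hn' : (0 : ℝ≥0) < n := by exact_mod_cast hn
  rw [gridCeil, le_div_iff₀ hn', mul_comm]
  exact Nat.le_ceil _

lemma ceil_le_of_le_one {n : ℕ} {t : ℝ≥0} (ht : t ≤ 1) : ⌈n * t⌉₊ ≤ n :=
  Nat.ceil_le.2 (mul_le_of_le_one_right zero_le ht)

lemma gridCeil_le_one {n : ℕ} (hn : 0 < n) {t : ℝ≥0} (ht : t ≤ 1) : gridCeil n t ≤ 1 := by
  have hn' : (0 : ℝ≥0) < n := by exact_mod_cast hn
  rw [gridCeil, div_le_one hn']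
  exact_mod_cast ceil_le_of_le_one ht

lemma tendsto_gridCeil (t : ℝ≥0) : Tendsto (fun n : ℕ => gridCeil (n + 1) t) atTop (𝓝 t) := by
  have h : Tendsto (fun n : ℕ => t + 1 / ((n : ℝ≥0) + 1)) atTop (𝓝 (t + 0)) :=
    tendsto_const_nhds.add tendsto_one_div_add_atTop_nhds_zero_nat
  rw [add_zero] at h
  refine tendsto_of_tendsto_of_tendsto_of_le_of_le tendsto_const_nhds h
    (fun n => le_gridCeil n.succ_pos t) fun n => ?_
  have hn' : (0 : ℝ≥0) < (n : ℝ≥0) + 1 := by positivity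
  have h1 := (Nat.ceil_lt_add_one (zero_le : (0 : ℝ≥0) ≤ ((n + 1 : ℕ) : ℝ≥0) * t)).le
  simp only [gridCeil]
  push_cast at h1 ⊢
  have e : (t + 1 / ((n : ℝ≥0) + 1)) * ((n : ℝ≥0) + 1) = ((n : ℝ≥0) + 1) * t + 1 := by
    field_simp
  rw [div_le_iff₀ hn', e]
  exact h1

lemma lt_iff_lt_ceil {n : ℕ} (hn : 0 < n) (t : ℝ≥0) (k : ℕ) :
    (k : ℝ≥0) / n < t ↔ k < ⌈n * t⌉₊ := by
  have hn' : (0 : ℝ≥0) < n := by exact_mod_cast hn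
  rw [Nat.lt_ceil, div_lt_iff₀ hn', mul_comm]

lemma measurable_gridCeil (n : ℕ) : Measurable (gridCeil n) := by
  unfold gridCeil
  fun_prop

section Setting

variable {Ω : Type*} [MeasurableSpace Ω] {P : Measure Ω} [IsProbabilityMeasure P]
  {l b : ℝ≥0} {B : ℝ≥0 → Ω → ℝ} {N : ℝ≥0 → Ω → ℕ} {hBm : ∀ t, Measurable (B t)}
  {hNm : ∀ t, Measurable (N t)} {X : ℝ≥0 → Ω → ℝ} {M : ℝ≥0 → Ω → ℕ}

lemma measurable_of_mem_stoppingTimesUnit {τ : Ω → ℝ≥0}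
    (hτ : τ ∈ stoppingTimesUnit (pairFiltration N B hNm hBm)) : Measurable τ := by
  refine measurable_of_Iic fun t => ?_
  have := (pairFiltration N B hNm hBm).le t _ (hτ.1 t)
  have e : τ ⁻¹' Set.Iic t = {ω | ((τ ω : ℝ≥0) : WithTop ℝ≥0) ≤ t} := by
    ext ω
    exact (WithTop.coe_le_coe (a := t) (b := τ ω)).symm
  rw [e]
  exact this

lemma measurableSet_lt_of_mem_stoppingTimesUnit {τ : Ω → ℝ≥0}
    (hτ : τ ∈ stoppingTimesUnit (pairFiltration N B hNm hBm)) (t : ℝ≥0) :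
    MeasurableSet[pairFiltration N B hNm hBm t] {ω | t < τ ω} := by
  have := (hτ.1 t).compl
  have e : {ω | ((τ ω : ℝ≥0) : WithTop ℝ≥0) ≤ t}ᶜ = {ω | t < τ ω} := by
    ext ω
    exact (not_congr (WithTop.coe_le_coe (a := t) (b := τ ω))).trans not_le
  rwa [e] at this

/-- A dominating function for all payoffs. -/
noncomputable def payoffBound (l b : ℝ≥0) (X : ℝ≥0 → Ω → ℝ) (y : ℝ) (ω : Ω) : ℝ :=
  Real.exp l * (∫ s in (0 : ℝ)..1, |fAux (l * b) (y + X s.toNNReal ω)|) +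
    b / 2 * Real.exp l * (localTime (fun t => X t ω) (-y) 1).toReal

namespace IsRegularVersion

variable (hV : IsRegularVersion P B N X M)
include hV

lemma measurable_comp_gridCeil (n : ℕ) {τ : Ω → ℝ≥0} (hτ : Measurable τ) :
    Measurable fun ω => M (gridCeil n (τ ω)) ω := by
  set F : ℕ × Ω → ℕ := fun p => M ((p.1 : ℝ≥0) / n) p.2 with hF
  have h1 : Measurable F := by
    refine measurable_from_prod_countable_right fun k => ?_
    have : (fun ω => F (k, ω)) = M ((k : ℝ≥0) / n) := rfl
    rw [this]
    exact hV.measM _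
  have h2 : Measurable fun ω => (⌈n * τ ω⌉₊, ω) :=
    (Nat.measurable_ceil.comp (hτ.const_mul (n : ℝ≥0))).prodMk measurable_id
  have h3 : (fun ω => M (gridCeil n (τ ω)) ω) = F ∘ fun ω => (⌈n * τ ω⌉₊, ω) := rfl
  rw [h3]
  exact h1.comp h2

lemma eventually_gridCeil_eq (t : ℝ≥0) (ω : Ω) :
    ∀ᶠ n : ℕ in atTop, M (gridCeil (n + 1) t) ω = M t ω := by
  have h : Tendsto (fun n : ℕ => gridCeil (n + 1) t) atTop (𝓝[Set.Ici t] t) :=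
    tendsto_nhdsWithin_iff.2 ⟨tendsto_gridCeil t, .of_forall fun n => le_gridCeil n.succ_pos t⟩
  have h2 := (hV.right_cont ω t).tendsto.comp h
  rw [nhds_discrete, tendsto_pure] at h2
  exact h2

/-- Grid times take countably many values and decrease the problem to fixed times; right-continuity
then passes to the limit. -/
lemma measurable_comp {τ : Ω → ℝ≥0} (hτ : Measurable τ) : Measurable fun ω => M (τ ω) ω := by
  refine measurable_of_tendsto_metrizable (f := fun n ω => M (gridCeil (n + 1) (τ ω)) ω)
    (fun n => hV.measurable_comp_gridCeil _ hτ) ?_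
  rw [tendsto_pi_nhds]
  intro ω
  rw [nhds_discrete, tendsto_pure]
  exact hV.eventually_gridCeil_eq (τ ω) ω

lemma measurable_path : Measurable fun p : ℝ × Ω => X p.1.toNNReal p.2 :=
  hV.measurable_uncurry.comp ((measurable_real_toNNReal.comp measurable_fst).prodMk measurable_snd)

lemma measurable_integral_path {g : ℝ → ℝ} (hg : Measurable g) {τ : Ω → ℝ≥0} (hτ : Measurable τ) :
    Measurable fun ω => ∫ s in (0 : ℝ)..(τ ω : ℝ), g (X s.toNNReal ω) := by
  have hS : MeasurableSet {p : Ω × ℝ | 0 < p.2 ∧ p.2 ≤ τ p.1} :=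
    (measurableSet_lt measurable_const measurable_snd).inter
      (measurableSet_le measurable_snd (by fun_prop))
  have hm : Measurable fun p : Ω × ℝ => g (X p.2.toNNReal p.1) :=
    hg.comp (hV.measurable_path.comp measurable_swap)
  have h := (hm.indicator hS).stronglyMeasurable.integral_prod_right' (ν := volume)
  convert h.measurable using 1
  ext ω
  rw [intervalIntegral.integral_of_le (τ ω).coe_nonneg, ← integral_indicator measurableSet_Ioc]
  rfl

lemma measurable_payoff (y : ℝ) {τ : Ω → ℝ≥0} (hτ : Measurable τ) :
    Measurable (payoff l b M X y τ) := by
  have hM := hV.measurable_comp hτ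
  have h1 : ∀ k : ℕ, Measurable fun ω => (if M (τ ω) ω = k then (1 : ℝ) else 0) := fun k =>
    Measurable.ite (hM (measurableSet_singleton k)) measurable_const measurable_const
  have h10 := h1 0
  have h11 := h1 1
  have h2 := hV.measurable_integral_path (g := fun x => fAux (l * b) (y + x))
    (by have := continuous_fAux (l * b); fun_prop) hτ
  have h3 : Measurable fun ω => localTime (fun t => X t ω) (-y) (τ ω : ℝ≥0∞) :=
    measurable_localTime hV.measurable_uncurry _ (by fun_prop)
  have h4 : Measurable fun ω => localTime (fun t => X t ω) (-y) (firstJumpTime M ω) :=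
    measurable_localTime hV.measurable_uncurry _ (measurable_firstJumpTime hV.measM hV.mono)
  unfold payoff
  fun_prop

lemma integrable_integral_path (hB : IsBrownianReal B P) {u v : ℝ} (hu : 0 ≤ u) (huv : u ≤ v)
    {g : ℝ → ℝ} (hg : Measurable g) {C : ℝ} (hC : ∀ x, |g x| ≤ C * (1 + x ^ 4)) :
    Integrable (fun ω => ∫ s in u..v, g (X s.toNNReal ω)) P := by
  simp_rw [intervalIntegral.integral_of_le huv]
  exact ((hV.isContBrownian hB).integrable_prod (b := v) hu hg hC).integral_prod_right

lemma localTime_lt_top (hB : IsBrownianReal B P) (a : ℝ) :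
    ∀ᵐ ω ∂P, localTime (fun t => X t ω) a 1 < ∞ :=
  ae_lt_top (measurable_localTime hV.measurable_uncurry a measurable_const)
    (lintegral_localTime_lt_top hV.measurable_uncurry (hV.isContBrownian hB) a).ne

lemma integrable_localTime (hB : IsBrownianReal B P) (a : ℝ) :
    Integrable (fun ω => (localTime (fun t => X t ω) a 1).toReal) P :=
  integrable_toReal_of_lintegral_ne_top
    (measurable_localTime hV.measurable_uncurry a measurable_const).aemeasurable
    (lintegral_localTime_lt_top hV.measurable_uncurry (hV.isContBrownian hB) a).ne

lemma integrable_payoffBound (hB : IsBrownianReal B P) (y : ℝ) :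
    Integrable (payoffBound l b X y) P := by
  refine ((hV.integrable_integral_path hB le_rfl zero_le_one
    (g := fun x => |fAux (l * b) (y + x)|) ?_ (C := (1 + l * b) * (1 + |y|))
    fun x => ?_).const_mul _).add ((hV.integrable_localTime hB (-y)).const_mul _)
  · have := continuous_fAux (l * b)
    fun_prop
  · rw [abs_abs]
    exact abs_fAux_add_le (by positivity) y x

lemma abs_payoff_le (hB : IsBrownianReal B P) (y : ℝ) :
    ∀ᵐ ω ∂P, ∀ τ : Ω → ℝ≥0, τ ω ≤ 1 → |payoff l b M X y τ ω| ≤ payoffBound l b X y ω := by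
  filter_upwards [hV.localTime_lt_top hB (-y)] with ω hL τ hτ
  have hτ' : (τ ω : ℝ) ≤ 1 := by exact_mod_cast hτ
  have hexp : Real.exp (l * τ ω) ≤ Real.exp l :=
    Real.exp_le_exp.2 (mul_le_of_le_one_right l.2 hτ')
  have hcf := continuous_fAux (l * b)
  have hcX := (hV.cont ω).comp continuous_real_toNNReal
  have hcg : Continuous fun s : ℝ => fAux (l * b) (y + X s.toNNReal ω) :=
    hcf.comp (continuous_const.add hcX)
  have hI : |∫ s in (0 : ℝ)..(τ ω : ℝ), fAux (l * b) (y + X s.toNNReal ω)| ≤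
      ∫ s in (0 : ℝ)..1, |fAux (l * b) (y + X s.toNNReal ω)| := by
    refine (intervalIntegral.abs_integral_le_integral_abs (τ ω).2).trans ?_
    exact intervalIntegral.integral_mono_interval le_rfl (τ ω).2 hτ'
      (ae_of_all _ fun s => abs_nonneg _) (hcg.abs.intervalIntegrable _ _)
  unfold payoff payoffBound
  refine (abs_add_le _ _).trans (add_le_add ?_ ?_)
  · rw [abs_mul, abs_mul, abs_of_pos (Real.exp_pos _)]
    refine mul_le_mul ?_ hI (abs_nonneg _) (Real.exp_pos _).le
    refine (mul_le_of_le_one_right (Real.exp_pos _).le ?_).trans hexp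
    split_ifs <;> simp
  · split_ifs with h
    -- On {M_τ = 1} one has T₁ ≤ τ ≤ 1, so both local times lie between 0 and L_1. Finiteness of L_1
    -- matters here, because `toReal` sends ∞ to 0 and is monotone only below a finite value.
    · have hT : firstJumpTime M ω ≤ 1 :=
        (firstJumpTime_le h.symm.le).trans (by exact_mod_cast hτ)
      have m1 := ENNReal.toReal_mono hL.ne
        (localTime_mono (fun t => X t ω) (-y) (show ((τ ω : ℝ≥0) : ℝ≥0∞) ≤ 1 by exact_mod_cast hτ))
      have m2 := ENNReal.toReal_mono hL.ne (localTime_mono (fun t => X t ω) (-y) hT)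
      rw [mul_one, abs_mul, abs_of_nonneg (by positivity)]
      refine mul_le_mul (by gcongr) ?_ (abs_nonneg _) (by positivity)
      rw [abs_le]
      constructor
      · linarith [ENNReal.toReal_nonneg (a := localTime (fun t => X t ω) (-y) (τ ω : ℝ≥0∞))]
      · linarith [ENNReal.toReal_nonneg
          (a := localTime (fun t => X t ω) (-y) (firstJumpTime M ω))]
    · rw [mul_zero, zero_mul, abs_zero]
      positivity

lemma integrable_payoff (hB : IsBrownianReal B P) (y : ℝ) {τ : Ω → ℝ≥0} (hτ : Measurable τ)
    (hτ1 : ∀ ω, τ ω ≤ 1) : Integrable (payoff l b M X y τ) P := by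
  refine (hV.integrable_payoffBound (l := l) (b := b) hB y).mono' (hV.measurable_payoff y hτ).aestronglyMeasurable ?_
  filter_upwards [hV.abs_payoff_le (l := l) (b := b) hB y] with ω h
  exact h τ (hτ1 ω)

end IsRegularVersion

end Setting

/-! ### Change of measure along the grid. -/

lemma sum_ite_lt_eq {n K : ℕ} (h : K ≤ n) (f : ℕ → ℝ) :
    ∑ k ∈ Finset.range n, (if k < K then f k else 0) = ∑ k ∈ Finset.range K, f k := by
  rw [← Finset.sum_filter]
  congr 1
  ext k
  simp only [Finset.mem_filter, Finset.mem_range]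
  lia

lemma sum_ite_not_lt_sub {n K : ℕ} (h : K ≤ n) (p : ℕ → ℝ) :
    ∑ k ∈ Finset.range n, (if k < K then 0 else p (k + 1) - p k) = p n - p K := by
  have h1 := sum_ite_lt_eq h fun k => p (k + 1) - p k
  have h2 : ∑ k ∈ Finset.range n, (if k < K then 0 else p (k + 1) - p k) =
      ∑ k ∈ Finset.range n, ((p (k + 1) - p k) - if k < K then p (k + 1) - p k else 0) := by
    refine Finset.sum_congr rfl fun k _ => ?_
    split_ifs <;> simp
  rw [h2, Finset.sum_sub_distrib, h1, Finset.sum_range_sub, Finset.sum_range_sub]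
  ring

/-- The density `e^{lt} 1_{M_t = 0}` of the law conditioned on the absence of jumps. -/
noncomputable def noJumpDensity {Ω : Type*} (l : ℝ≥0) (M : ℝ≥0 → Ω → ℕ) (t : ℝ≥0) (ω : Ω) : ℝ :=
  Real.exp (l * t) * (if M t ω = 0 then 1 else 0)

lemma noJumpDensity_nonneg {Ω : Type*} (l : ℝ≥0) (M : ℝ≥0 → Ω → ℕ) (t : ℝ≥0) (ω : Ω) :
    0 ≤ noJumpDensity l M t ω := by
  unfold noJumpDensity
  split_ifs <;> positivity

lemma noJumpDensity_le {Ω : Type*} (l : ℝ≥0) (M : ℝ≥0 → Ω → ℕ) {t : ℝ≥0} (ht : t ≤ 1) (ω : Ω) :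
    noJumpDensity l M t ω ≤ Real.exp l := by
  unfold noJumpDensity
  have h : Real.exp (l * t) ≤ Real.exp l :=
    Real.exp_le_exp.2 (mul_le_of_le_one_right l.2 (by exact_mod_cast ht))
  split_ifs
  · simpa using h
  · simpa using (Real.exp_pos _).le

section Setting

variable {Ω : Type*} [MeasurableSpace Ω] {P : Measure Ω} [IsProbabilityMeasure P]
  {l b : ℝ≥0} {B : ℝ≥0 → Ω → ℝ} {N : ℝ≥0 → Ω → ℕ} {hBm : ∀ t, Measurable (B t)}
  {hNm : ∀ t, Measurable (N t)} {X : ℝ≥0 → Ω → ℝ} {M : ℝ≥0 → Ω → ℕ}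

namespace IsRegularVersion

variable (hV : IsRegularVersion P B N X M)
include hV

lemma eq_zero_iff {t t' : ℝ≥0} (h : t ≤ t') (ω : Ω) :
    M t' ω = 0 ↔ M t ω = 0 ∧ M t' ω - M t ω = 0 := by
  have : M t ω ≤ M t' ω := hV.mono ω h
  lia

lemma measurable_noJumpDensity (t : ℝ≥0) : Measurable (noJumpDensity l M t) :=
  (Measurable.ite (hV.measM t (measurableSet_singleton 0)) measurable_const
    measurable_const).const_mul _

lemma integrable_noJumpDensity_mul {t : ℝ≥0} (ht : t ≤ 1) {f : Ω → ℝ} (hf : Integrable f P) :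
    Integrable (fun ω => noJumpDensity l M t ω * f ω) P := by
  refine hf.bdd_mul (c := Real.exp l) (hV.measurable_noJumpDensity t).aestronglyMeasurable
    (ae_of_all _ fun ω => ?_)
  rw [Real.norm_of_nonneg (noJumpDensity_nonneg _ _ _ _)]
  exact noJumpDensity_le l M ht ω

lemma setIntegral_noJumpDensity (t : ℝ≥0) (A : Set Ω) (f : Ω → ℝ) :
    ∫ ω in A, noJumpDensity l M t ω * f ω ∂P =
      Real.exp (l * t) * ∫ ω in A ∩ {ω | M t ω = 0}, f ω ∂P := by
  have hm : MeasurableSet {ω | M t ω = 0} := hV.measM t (measurableSet_singleton 0)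
  rw [← integral_const_mul, ← setIntegral_indicator hm]
  congr 1 with ω
  by_cases h : M t ω = 0 <;> simp [noJumpDensity, h]

/-- `e^{lt} 1_{M_t = 0}` is a martingale, also jointly with the Brownian path. -/
lemma setIntegral_noJumpDensity_eq (hB : IsBrownianReal B P) (hN : IsPoissonProcess N l P)
    (hindep : IndepFun (fun ω t => N t ω) (fun ω t => B t ω) P) {t t' : ℝ≥0} (htt : t ≤ t')
    {A : Set Ω} (hA : MeasurableSet[pairFiltration N B hNm hBm t] A) {u v : ℝ}
    (hu : 0 ≤ u) (huv : u ≤ v) {g : ℝ → ℝ} (hg : Measurable g) {C : ℝ}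
    (hC : ∀ x, |g x| ≤ C * (1 + x ^ 4)) :
    ∫ ω in A, noJumpDensity l M t' ω * (∫ s in u..v, g (X s.toNNReal ω)) ∂P =
      ∫ ω in A, noJumpDensity l M t ω * (∫ s in u..v, g (X s.toNNReal ω)) ∂P := by
  have e : A ∩ {ω | M t' ω = 0} =
      A ∩ {ω | M t ω = 0} ∩ {ω | M t' ω - M t ω ∈ ({0} : Set ℕ)} := by
    ext ω
    have := hV.eq_zero_iff htt ω
    simp only [Set.mem_inter_iff, Set.mem_ofPred_eq, Set.mem_singleton_iff]
    tauto
  have hp : P.real {ω | M t' ω - M t ω ∈ ({0} : Set ℕ)} = Real.exp (-(l * (t' - t))) :=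
    hV.prob_increment_eq_zero hN htt
  rw [hV.setIntegral_noJumpDensity, hV.setIntegral_noJumpDensity, e,
    hV.setIntegral_jump hB hN hindep htt hA {0} hu huv hg hC, hp, ← mul_assoc, ← Real.exp_add]
  congr 2
  ring

lemma setIntegral_cond_eq (hN : IsPoissonProcess N l P) {A : Set Ω} (hA : MeasurableSet A)
    (f : Ω → ℝ) : ∫ ω in A, f ω ∂P[|{ω | M 1 ω = 0}] =
      ∫ ω in A, noJumpDensity l M 1 ω * f ω ∂P := by
  rw [hV.setIntegral_cond hN hA, hV.setIntegral_noJumpDensity]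
  simp

/-- Optional stopping for `e^{lt} 1_{M_t = 0}` at a grid stopping time. -/
lemma setIntegral_noJumpDensity_gridCeil (hB : IsBrownianReal B P) (hN : IsPoissonProcess N l P)
    (hindep : IndepFun (fun ω t => N t ω) (fun ω t => B t ω) P) {τ : Ω → ℝ≥0}
    (hτ : τ ∈ stoppingTimesUnit (pairFiltration N B hNm hBm)) {n : ℕ} (hn : 0 < n) (k : ℕ)
    {u v : ℝ} (hu : 0 ≤ u) (huv : u ≤ v) {g : ℝ → ℝ} (hg : Measurable g) {C : ℝ}
    (hC : ∀ x, |g x| ≤ C * (1 + x ^ 4)) :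
    ∫ ω in {ω | (k : ℝ≥0) / n < τ ω}, noJumpDensity l M (gridCeil n (τ ω)) ω *
        (∫ s in u..v, g (X s.toNNReal ω)) ∂P =
      ∫ ω in {ω | (k : ℝ≥0) / n < τ ω}, (∫ s in u..v, g (X s.toNNReal ω))
        ∂P[|{ω | M 1 ω = 0}] := by
  have hn' : (0 : ℝ≥0) < n := by exact_mod_cast hn
  have hA : ∀ j : ℕ, MeasurableSet[pairFiltration N B hNm hBm ((j : ℝ≥0) / n)]
      {ω | (j : ℝ≥0) / n < τ ω} := fun j => measurableSet_lt_of_mem_stoppingTimesUnit hτ _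
  have hA' : ∀ j : ℕ, MeasurableSet {ω | (j : ℝ≥0) / n < τ ω} := fun j =>
    (pairFiltration N B hNm hBm).le _ _ (hA j)
  have hI := hV.integrable_integral_path hB hu huv hg hC
  have hle : ∀ j : ℕ, j ≤ n → (j : ℝ≥0) / n ≤ 1 := fun j hj => by
    rw [div_le_one hn']; exact_mod_cast hj
  have hint : ∀ j : ℕ, j ≤ n → Integrable (fun ω => noJumpDensity l M ((j : ℝ≥0) / n) ω *
      (∫ s in u..v, g (X s.toNNReal ω))) P := fun j hj =>
    hV.integrable_noJumpDensity_mul (hle j hj) hI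
  rw [hV.setIntegral_cond_eq hN (hA' k), eq_comm, ← sub_eq_zero]
  set I : Ω → ℝ := fun ω => ∫ s in u..v, g (X s.toNNReal ω) with hIdef
  -- The density at time 1 is the density at the grid time plus its increments over the cells from
  -- the grid time to 1, those with τ ≤ j/n.
  have htel : ∀ ω, noJumpDensity l M 1 ω * I ω = noJumpDensity l M (gridCeil n (τ ω)) ω * I ω +
      ∑ j ∈ Finset.range n, {ω | (j : ℝ≥0) / n < τ ω}ᶜ.indicator (fun ω =>
        noJumpDensity l M (((j + 1 : ℕ) : ℝ≥0) / n) ω * I ω -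
          noJumpDensity l M ((j : ℝ≥0) / n) ω * I ω) ω := by
    intro ω
    have h := sum_ite_not_lt_sub (ceil_le_of_le_one (n := n) (hτ.2 ω))
      fun j => noJumpDensity l M ((j : ℝ≥0) / n) ω * I ω
    have e : ∀ j : ℕ, {ω | (j : ℝ≥0) / n < τ ω}ᶜ.indicator (fun ω =>
        noJumpDensity l M (((j + 1 : ℕ) : ℝ≥0) / n) ω * I ω -
          noJumpDensity l M ((j : ℝ≥0) / n) ω * I ω) ω =
        if j < ⌈n * τ ω⌉₊ then 0 else noJumpDensity l M (((j + 1 : ℕ) : ℝ≥0) / n) ω * I ω -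
          noJumpDensity l M ((j : ℝ≥0) / n) ω * I ω := by
      intro j
      by_cases hj : j < ⌈n * τ ω⌉₊
      · rw [if_pos hj, Set.indicator_of_notMem]
        simpa using (lt_iff_lt_ceil hn (τ ω) j).2 hj
      · rw [if_neg hj, Set.indicator_of_mem]
        simpa using fun h' => hj ((lt_iff_lt_ceil hn (τ ω) j).1 h')
    simp_rw [e]
    rw [h, div_self hn'.ne']
    simp [gridCeil]
  have hjint : ∀ j ∈ Finset.range n, Integrable ({ω | (j : ℝ≥0) / n < τ ω}ᶜ.indicator (fun ω =>
        noJumpDensity l M (((j + 1 : ℕ) : ℝ≥0) / n) ω * I ω -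
          noJumpDensity l M ((j : ℝ≥0) / n) ω * I ω)) P := fun j hj =>
    ((hint (j + 1) (Finset.mem_range.1 hj)).sub
      (hint j (Finset.mem_range.1 hj).le)).indicator (hA' j).compl
  have hsum := integrable_finsetSum (Finset.range n) hjint
  have hi1 : Integrable (fun ω => noJumpDensity l M 1 ω * I ω) P :=
    hV.integrable_noJumpDensity_mul le_rfl hI
  have higrid : Integrable (fun ω => noJumpDensity l M (gridCeil n (τ ω)) ω * I ω) P := by
    refine (hi1.sub hsum).congr (ae_of_all _ fun ω => ?_)
    simp only [Pi.sub_apply, htel ω, add_sub_cancel_right]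
  rw [show ∫ ω in {ω | (k : ℝ≥0) / n < τ ω}, noJumpDensity l M 1 ω * I ω ∂P = _ from
    integral_congr_ae (ae_of_all _ htel)]
  have hsum' : Integrable (fun ω => ∑ j ∈ Finset.range n, {ω | (j : ℝ≥0) / n < τ ω}ᶜ.indicator
      (fun ω => noJumpDensity l M (((j + 1 : ℕ) : ℝ≥0) / n) ω * I ω -
          noJumpDensity l M ((j : ℝ≥0) / n) ω * I ω) ω) P :=
    integrable_finsetSum (Finset.range n) hjint
  rw [integral_add higrid.restrict hsum'.restrict, add_sub_cancel_left,
    integral_finsetSum _ fun j hj => (hjint j hj).restrict]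
  refine Finset.sum_eq_zero fun j hj => ?_
  have hj := Finset.mem_range.1 hj
  rw [setIntegral_indicator (hA' j).compl]
  -- For j < k the events k/n < τ and τ ≤ j/n are incompatible. For j ≥ k their intersection is
  -- known at time j/n, and the martingale increment integrates to zero over it.
  by_cases hjk : j < k
  · have : {ω | (k : ℝ≥0) / n < τ ω} ∩ {ω | (j : ℝ≥0) / n < τ ω}ᶜ = ∅ := by
      rw [← Set.sdiff_eq, Set.sdiff_eq_empty]
      intro ω hω
      refine lt_of_le_of_lt ?_ (show (k : ℝ≥0) / n < τ ω from hω)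
      gcongr
    rw [this, Measure.restrict_empty, integral_zero_measure]
  · have hkj : (k : ℝ≥0) / n ≤ (j : ℝ≥0) / n := by
      have := not_lt.1 hjk
      gcongr
    have hE : MeasurableSet[pairFiltration N B hNm hBm ((j : ℝ≥0) / n)]
        ({ω | (k : ℝ≥0) / n < τ ω} ∩ {ω | (j : ℝ≥0) / n < τ ω}ᶜ) :=
      ((pairFiltration N B hNm hBm).mono hkj _ (hA k)).inter (hA j).compl
    rw [integral_sub (hint (j + 1) hj).restrict (hint j hj.le).restrict,
      hV.setIntegral_noJumpDensity_eq hB hN hindep (by gcongr; simp) hE hu huv hg hC, sub_self]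

lemma integral_eq_sum_cells {n : ℕ} (hn : 0 < n) {t : ℝ≥0} (ht : t ≤ 1) {g : ℝ → ℝ}
    (hg : Continuous g) (ω : Ω) :
    ∫ s in (0 : ℝ)..(gridCeil n t : ℝ), g (X s.toNNReal ω) =
      ∑ k ∈ Finset.range n, if (k : ℝ≥0) / n < t then
        ∫ s in ((k : ℝ) / n)..((k + 1 : ℝ) / n), g (X s.toNNReal ω) else 0 := by
  have hc : Continuous fun s : ℝ => g (X s.toNNReal ω) :=
    hg.comp ((hV.cont ω).comp continuous_real_toNNReal)
  simp_rw [lt_iff_lt_ceil hn]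
  rw [sum_ite_lt_eq (ceil_le_of_le_one ht)]
  have := intervalIntegral.sum_integral_adjacent_intervals (n := ⌈n * t⌉₊)
    (a := fun i : ℕ => (i : ℝ) / n) (f := fun s => g (X s.toNNReal ω)) (μ := volume)
    fun i _ => hc.intervalIntegrable _ _
  simp only [Nat.cast_add, Nat.cast_one, Nat.cast_zero, zero_div] at this
  rw [this]
  simp [gridCeil]

/-- The first part of the expected payoff is an expectation without jumps. -/
lemma integral_noJumpDensity_mul_gridCeil (hB : IsBrownianReal B P) (hN : IsPoissonProcess N l P)
    (hindep : IndepFun (fun ω t => N t ω) (fun ω t => B t ω) P) {τ : Ω → ℝ≥0}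
    (hτ : τ ∈ stoppingTimesUnit (pairFiltration N B hNm hBm)) {n : ℕ} (hn : 0 < n)
    {g : ℝ → ℝ} (hg : Continuous g) {C : ℝ} (hC : ∀ x, |g x| ≤ C * (1 + x ^ 4)) :
    Integrable (fun ω => noJumpDensity l M (gridCeil n (τ ω)) ω *
      ∫ s in (0 : ℝ)..(gridCeil n (τ ω) : ℝ), g (X s.toNNReal ω)) P ∧
    ∫ ω, noJumpDensity l M (gridCeil n (τ ω)) ω *
        (∫ s in (0 : ℝ)..(gridCeil n (τ ω) : ℝ), g (X s.toNNReal ω)) ∂P =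
      ∑ k ∈ Finset.range n, ∫ ω in {ω | (k : ℝ≥0) / n < τ ω},
        (∫ s in ((k : ℝ) / n)..((k + 1 : ℝ) / n), g (X s.toNNReal ω)) ∂P[|{ω | M 1 ω = 0}] := by
  have hA' : ∀ j : ℕ, MeasurableSet {ω | (j : ℝ≥0) / n < τ ω} := fun j =>
    (pairFiltration N B hNm hBm).le _ _ (measurableSet_lt_of_mem_stoppingTimesUnit hτ _)
  have hτm := measurable_of_mem_stoppingTimesUnit hτ
  have hm : Measurable fun ω => noJumpDensity l M (gridCeil n (τ ω)) ω := by
    unfold noJumpDensity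
    have h1 := (measurable_gridCeil n).comp hτm
    have h2 : Measurable fun ω => (if M (gridCeil n (τ ω)) ω = 0 then (1 : ℝ) else 0) :=
      Measurable.ite (hV.measurable_comp_gridCeil n hτm (measurableSet_singleton 0))
        measurable_const measurable_const
    exact (Real.measurable_exp.comp ((measurable_coe_nnreal_real.comp h1).const_mul _)).mul h2
  have hcell : ∀ k : ℕ, Integrable (fun ω => noJumpDensity l M (gridCeil n (τ ω)) ω *
      ∫ s in ((k : ℝ) / n)..((k + 1 : ℝ) / n), g (X s.toNNReal ω)) P := by
    intro k
    refine (hV.integrable_integral_path hB (by positivity) (by gcongr; linarith)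
      hg.measurable hC).bdd_mul (c := Real.exp l) hm.aestronglyMeasurable (ae_of_all _ fun ω => ?_)
    rw [Real.norm_of_nonneg (noJumpDensity_nonneg _ _ _ _)]
    exact noJumpDensity_le l M (gridCeil_le_one hn (hτ.2 ω)) ω
  have e : ∀ ω, noJumpDensity l M (gridCeil n (τ ω)) ω *
      (∫ s in (0 : ℝ)..(gridCeil n (τ ω) : ℝ), g (X s.toNNReal ω)) =
      ∑ k ∈ Finset.range n, {ω | (k : ℝ≥0) / n < τ ω}.indicator (fun ω =>
        noJumpDensity l M (gridCeil n (τ ω)) ω *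
          ∫ s in ((k : ℝ) / n)..((k + 1 : ℝ) / n), g (X s.toNNReal ω)) ω := by
    intro ω
    rw [hV.integral_eq_sum_cells hn (hτ.2 ω) hg, Finset.mul_sum]
    refine Finset.sum_congr rfl fun k _ => ?_
    by_cases h : (k : ℝ≥0) / n < τ ω <;> simp [h]
  simp_rw [e]
  refine ⟨integrable_finsetSum _ fun k _ => (hcell k).indicator (hA' k), ?_⟩
  rw [integral_finsetSum _ fun k _ => (hcell k).indicator (hA' k)]
  refine Finset.sum_congr rfl fun k _ => ?_
  rw [integral_indicator (hA' k)]
  exact hV.setIntegral_noJumpDensity_gridCeil hB hN hindep hτ hn k (by positivity)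
    (by gcongr; linarith) hg.measurable hC

end IsRegularVersion

end Setting

/-! ### No grid stopping time is profitable far below zero. -/

/-- The quadratic (3/10) x² lies above the line x - 5/6, tangent at x = 5/3, hence above x - c. It
replaces the positive part by a function covered by Dynkin's formula. -/
lemma fAux_sub_le {a c : ℝ} (ha : 0 ≤ a) (hc : 19 / 20 ≤ c) (x : ℝ) :
    fAux a (x - c) ≤ x - c + a * (3 / 10 * x ^ 2) := by
  unfold fAux
  have h : max (x - c) 0 ≤ 3 / 10 * x ^ 2 :=
    max_le (by nlinarith [sq_nonneg (x - 5 / 3)]) (by positivity)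
  linarith [mul_le_mul_of_nonneg_left h ha]

section Setting

variable {Ω : Type*} [MeasurableSpace Ω] {P : Measure Ω} [IsProbabilityMeasure P]
  {l b : ℝ≥0} {B : ℝ≥0 → Ω → ℝ} {N : ℝ≥0 → Ω → ℕ} {hBm : ∀ t, Measurable (B t)}
  {hNm : ∀ t, Measurable (N t)} {X : ℝ≥0 → Ω → ℝ} {M : ℝ≥0 → Ω → ℕ}

/-- The event that `τ` is after `k / n` and that the first jump of `M` falls between `k / n` and
`(k + 1) / n`. -/
def jumpCell (M : ℝ≥0 → Ω → ℕ) (τ : Ω → ℝ≥0) (n k : ℕ) : Set Ω :=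
  {ω | (k : ℝ≥0) / n < τ ω} ∩ {ω | M ((k : ℝ≥0) / n) ω = 0} ∩
    {ω | M (((k + 1 : ℕ) : ℝ≥0) / n) ω - M ((k : ℝ≥0) / n) ω ∈ ({0}ᶜ : Set ℕ)}

namespace IsRegularVersion

variable (hV : IsRegularVersion P B N X M)
include hV

lemma prob_jump_le (hN : IsPoissonProcess N l P) {t t' : ℝ≥0} (h : t ≤ t') :
    P.real {ω | M t' ω - M t ω ∈ ({0}ᶜ : Set ℕ)} ≤ l * (t' - t) := by
  have hm : MeasurableSet {ω | M t' ω - M t ω = 0} :=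
    ((hV.measM t').sub (hV.measM t)) (measurableSet_singleton 0)
  have e : {ω | M t' ω - M t ω ∈ ({0}ᶜ : Set ℕ)} = {ω | M t' ω - M t ω = 0}ᶜ := rfl
  rw [e, probReal_compl_eq_one_sub hm, hV.prob_increment_eq_zero hN h]
  linarith [Real.add_one_le_exp (-(l * ((t' : ℝ) - t)))]

lemma measurableSet_jumpCell {τ : Ω → ℝ≥0} (hτ : Measurable τ) (n k : ℕ) :
    MeasurableSet (jumpCell M τ n k) :=
  ((measurableSet_lt measurable_const hτ).inter (hV.measM _ (measurableSet_singleton 0))).inter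
    (((hV.measM _).sub (hV.measM _)) (measurableSet_singleton 0).compl)

/-- Removing the event of no jump up to time `t` decreases expectations conditioned on the absence
of jumps. -/
lemma setIntegral_inter_le_cond (hB : IsBrownianReal B P) (hN : IsPoissonProcess N l P)
    (hindep : IndepFun (fun ω t => N t ω) (fun ω t => B t ω) P) {t : ℝ≥0} (ht : t ≤ 1)
    {A : Set Ω} (hA : MeasurableSet[pairFiltration N B hNm hBm t] A) {u v : ℝ}
    (hu : 0 ≤ u) (huv : u ≤ v) {g : ℝ → ℝ} (hg : Measurable g) {C : ℝ}
    (hC : ∀ x, |g x| ≤ C * (1 + x ^ 4)) (hg0 : ∀ x, 0 ≤ g x) :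
    ∫ ω in A ∩ {ω | M t ω = 0}, (∫ s in u..v, g (X s.toNNReal ω)) ∂P ≤
      ∫ ω in A, (∫ s in u..v, g (X s.toNNReal ω)) ∂P[|{ω | M 1 ω = 0}] := by
  rw [hV.setIntegral_cond_eq hN ((pairFiltration N B hNm hBm).le t A hA),
    hV.setIntegral_noJumpDensity_eq hB hN hindep ht hA hu huv hg hC,
    hV.setIntegral_noJumpDensity]
  refine le_mul_of_one_le_left (integral_nonneg fun ω => ?_) (Real.one_le_exp (by positivity))
  exact intervalIntegral.integral_nonneg huv fun s _ => hg0 _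

/-- The hypotheses of the grid estimates under the law conditioned on the absence of jumps. -/
lemma indepOfFuture_grid (hB : IsBrownianReal B P) (hN : IsPoissonProcess N l P)
    (hindep : IndepFun (fun ω t => N t ω) (fun ω t => B t ω) P) {τ : Ω → ℝ≥0}
    (hτ : τ ∈ stoppingTimesUnit (pairFiltration N B hNm hBm)) (n k : ℕ) :
    IndepOfFuture (fun s => X s.toNNReal) P[|{ω | M 1 ω = 0}] {ω | (k : ℝ≥0) / n < τ ω}
      ((k : ℝ) / n) := by
  have := hV.indepOfFuture_cond hB hN hindep
    (measurableSet_lt_of_mem_stoppingTimesUnit hτ ((k : ℝ≥0) / n))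
  simpa using! this

omit hV in
lemma antitone_grid (τ : Ω → ℝ≥0) (n : ℕ) :
    Antitone fun k : ℕ => {ω | (k : ℝ≥0) / n < τ ω} := by
  intro i j hij ω hω
  refine lt_of_le_of_lt ?_ (show (j : ℝ≥0) / n < τ ω from hω)
  gcongr

/-- A jump in a cell has probability at most l / n and is independent of the past and of the
Brownian path. The sum is thus at most l times the expectation, conditioned on no jump, of the grid
time multiplied by the occupation density over [0, 1]. -/
lemma sum_jumpCell_windowDensity_le (hB : IsBrownianReal B P) (hN : IsPoissonProcess N l P)
    (hindep : IndepFun (fun ω t => N t ω) (fun ω t => B t ω) P) {τ : Ω → ℝ≥0}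
    (hτ : τ ∈ stoppingTimesUnit (pairFiltration N B hNm hBm)) {n : ℕ} (hn : 0 < n)
    {c ε : ℝ} (hε : 0 < ε) (hc : 2 * ε < c) :
    ∑ k ∈ Finset.range n, ∫ ω in jumpCell M τ n k,
        (∫ s in (0 : ℝ)..1, windowDensity c ε (X s.toNNReal ω)) ∂P ≤
      l * ((4 / 5 + 1 / (c - 2 * ε)) * (1 / n * ∑ k ∈ Finset.range n,
        P[|{ω | M 1 ω = 0}].real {ω | (k : ℝ≥0) / n < τ ω})) := by
  have := hV.isProbabilityMeasure_cond hN
  have hn' : (0 : ℝ) < n := by exact_mod_cast hn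
  refine le_trans ?_ (mul_le_mul_of_nonneg_left (sum_setIntegral_total_windowDensity_le
    (hV.isContBrownian_cond hB hN hindep hBm hNm) hn (antitone_grid τ n)
    (fun k _ => hV.indepOfFuture_grid hB hN hindep hτ n k) hε hc) l.2)
  rw [Finset.mul_sum, Finset.mul_sum]
  refine Finset.sum_le_sum fun k hk => ?_
  have hk1 : (k : ℝ≥0) / n ≤ 1 := by
    rw [div_le_one (by exact_mod_cast hn)]
    exact_mod_cast (Finset.mem_range.1 hk).le
  have hkk : (k : ℝ≥0) / n ≤ ((k + 1 : ℕ) : ℝ≥0) / n := by gcongr; simp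
  have hA := measurableSet_lt_of_mem_stoppingTimesUnit hτ ((k : ℝ≥0) / n)
  have hwm := measurable_windowDensity c ε
  have hw0 := windowDensity_nonneg (c := c) hε
  have hC : ∀ x, |windowDensity c ε x| ≤ 1 / (2 * ε) * (1 + x ^ 4) := fun x => by
    rw [abs_of_nonneg (hw0 x)]
    refine (windowDensity_le hε x).trans (le_mul_of_one_le_right (by positivity) ?_)
    linarith [show 0 ≤ x ^ 4 by positivity]
  rw [jumpCell, hV.setIntegral_jump hB hN hindep hkk hA _ le_rfl zero_le_one hwm hC]
  have h1 := hV.prob_jump_le hN hkk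
  have h2 := hV.setIntegral_inter_le_cond hB hN hindep hk1 hA le_rfl zero_le_one hwm hC hw0
  have h3 : 0 ≤ ∫ ω in {ω | (k : ℝ≥0) / n < τ ω},
      (∫ s in (0 : ℝ)..1, windowDensity c ε (X s.toNNReal ω)) ∂P[|{ω | M 1 ω = 0}] :=
    integral_nonneg fun ω => intervalIntegral.integral_nonneg zero_le_one fun s _ => hw0 _
  refine (mul_le_mul_of_nonneg_left h2 measureReal_nonneg).trans
    ((mul_le_mul_of_nonneg_right h1 h3).trans_eq ?_)
  push_cast
  ring

/-- The local time accumulated on the event that a jump occurs before a grid stopping time. -/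
lemma sum_jumpCell_localTime_le (hB : IsBrownianReal B P) (hN : IsPoissonProcess N l P)
    (hindep : IndepFun (fun ω t => N t ω) (fun ω t => B t ω) P) {τ : Ω → ℝ≥0}
    (hτ : τ ∈ stoppingTimesUnit (pairFiltration N B hNm hBm)) {n : ℕ} (hn : 0 < n)
    {c : ℝ} (hc : 0 < c) :
    ∑ k ∈ Finset.range n, ∫ ω in jumpCell M τ n k, (localTime (fun t => X t ω) c 1).toReal ∂P ≤
      l * ((4 / 5 + 1 / c) * (1 / n * ∑ k ∈ Finset.range n,
        P[|{ω | M 1 ω = 0}].real {ω | (k : ℝ≥0) / n < τ ω})) := by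
  set σ : ℝ := 1 / n * ∑ k ∈ Finset.range n,
    P[|{ω | M 1 ω = 0}].real {ω | (k : ℝ≥0) / n < τ ω} with hσ
  have hσ0 : 0 ≤ σ := mul_nonneg (by positivity) (Finset.sum_nonneg fun k _ => measureReal_nonneg)
  -- Gathering the cells into one measure lets Fatou's lemma be applied once, to the sum whose bound
  -- is known.
  set μ : Measure Ω := ∑ k ∈ Finset.range n, P.restrict (jumpCell M τ n k) with hμ
  have hK : Tendsto (fun ε : ℝ => (l : ℝ) * ((4 / 5 + 1 / (c - 2 * ε)) * σ)) (𝓝[>] 0)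
      (𝓝 (l * ((4 / 5 + 1 / c) * σ))) := by
    have : ContinuousAt (fun ε : ℝ => (l : ℝ) * ((4 / 5 + 1 / (c - 2 * ε)) * σ)) 0 := by
      have : c - 2 * 0 ≠ 0 := by simpa using hc.ne'
      fun_prop (disch := assumption)
    have h := this.tendsto
    simp only [mul_zero, sub_zero] at h
    exact h.mono_left nhdsWithin_le_nhds
  have hle : ∫⁻ ω, localTime (fun t => X t ω) c 1 ∂μ ≤
      ENNReal.ofReal (l * ((4 / 5 + 1 / c) * σ)) := by
    refine lintegral_localTime_le hV.measurable_uncurry c μ hK ?_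
    filter_upwards [Ioo_mem_nhdsGT (show 0 < c / 2 by linarith)] with ε hε
    have hw0 := windowDensity_nonneg (c := c) hε.1
    have hint : Integrable (fun ω => ∫ s in (0 : ℝ)..1, windowDensity c ε (X s.toNNReal ω)) P :=
      hV.integrable_integral_path hB le_rfl zero_le_one (measurable_windowDensity c ε)
        (C := 1 / (2 * ε)) fun x => by
          rw [abs_of_nonneg (hw0 x)]
          have := hε.1
          refine (windowDensity_le hε.1 x).trans (le_mul_of_one_le_right (by positivity) ?_)
          linarith [show 0 ≤ x ^ 4 by positivity]
    have hnn : ∀ ω, 0 ≤ ∫ s in (0 : ℝ)..1, windowDensity c ε (X s.toNNReal ω) := fun ω =>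
      intervalIntegral.integral_nonneg zero_le_one fun s _ => hw0 _
    rw [hμ, lintegral_finsetSum_measure]
    simp_rw [← ofReal_integral_eq_lintegral_ofReal hint.restrict (ae_of_all _ hnn)]
    rw [← ENNReal.ofReal_sum_of_nonneg fun k _ => integral_nonneg hnn]
    exact ENNReal.ofReal_le_ofReal
      (hV.sum_jumpCell_windowDensity_le hB hN hindep hτ hn hε.1 (by linarith [hε.2]))
  have hm := measurable_localTime hV.measurable_uncurry c (measurable_const (a := (1 : ℝ≥0∞)))
  have e : ∑ k ∈ Finset.range n, ∫ ω in jumpCell M τ n k,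
      (localTime (fun t => X t ω) c 1).toReal ∂P =
      (∫⁻ ω, localTime (fun t => X t ω) c 1 ∂μ).toReal := by
    rw [hμ, lintegral_finsetSum_measure, ENNReal.toReal_sum]
    · refine Finset.sum_congr rfl fun k _ => ?_
      exact integral_toReal hm.aemeasurable (ae_restrict_of_ae (hV.localTime_lt_top hB c))
    · intro k _
      exact ((setLIntegral_le_lintegral _ _).trans_lt
        (lintegral_localTime_lt_top hV.measurable_uncurry (hV.isContBrownian hB) c)).ne
  rw [e]
  exact ENNReal.toReal_le_of_le_ofReal (by positivity) hle

/-- If a jump occurs before a grid stopping time, then it occurs in one of the cells. -/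
lemma exists_mem_jumpCell {τ : Ω → ℝ≥0} {n : ℕ} (hn : 0 < n) {ω : Ω} (h1 : τ ω ≤ 1)
    (h : M (gridCeil n (τ ω)) ω ≠ 0) : ∃ k < n, ω ∈ jumpCell M τ n k := by
  classical
  have hex : ∃ j : ℕ, M ((j : ℝ≥0) / n) ω ≠ 0 := ⟨_, h⟩
  -- The first grid index at which M is nonzero is positive because M starts at 0; the cell sought
  -- ends there, so its index is j - 1.
  set j := Nat.find hex with hj
  have hj0 : j ≠ 0 := by
    intro h0
    have := Nat.find_spec hex
    rw [← hj, h0] at this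
    simp [hV.zeroM] at this
  obtain ⟨k, hk⟩ := Nat.exists_eq_succ_of_ne_zero hj0
  have hkK : k < ⌈n * τ ω⌉₊ := by
    have : j ≤ ⌈n * τ ω⌉₊ := Nat.find_min' hex h
    lia
  have hk0 : M ((k : ℝ≥0) / n) ω = 0 := by
    have := Nat.find_min hex (m := k) (by lia)
    simpa using this
  have hk1 : M (((k + 1 : ℕ) : ℝ≥0) / n) ω ≠ 0 := by
    have := Nat.find_spec hex
    rwa [← hj, hk] at this
  refine ⟨k, hkK.trans_le (ceil_le_of_le_one h1), ⟨(lt_iff_lt_ceil hn _ k).2 hkK, hk0⟩, ?_⟩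
  show M (((k + 1 : ℕ) : ℝ≥0) / n) ω - M ((k : ℝ≥0) / n) ω ≠ 0
  rwa [hk0, Nat.sub_zero]

/-- The local time since the first jump is replaced by the larger L_1. This removes the dependence
on T₁ and on the end point, and leaves a quantity independent of when the jump occurs. -/
lemma payoff_gridCeil_le (hB : IsBrownianReal B P) (y : ℝ) {τ : Ω → ℝ≥0} (hτ1 : ∀ ω, τ ω ≤ 1)
    {n : ℕ} (hn : 0 < n) :
    ∀ᵐ ω ∂P, payoff l b M X y (fun ω => gridCeil n (τ ω)) ω ≤
      noJumpDensity l M (gridCeil n (τ ω)) ω *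
        (∫ s in (0 : ℝ)..(gridCeil n (τ ω) : ℝ), fAux (l * b) (y + X s.toNNReal ω)) +
      b / 2 * Real.exp l * ∑ k ∈ Finset.range n, (jumpCell M τ n k).indicator
        (fun ω => (localTime (fun t => X t ω) (-y) 1).toReal) ω := by
  filter_upwards [hV.localTime_lt_top hB (-y)] with ω hL
  have hg1 := gridCeil_le_one hn (hτ1 ω)
  have hnn : ∀ k, 0 ≤ (jumpCell M τ n k).indicator
      (fun ω => (localTime (fun t => X t ω) (-y) 1).toReal) ω := fun k =>
    Set.indicator_nonneg (fun _ _ => ENNReal.toReal_nonneg) _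
  unfold payoff
  refine add_le_add le_rfl ?_
  split_ifs with h
  · obtain ⟨k, hk, hmem⟩ := hV.exists_mem_jumpCell hn (hτ1 ω) (by rw [h]; exact one_ne_zero)
    have hs := Finset.single_le_sum (f := fun k => (jumpCell M τ n k).indicator
      (fun ω => (localTime (fun t => X t ω) (-y) 1).toReal) ω) (fun k _ => hnn k)
      (Finset.mem_range.2 hk)
    simp only [Set.indicator_of_mem hmem] at hs
    have hexp : Real.exp (l * gridCeil n (τ ω)) ≤ Real.exp l :=
      Real.exp_le_exp.2 (mul_le_of_le_one_right l.2 (by exact_mod_cast hg1))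
    have m1 := ENNReal.toReal_mono hL.ne (localTime_mono (fun t => X t ω) (-y)
      (show ((gridCeil n (τ ω) : ℝ≥0) : ℝ≥0∞) ≤ 1 by exact_mod_cast hg1))
    have m2 : 0 ≤ (localTime (fun t => X t ω) (-y) (firstJumpTime M ω)).toReal :=
      ENNReal.toReal_nonneg
    rw [mul_one]
    exact (mul_le_mul_of_nonneg_left (((sub_le_self _ m2).trans m1).trans hs)
      (by positivity)).trans
      (mul_le_mul_of_nonneg_right (by gcongr) (Finset.sum_nonneg fun k _ => hnn k))
  · rw [mul_zero, zero_mul]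
    exact mul_nonneg (by positivity) (Finset.sum_nonneg fun k _ => hnn k)

/-- The running reward on the grid. -/
lemma sum_setIntegral_fAux_le (hB : IsBrownianReal B P) (hN : IsPoissonProcess N l P)
    (hindep : IndepFun (fun ω t => N t ω) (fun ω t => B t ω) P) {τ : Ω → ℝ≥0}
    (hτ : τ ∈ stoppingTimesUnit (pairFiltration N B hNm hBm)) {n : ℕ} (hn : 0 < n)
    {a c : ℝ} (ha : 0 ≤ a) (hc : 19 / 20 ≤ c) :
    ∑ k ∈ Finset.range n, ∫ ω in {ω | (k : ℝ≥0) / n < τ ω},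
        (∫ s in ((k : ℝ) / n)..((k + 1 : ℝ) / n), fAux a (-c + X s.toNNReal ω))
          ∂P[|{ω | M 1 ω = 0}] ≤
      (19 / 20 - c + 3 / 10 * a) * (1 / n * ∑ k ∈ Finset.range n,
        P[|{ω | M 1 ω = 0}].real {ω | (k : ℝ≥0) / n < τ ω}) := by
  have := hV.isProbabilityMeasure_cond hN
  set Q := P[|{ω | M 1 ω = 0}] with hQ
  have hW := hV.isContBrownian_cond hB hN hindep hBm hNm
  have hn' : (0 : ℝ) < n := by exact_mod_cast hn
  have hI := fun k (_ : k < n) => hV.indepOfFuture_grid hB hN hindep hτ n k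
  have e1 := sum_setIntegral_id_le hW hn (antitone_grid τ n) hI
  have e2 := sum_setIntegral_sq_le hW hn (antitone_grid τ n) hI
  have hint : ∀ {g : ℝ → ℝ} {C : ℝ} (k : ℕ), Measurable g → (∀ x, |g x| ≤ C * (1 + x ^ 4)) →
      Integrable (fun ω => ∫ s in ((k : ℝ) / n)..((k + 1 : ℝ) / n), g (X s.toNNReal ω)) Q := by
    intro g C k hg hC
    have hkk : (k : ℝ) / n ≤ (k + 1 : ℝ) / n := by gcongr; linarith
    simp_rw [intervalIntegral.integral_of_le hkk]
    exact (hW.integrable_prod (by positivity) hg hC).integral_prod_right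
  have hcell : ∀ k ∈ Finset.range n, ∫ ω in {ω | (k : ℝ≥0) / n < τ ω},
        (∫ s in ((k : ℝ) / n)..((k + 1 : ℝ) / n), fAux a (-c + X s.toNNReal ω)) ∂Q ≤
      (∫ ω in {ω | (k : ℝ≥0) / n < τ ω},
        (∫ s in ((k : ℝ) / n)..((k + 1 : ℝ) / n), X s.toNNReal ω) ∂Q) +
      (a * (3 / 10)) * (∫ ω in {ω | (k : ℝ≥0) / n < τ ω},
        (∫ s in ((k : ℝ) / n)..((k + 1 : ℝ) / n), X s.toNNReal ω ^ 2) ∂Q) -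
      c * (1 / n * Q.real {ω | (k : ℝ≥0) / n < τ ω}) := by
    intro k _
    have hkk : (k : ℝ) / n ≤ (k + 1 : ℝ) / n := by gcongr; linarith
    have i1 := hint (g := fun x => x) (C := 5) k measurable_id fun x => by
      have := abs_quartic_le (c₀ := 0) (c₁ := 1) (c₂ := 0) (c₃ := 0) (c₄ := 0) (M := 1)
        (by simp) (by simp) (by simp) (by simp) (by simp) x
      simpa using this
    have i2 := hint (g := fun x => x ^ 2) (C := 5) k (by fun_prop) fun x => by
      have := abs_quartic_le (c₀ := 0) (c₁ := 0) (c₂ := 1) (c₃ := 0) (c₄ := 0) (M := 1)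
        (by simp) (by simp) (by simp) (by simp) (by simp) x
      simpa using this
    have i3 := hint (g := fun x => fAux a (-c + x)) k
      (by have := continuous_fAux a; fun_prop) (abs_fAux_add_le ha (-c))
    have i4 : Integrable (fun _ : Ω => c * (1 / n : ℝ)) Q := integrable_const _
    have i5 : Integrable (fun ω => (∫ s in ((k : ℝ) / n)..((k + 1 : ℝ) / n), X s.toNNReal ω) +
        a * (3 / 10) * ∫ s in ((k : ℝ) / n)..((k + 1 : ℝ) / n), X s.toNNReal ω ^ 2) Q :=
      i1.add (i2.const_mul _)
    have hconst : c * (1 / n * Q.real {ω | (k : ℝ≥0) / n < τ ω}) =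
        ∫ ω in {ω | (k : ℝ≥0) / n < τ ω}, c * (1 / n : ℝ) ∂Q := by
      rw [setIntegral_const, smul_eq_mul]
      ring
    rw [hconst, ← integral_const_mul, ← integral_add i1.restrict (i2.restrict.const_mul _),
      ← integral_sub i5.restrict i4.restrict]
    refine integral_mono i3.restrict (i5.sub i4).restrict fun ω => ?_
    have hcX : Continuous fun s : ℝ => X s.toNNReal ω :=
      (hV.cont ω).comp continuous_real_toNNReal
    have hcX2 : Continuous fun s : ℝ => a * (3 / 10) * X s.toNNReal ω ^ 2 :=
      continuous_const.mul (hcX.pow 2)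
    have hcX3 : Continuous fun s : ℝ => X s.toNNReal ω + a * (3 / 10) * X s.toNNReal ω ^ 2 :=
      hcX.add hcX2
    have hconst2 : c * (1 / n : ℝ) = ∫ _ in ((k : ℝ) / n)..((k + 1 : ℝ) / n), c := by
      rw [intervalIntegral.integral_const, smul_eq_mul]
      ring
    have hp : (∫ s in ((k : ℝ) / n)..((k + 1 : ℝ) / n), X s.toNNReal ω) +
        a * (3 / 10) * (∫ s in ((k : ℝ) / n)..((k + 1 : ℝ) / n), X s.toNNReal ω ^ 2) -
        c * (1 / n : ℝ) =
        ∫ s in ((k : ℝ) / n)..((k + 1 : ℝ) / n),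
          (X s.toNNReal ω + a * (3 / 10) * X s.toNNReal ω ^ 2 - c) := by
      rw [hconst2, ← intervalIntegral.integral_const_mul, ← intervalIntegral.integral_add
        (hcX.intervalIntegrable _ _)
        (hcX2.intervalIntegrable _ _),
        ← intervalIntegral.integral_sub (hcX3.intervalIntegrable _ _)
        (continuous_const.intervalIntegrable _ _)]
    refine le_trans ?_ hp.ge
    refine intervalIntegral.integral_mono_on hkk
      (((continuous_fAux a).comp (continuous_const.add hcX)).intervalIntegrable _ _)
      ((hcX3.sub continuous_const).intervalIntegrable _ _)
      fun s _ => ?_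
    have := fAux_sub_le ha hc (X s.toNNReal ω)
    rw [show -c + X s.toNNReal ω = X s.toNNReal ω - c by ring]
    linarith
  refine (Finset.sum_le_sum hcell).trans ?_
  rw [Finset.sum_sub_distrib, Finset.sum_add_distrib, ← Finset.mul_sum, ← Finset.mul_sum,
    ← Finset.mul_sum]
  have e3 := mul_le_mul_of_nonneg_left e2 (show 0 ≤ a * (3 / 10) by positivity)
  linarith

/-- Stopping on a grid is not profitable below the threshold. -/
lemma integral_payoff_gridCeil_nonpos (hB : IsBrownianReal B P) (hN : IsPoissonProcess N l P)
    (hindep : IndepFun (fun ω t => N t ω) (fun ω t => B t ω) P) {τ : Ω → ℝ≥0}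
    (hτ : τ ∈ stoppingTimesUnit (pairFiltration N B hNm hBm)) {n : ℕ} (hn : 0 < n) {y : ℝ}
    (hy : y ≤ -(19 / 20 + l * b * (2 + Real.exp l))) :
    ∫ ω, payoff l b M X y (fun ω => gridCeil n (τ ω)) ω ∂P ≤ 0 := by
  have hτm := measurable_of_mem_stoppingTimesUnit hτ
  have ha : (0 : ℝ) ≤ l * b := by positivity
  have hc : 19 / 20 ≤ -y := by
    have : 0 ≤ (l : ℝ) * b * (2 + Real.exp l) := by positivity
    linarith
  have h1 := hV.integral_noJumpDensity_mul_gridCeil hB hN hindep hτ hn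
    (g := fun x => fAux (l * b) (y + x)) (by have := continuous_fAux (l * b); fun_prop)
    (abs_fAux_add_le ha y)
  have hcell : ∀ k ∈ Finset.range n, Integrable ((jumpCell M τ n k).indicator
        (fun ω => (localTime (fun t => X t ω) (-y) 1).toReal)) P := fun k _ =>
    (hV.integrable_localTime hB (-y)).indicator (hV.measurableSet_jumpCell hτm n k)
  have hsum := integrable_finsetSum (Finset.range n) hcell
  have hpay := hV.integrable_payoff (l := l) (b := b) hB y ((measurable_gridCeil n).comp hτm)
    fun ω => gridCeil_le_one hn (hτ.2 ω)
  refine (integral_mono_ae hpay (h1.1.add (hsum.const_mul _))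
    (hV.payoff_gridCeil_le hB y hτ.2 hn)).trans ?_
  rw [integral_add' h1.1 (hsum.const_mul _), h1.2, integral_const_mul,
    integral_finsetSum _ hcell]
  simp_rw [integral_indicator (hV.measurableSet_jumpCell hτm n _)]
  have k1 := hV.sum_setIntegral_fAux_le hB hN hindep hτ hn ha hc
  have k2 := hV.sum_jumpCell_localTime_le hB hN hindep hτ hn (c := -y) (by linarith)
  rw [neg_neg] at k1
  set σ : ℝ := 1 / n * ∑ k ∈ Finset.range n,
    P[|{ω | M 1 ω = 0}].real {ω | (k : ℝ≥0) / n < τ ω} with hσ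
  have hσ0 : 0 ≤ σ := mul_nonneg (by positivity) (Finset.sum_nonneg fun k _ => measureReal_nonneg)
  have k3 : 4 / 5 + 1 / (-y) ≤ 2 := by
    have : 1 / (-y) ≤ 20 / 19 := by
      rw [div_le_div_iff₀ (by linarith) (by norm_num)]
      linarith
    linarith
  have k4 := mul_le_mul_of_nonneg_left (k2.trans (mul_le_mul_of_nonneg_left
    (mul_le_mul_of_nonneg_right k3 hσ0) l.2)) (show 0 ≤ (b : ℝ) / 2 * Real.exp l by positivity)
  -- The total coefficient of σ is 19/20 + y + (3/10) l b + l b e^l. The bound on y makes it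
  -- nonpositive, with (17/10) l b to spare.
  have k5 : 0 ≤ (-(19 / 20 + l * b * (2 + Real.exp l)) - y) * σ :=
    mul_nonneg (by linarith) hσ0
  have k6 : 0 ≤ (l : ℝ) * b * σ := mul_nonneg ha hσ0
  refine (add_le_add k1 k4).trans ?_
  linarith [NNReal.val_eq_coe l]

end IsRegularVersion

end Setting

/-! ### A profitable stopping time at a level below zero. -/

lemma IndepOfFuture.setIntegral_affine {Ω : Type*} [MeasurableSpace Ω] {W : ℝ → Ω → ℝ}
    {Q : Measure Ω} [IsProbabilityMeasure Q] {A : Set Ω} {t : ℝ} (hA : IndepOfFuture W Q A t)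
    (hW : IsContBrownian W Q) (ht : 0 ≤ t) {h : ℝ} (hh : 0 ≤ h) (y : ℝ) :
    ∫ ω in A, (∫ s in t..(t + h), (y + W s ω)) ∂Q = h * ∫ ω in A, (y + W t ω) ∂Q := by
  have hb : ∀ k x : ℝ, |k * (y + x)| ≤ 5 * max |k * y| |k| * (1 + x ^ 4) := fun k x => by
    have := abs_quartic_le (c₀ := k * y) (c₁ := k) (c₂ := 0) (c₃ := 0) (c₄ := 0)
      (M := max |k * y| |k|) (le_max_left _ _) (le_max_right _ _) (by simp) (by simp) (by simp) x
    simpa [mul_add] using this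
  set C : ℝ := max (5 * max |1 * y| |1|) (5 * max |-h * y| |-h|) with hC
  have hle : ∀ x : ℝ, (0 : ℝ) ≤ 1 + x ^ 4 := fun x => by positivity
  -- With terminal function q = 0 and p = -h (y + x), the heat identity says only that the mean of y
  -- + x + w is y + x.
  rw [hA.dynkin_step hW ht hh (F := fun x => y + x) (p := fun x => -h * (y + x))
    (q := fun _ => 0) (C := C) (by fun_prop) (by fun_prop) (by fun_prop) (fun x => ?_)
    (fun x => ?_) (fun x => ?_) fun x => ?_]
  · rw [← integral_const_mul]
    congr 1 with ω
    ring
  · have := hb 1 x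
    rw [one_mul] at this
    exact this.trans (mul_le_mul_of_nonneg_right (le_max_left _ _) (hle x))
  · exact (hb (-h) x).trans (mul_le_mul_of_nonneg_right (le_max_right _ _) (hle x))
  · rw [abs_zero]
    exact mul_nonneg (le_max_of_le_left (by positivity)) (hle x)
  · have e : ∀ r : ℝ, ∫ w, (y + (x + w)) ∂gaussianReal 0 r.toNNReal = y + x := by
      intro r
      have hi : Integrable (fun w : ℝ => w) (gaussianReal 0 r.toNNReal) := by
        simpa using integrable_pow_gaussianReal r.toNNReal 1
      simp_rw [← add_assoc]
      rw [integral_add (integrable_const _) hi, integral_id_gaussianReal]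
      simp
    simp_rw [e]
    simp
    ring

/-- The positive part is bounded below by x/2 + x²/2 - x⁴/8, equivalently |x| ≥ x² - x⁴/4. At time
1/2 the second and fourth moments are 1/2 and 3/4, so the expectation of this polynomial is 1/4 -
3/32 = 5/32. -/
lemma IsContBrownian.le_setIntegral_nonneg {Ω : Type*} [MeasurableSpace Ω] {W : ℝ → Ω → ℝ}
    {Q : Measure Ω} [IsProbabilityMeasure Q] (hW : IsContBrownian W Q) :
    5 / 32 ≤ ∫ ω in {ω | 0 ≤ W (1 / 2) ω}, W (1 / 2) ω ∂Q := by
  have hs : (0 : ℝ) ≤ 1 / 2 := by norm_num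
  have hm : MeasurableSet {ω | 0 ≤ W (1 / 2) ω} := measurableSet_le measurable_const (hW.meas _)
  have i1 : Integrable (W (1 / 2)) Q := by simpa using hW.integrable_pow hs 1
  have h := (hW.law hs).integral_comp
    (f := fun x : ℝ => 0 + 1 / 2 * x + 1 / 2 * x ^ 2 + 0 * x ^ 3 + -(1 / 8) * x ^ 4) (by fun_prop)
  rw [integral_quartic_gaussianReal _ _ _ _ _ hs] at h
  rw [← integral_indicator hm]
  have h5 : (5 : ℝ) / 32 = 0 + 1 / 2 * (1 / 2) + 3 * -(1 / 8) * (1 / 2) ^ 2 := by norm_num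
  rw [h5, ← h]
  refine integral_mono ?_ (i1.indicator hm) fun ω => ?_
  · have := ((i1.const_mul (1 / 2)).add ((hW.integrable_pow hs 2).const_mul (1 / 2))).add
      ((hW.integrable_pow hs 4).const_mul (-(1 / 8)))
    refine this.congr (ae_of_all _ fun ω => ?_)
    simp only [Pi.add_apply, Function.comp_apply]
    ring
  · simp only [Function.comp_apply]
    set x := W (1 / 2) ω with hx
    by_cases hx0 : 0 ≤ x
    · rw [Set.indicator_of_mem (show ω ∈ {ω | 0 ≤ W (1 / 2) ω} from hx0)]
      have : 0 ≤ x * ((x - 1) ^ 2 * (x + 2) + 2 * (x - 1 / 2) ^ 2 + (1 + 1 / 2) - x) := by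
        refine mul_nonneg hx0 ?_
        nlinarith [mul_nonneg hx0 (sq_nonneg (x - 1)), sq_nonneg (x - 1)]
      nlinarith [mul_nonneg hx0 (sq_nonneg (x - 1)), mul_nonneg hx0 (sq_nonneg (x - 5 / 4)),
        mul_nonneg hx0 (mul_nonneg hx0 (sq_nonneg (x - 5 / 4)))]
    · rw [Set.indicator_of_notMem (show ω ∉ {ω | 0 ≤ W (1 / 2) ω} from hx0)]
      have hx1 : 0 ≤ -x := by linarith
      nlinarith [mul_nonneg hx1 (sq_nonneg (x - 1)), mul_nonneg hx1 (sq_nonneg (x + 1)),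
        mul_nonneg hx1 (sq_nonneg (x + 5 / 4)),
        mul_nonneg hx1 (mul_nonneg hx1 (sq_nonneg (x + 5 / 4)))]

section Setting

variable {Ω : Type*} [MeasurableSpace Ω] {P : Measure Ω} [IsProbabilityMeasure P]
  {l b : ℝ≥0} {B : ℝ≥0 → Ω → ℝ} {N : ℝ≥0 → Ω → ℕ} {hBm : ∀ t, Measurable (B t)}
  {hNm : ∀ t, Measurable (N t)} {X : ℝ≥0 → Ω → ℝ} {M : ℝ≥0 → Ω → ℕ}

/-- Stop at time `1` if the Brownian motion is nonnegative at time `1 / 2`, else at `1 / 2`. -/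
noncomputable def halfwayTime (B : ℝ≥0 → Ω → ℝ) (ω : Ω) : ℝ≥0 :=
  haveI := Classical.dec (0 ≤ B (1 / 2) ω)
  if 0 ≤ B (1 / 2) ω then 1 else 1 / 2

lemma halfwayTime_mem (hBm : ∀ t, Measurable (B t)) (hNm : ∀ t, Measurable (N t)) :
    halfwayTime B ∈ stoppingTimesUnit (pairFiltration N B hNm hBm) := by
  have h12 : (1 / 2 : ℝ≥0) ≤ 1 := by
    rw [← NNReal.coe_le_coe]; norm_num
  refine ⟨fun t => ?_, fun ω => ?_⟩
  · have e : {ω | ((halfwayTime B ω : ℝ≥0) : WithTop ℝ≥0) ≤ t} = {ω | halfwayTime B ω ≤ t} := by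
      ext ω
      exact WithTop.coe_le_coe
    rw [e]
    have hBt : MeasurableSet[pairFiltration N B hNm hBm (1 / 2)] {ω | 0 ≤ B (1 / 2) ω} := by
      have h := (Filtration.stronglyAdapted_natural (u := fun t ω => (N t ω, B t ω))
        (fun t => ((hNm t).prodMk (hBm t)).stronglyMeasurable) (1 / 2)).measurable
      exact (measurable_snd.comp h) measurableSet_Ici
    by_cases h1 : 1 ≤ t
    · have : {ω | halfwayTime B ω ≤ t} = Set.univ := by
        ext ω
        simp only [Set.mem_ofPred_eq, Set.mem_univ, iff_true]
        unfold halfwayTime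
        split_ifs
        · exact h1
        · exact h12.trans h1
      rw [this]
      exact MeasurableSet.univ
    · by_cases h2 : 1 / 2 ≤ t
      · have : {ω | halfwayTime B ω ≤ t} = {ω | 0 ≤ B (1 / 2) ω}ᶜ := by
          ext ω
          simp only [Set.mem_ofPred_eq, Set.mem_compl_iff]
          unfold halfwayTime
          split_ifs with h
          · exact iff_of_false h1 (not_not.2 h)
          · exact iff_of_true h2 h
        rw [this]
        exact ((pairFiltration N B hNm hBm).mono h2 _ hBt).compl
      · have : {ω | halfwayTime B ω ≤ t} = ∅ := by
          ext ω
          simp only [Set.mem_ofPred_eq, Set.mem_empty_iff_false, iff_false]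
          unfold halfwayTime
          split_ifs with h
          · exact h1
          · exact h2
        rw [this]
        exact @MeasurableSet.empty _ (pairFiltration N B hNm hBm t)
  · unfold halfwayTime
    split_ifs
    · exact le_rfl
    · exact h12

/-- Both values lie on the grid of mesh 1/2, so the grid formulas with n = 2 hold for this time
without approximation. -/
lemma gridCeil_halfwayTime (ω : Ω) : gridCeil 2 (halfwayTime B ω) = halfwayTime B ω := by
  unfold halfwayTime gridCeil
  split_ifs <;> simp

namespace IsRegularVersion

variable (hV : IsRegularVersion P B N X M)
include hV

/-- The two discarded terms are nonnegative: the multiple of the positive part in `fAux`, and the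
local time gained after the first jump. -/
lemma noJumpDensity_mul_le_payoff (hB : IsBrownianReal B P) (y : ℝ) {τ : Ω → ℝ≥0}
    (hτ1 : ∀ ω, τ ω ≤ 1) :
    ∀ᵐ ω ∂P, noJumpDensity l M (τ ω) ω * (∫ s in (0 : ℝ)..(τ ω : ℝ), (y + X s.toNNReal ω)) ≤
      payoff l b M X y τ ω := by
  filter_upwards [hV.localTime_lt_top hB (-y)] with ω hL
  have hcX : Continuous fun s : ℝ => y + X s.toNNReal ω :=
    continuous_const.add ((hV.cont ω).comp continuous_real_toNNReal)
  unfold payoff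
  refine (mul_le_mul_of_nonneg_left (intervalIntegral.integral_mono_on (τ ω).2
    (hcX.intervalIntegrable _ _) (((continuous_fAux (l * b)).comp hcX).intervalIntegrable _ _)
    fun s _ => ?_) (noJumpDensity_nonneg _ _ _ _)).trans (le_add_of_nonneg_right ?_)
  · rw [Function.comp_apply]
    unfold fAux
    have : 0 ≤ (l : ℝ) * b * max (y + X s.toNNReal ω) 0 :=
      mul_nonneg (by positivity) (le_max_right _ _)
    linarith
  · split_ifs with h
    · have m1 := localTime_mono (fun t => X t ω) (-y) (firstJumpTime_le h.symm.le)
      have m2 := localTime_mono (fun t => X t ω) (-y)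
        (show ((τ ω : ℝ≥0) : ℝ≥0∞) ≤ 1 by exact_mod_cast hτ1 ω)
      have := ENNReal.toReal_mono (m2.trans_lt hL).ne m1
      exact mul_nonneg (by positivity) (sub_nonneg.2 this)
    · simp

/-- By the Markov property each half-interval contributes its length times the mean starting
position on the event of continuation. The total is at least (1/2)(-1/16) + (1/2)(5/32 - 1/16) =
1/64. -/
lemma integral_payoff_halfwayTime_pos (hB : IsBrownianReal B P) (hN : IsPoissonProcess N l P)
    (hindep : IndepFun (fun ω t => N t ω) (fun ω t => B t ω) P)
    (hBm : ∀ t, Measurable (B t)) (hNm : ∀ t, Measurable (N t)) :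
    0 < ∫ ω, payoff l b M X (-(1 / 16)) (halfwayTime B) ω ∂P := by
  have := hV.isProbabilityMeasure_cond hN
  have hτ := halfwayTime_mem hBm hNm
  have hW := hV.isContBrownian_cond hB hN hindep hBm hNm
  have h1 := hV.integral_noJumpDensity_mul_gridCeil hB hN hindep hτ (n := 2) two_pos
    (g := fun x => -(1 / 16) + x) (by fun_prop) (C := 5) fun x => by
      simpa using abs_quartic_le (c₀ := -(1 / 16)) (c₁ := 1) (c₂ := 0) (c₃ := 0) (c₄ := 0) (M := 1)
        (by rw [abs_le]; norm_num) (by simp) (by simp) (by simp) (by simp) x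
  simp_rw [gridCeil_halfwayTime] at h1
  refine lt_of_lt_of_le ?_ (integral_mono_ae h1.1
    (hV.integrable_payoff hB _ (measurable_of_mem_stoppingTimesUnit hτ) hτ.2)
    (hV.noJumpDensity_mul_le_payoff hB _ hτ.2))
  rw [h1.2]
  set Q := P[|{ω | M 1 ω = 0}] with hQ
  have hcell : ∀ k : ℕ, ∫ ω in {ω | (k : ℝ≥0) / (2 : ℕ) < halfwayTime B ω},
      (∫ s in ((k : ℝ) / (2 : ℕ))..((k + 1 : ℝ) / (2 : ℕ)), (-(1 / 16) + X s.toNNReal ω)) ∂Q =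
      1 / 2 * ∫ ω in {ω | (k : ℝ≥0) / (2 : ℕ) < halfwayTime B ω},
        (-(1 / 16) + X ((k : ℝ) / (2 : ℕ)).toNNReal ω) ∂Q := by
    intro k
    rw [← (hV.indepOfFuture_grid hB hN hindep hτ 2 k).setIntegral_affine hW (by positivity)
      (by norm_num) (-(1 / 16)), show (k : ℝ) / (2 : ℕ) + 1 / 2 = (k + 1 : ℝ) / (2 : ℕ) by
        push_cast; ring]
  rw [Finset.sum_range_succ, Finset.sum_range_one, hcell, hcell]
  have hpos : ∀ ω, 0 < halfwayTime B ω := fun ω => by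
    unfold halfwayTime
    split_ifs <;> simp
  have e0 : {ω | ((0 : ℕ) : ℝ≥0) / (2 : ℕ) < halfwayTime B ω} = Set.univ := by
    ext ω
    simpa using hpos ω
  have e1 : {ω | ((1 : ℕ) : ℝ≥0) / (2 : ℕ) < halfwayTime B ω} =ᵐ[Q]
      {ω | 0 ≤ X (1 / 2 : ℝ).toNNReal ω} := by
    filter_upwards [cond_absolutelyContinuous.ae_le hV.eqX] with ω hω
    have h2 : (1 / 2 : ℝ).toNNReal = 1 / 2 := by
      rw [Real.toNNReal_div zero_le_one]
      simp
    have h3 : (1 / 2 : ℝ≥0) < 1 := by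
      rw [← NNReal.coe_lt_coe]; norm_num
    have : (((1 : ℕ) : ℝ≥0) / (2 : ℕ) < halfwayTime B ω) = (0 ≤ X (1 / 2 : ℝ).toNNReal ω) := by
      rw [h2, hω, Nat.cast_one, Nat.cast_ofNat]
      unfold halfwayTime
      split_ifs with h
      · exact propext (iff_of_true h3 h)
      · simpa using h
    exact this
  rw [e0, setIntegral_congr_set e1]
  have k0 : ∫ ω in Set.univ, (-(1 / 16) + X (((0 : ℕ) : ℝ) / (2 : ℕ)).toNNReal ω) ∂Q =
      -(1 / 16) := by
    rw [setIntegral_univ]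
    have : (fun ω => -(1 / 16) + X (((0 : ℕ) : ℝ) / (2 : ℕ)).toNNReal ω) =ᵐ[Q]
        fun _ => -(1 / 16 : ℝ) := by
      filter_upwards [hW.zero] with ω hω
      simpa using hω
    rw [integral_congr_ae this]
    simp
  have hs : (0 : ℝ) ≤ 1 / 2 := by norm_num
  have i1 : Integrable (X (1 / 2 : ℝ).toNNReal) Q := by simpa using hW.integrable_pow hs 1
  have k1 : 5 / 32 - 1 / 16 ≤ ∫ ω in {ω | 0 ≤ X (1 / 2 : ℝ).toNNReal ω},
      (-(1 / 16) + X (((1 : ℕ) : ℝ) / (2 : ℕ)).toNNReal ω) ∂Q := by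
    rw [Nat.cast_one, Nat.cast_ofNat, integral_add (integrable_const _) i1.restrict,
      setIntegral_const, smul_eq_mul]
    have := hW.le_setIntegral_nonneg
    have hle : Q.real {ω | 0 ≤ X (1 / 2 : ℝ).toNNReal ω} ≤ 1 := measureReal_le_one
    linarith
  rw [k0]
  linarith

/-! ### From grid times to all stopping times. -/

/-- The payoff at `τ` exceeds the payoff at a later grid time by a negligible amount. -/
lemma tendsto_payoff_sub_gridCeil (hB : IsBrownianReal B P) (y : ℝ) {τ : Ω → ℝ≥0}
    (hτ1 : ∀ ω, τ ω ≤ 1) :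
    ∀ᵐ ω ∂P, Tendsto (fun n : ℕ => max (payoff l b M X y τ ω -
      payoff l b M X y (fun ω => gridCeil (n + 1) (τ ω)) ω) 0) atTop (𝓝 0) := by
  filter_upwards [hV.localTime_lt_top hB (-y)] with ω hL
  set t := τ ω with ht
  set L : ℝ≥0 → ℝ := fun u => (localTime (fun t => X t ω) (-y) (u : ℝ≥0∞)).toReal with hLdef
  set L₀ : ℝ := (localTime (fun t => X t ω) (-y) (firstJumpTime M ω)).toReal with hL₀
  set i₀ : ℝ := if M t ω = 0 then 1 else 0 with hi₀
  set i₁ : ℝ := if M t ω = 1 then 1 else 0 with hi₁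
  have hi₁0 : 0 ≤ i₁ := by rw [hi₁]; split_ifs <;> simp
  set I : ℝ → ℝ := fun u => ∫ s in (0 : ℝ)..u, fAux (l * b) (y + X s.toNNReal ω) with hI
  have hcI : Continuous I := by
    have hcg : Continuous fun s : ℝ => fAux (l * b) (y + X s.toNNReal ω) :=
      (continuous_fAux _).comp (continuous_const.add ((hV.cont ω).comp continuous_real_toNNReal))
    exact intervalIntegral.continuous_primitive (fun a b => hcg.intervalIntegrable a b) 0
  -- G is the difference of the payoffs with the local time frozen at t: it is continuous in u and
  -- vanishes at u = t. The true difference is smaller by the nonnegative term that carries L u - L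
  -- t.
  set G : ℝ≥0 → ℝ := fun u => Real.exp (l * t) * i₀ * I t - Real.exp (l * u) * i₀ * I u +
    b / 2 * (Real.exp (l * t) - Real.exp (l * u)) * i₁ * (L t - L₀) with hG
  have hcG : Continuous fun u => max (G u) 0 := by
    rw [hG]
    fun_prop
  have hlim : Tendsto (fun n : ℕ => max (G (gridCeil (n + 1) t)) 0) atTop (𝓝 0) := by
    have := (hcG.tendsto t).comp (tendsto_gridCeil t)
    simpa [hG, Function.comp_def] using this
  refine squeeze_zero' (.of_forall fun n => le_max_right _ _) ?_ hlim
  filter_upwards [hV.eventually_gridCeil_eq t ω] with n hn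
  refine max_le_max ?_ le_rfl
  have hmono : L t ≤ L (gridCeil (n + 1) t) := by
    refine ENNReal.toReal_mono ((localTime_mono _ _ ?_).trans_lt hL).ne (localTime_mono _ _ ?_)
    · exact_mod_cast gridCeil_le_one n.succ_pos (hτ1 ω)
    · exact_mod_cast le_gridCeil n.succ_pos t
  have h2 : 0 ≤ b / 2 * Real.exp (l * gridCeil (n + 1) t) * i₁ * (L (gridCeil (n + 1) t) - L t) :=
    mul_nonneg (by positivity) (sub_nonneg.2 hmono)
  simp only [payoff, ← ht, hn]
  simp only [hG, hLdef, hI] at h2 ⊢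
  linarith

/-- Below the threshold no stopping time is profitable. -/
lemma integral_payoff_nonpos (hB : IsBrownianReal B P) (hN : IsPoissonProcess N l P)
    (hindep : IndepFun (fun ω t => N t ω) (fun ω t => B t ω) P) {τ : Ω → ℝ≥0}
    (hτ : τ ∈ stoppingTimesUnit (pairFiltration N B hNm hBm)) {y : ℝ}
    (hy : y ≤ -(19 / 20 + l * b * (2 + Real.exp l))) :
    ∫ ω, payoff l b M X y τ ω ∂P ≤ 0 := by
  have hτm := measurable_of_mem_stoppingTimesUnit hτ
  have hg1 : ∀ (n : ℕ) ω, gridCeil (n + 1) (τ ω) ≤ 1 := fun n ω =>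
    gridCeil_le_one n.succ_pos (hτ.2 ω)
  have i1 := hV.integrable_payoff (l := l) (b := b) hB y hτm hτ.2
  have i2 : ∀ n : ℕ, Integrable (payoff l b M X y fun ω => gridCeil (n + 1) (τ ω)) P := fun n =>
    hV.integrable_payoff hB y ((measurable_gridCeil _).comp hτm) (hg1 n)
  have i3 : ∀ n : ℕ, Integrable (fun ω => max (payoff l b M X y τ ω -
      payoff l b M X y (fun ω => gridCeil (n + 1) (τ ω)) ω) 0) P := fun n => (i1.sub (i2 n)).pos_part
  have hlim := tendsto_integral_of_dominated_convergence
    (fun ω => 2 * payoffBound l b X y ω) (fun n => (i3 n).aestronglyMeasurable)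
    ((hV.integrable_payoffBound hB y).const_mul 2) (fun n => ?_)
    (hV.tendsto_payoff_sub_gridCeil (l := l) (b := b) hB y hτ.2)
  · rw [integral_zero] at hlim
    refine ge_of_tendsto' hlim fun n => ?_
    have h1 : ∫ ω, payoff l b M X y τ ω ∂P ≤
        ∫ ω, (payoff l b M X y (fun ω => gridCeil (n + 1) (τ ω)) ω + max (payoff l b M X y τ ω -
          payoff l b M X y (fun ω => gridCeil (n + 1) (τ ω)) ω) 0) ∂P :=
      integral_mono i1 ((i2 n).add (i3 n)) fun ω => by
        have := le_max_left (payoff l b M X y τ ω -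
          payoff l b M X y (fun ω => gridCeil (n + 1) (τ ω)) ω) 0
        show payoff l b M X y τ ω ≤ _
        linarith
    rw [integral_add (i2 n) (i3 n)] at h1
    have h2 := hV.integral_payoff_gridCeil_nonpos (b := b) hB hN hindep hτ n.succ_pos hy
    exact h1.trans (add_le_of_nonpos_left h2)
  · filter_upwards [hV.abs_payoff_le (l := l) (b := b) hB y] with ω h
    have h1 := h τ (hτ.2 ω)
    have h2 := h (fun ω => gridCeil (n + 1) (τ ω)) (hg1 n ω)
    rw [Real.norm_of_nonneg (le_max_right _ _)]
    have h3 := abs_sub (payoff l b M X y τ ω)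
      (payoff l b M X y (fun ω => gridCeil (n + 1) (τ ω)) ω)
    refine max_le ((le_abs_self _).trans (h3.trans (by linarith))) ?_
    linarith [abs_nonneg (payoff l b M X y τ ω)]

end IsRegularVersion

end Setting

/-! ### Conclusion. -/

lemma zero_mem_expectedPayoffs {Ω : Type*} [MeasurableSpace Ω] {P : Measure Ω} {l b : ℝ≥0}
    {B : ℝ≥0 → Ω → ℝ} {N : ℝ≥0 → Ω → ℕ} (hBm : ∀ t, Measurable (B t))
    (hNm : ∀ t, Measurable (N t)) (h0 : ∀ᵐ ω ∂P, N 0 ω = 0) (y : ℝ) :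
    0 ∈ expectedPayoffs P l b N B hNm hBm y := by
  refine ⟨fun _ => 0, ⟨isStoppingTime_const _ 0, fun _ => zero_le⟩, ?_⟩
  have : payoff l b N B y (fun _ => 0) =ᵐ[P] fun _ => 0 := by
    filter_upwards [h0] with ω h
    simp [payoff, h]
  simpa using integral_congr_ae this

theorem mainTheorem6 {Ω : Type*} [MeasurableSpace Ω] (P : Measure Ω) [IsProbabilityMeasure P]
    (l b : ℝ≥0) (B : ℝ≥0 → Ω → ℝ) (N : ℝ≥0 → Ω → ℕ)
    (hBm : ∀ t, Measurable (B t)) (hNm : ∀ t, Measurable (N t))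
    (hB : IsBrownianReal B P) (hN : IsPoissonProcess N l P)
    (hindep : IndepFun (fun ω t => N t ω) (fun ω t => B t ω) P) :
    (∀ y : ℝ,
      (∀ τ ∈ stoppingTimesUnit (pairFiltration N B hNm hBm), Integrable (payoff l b N B y τ) P) ∧
      BddAbove (expectedPayoffs P l b N B hNm hBm y)) ∧
    0 < yThreshold P l b N B hNm hBm ∧
    yThreshold P l b N B hNm hBm < 1 + (l : ℝ) * b * (2 + Real.exp l) ∧
    ∀ y : ℝ, y < -yThreshold P l b N B hNm hBm → vAux P l b N B hNm hBm y = 0 := by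
  obtain ⟨X, M, hV⟩ := exists_isRegularVersion hBm hNm hB hN
  have hint : ∀ y, ∀ τ ∈ stoppingTimesUnit (pairFiltration N B hNm hBm),
      Integrable (payoff l b M X y τ) P := fun y τ hτ =>
    hV.integrable_payoff hB y (measurable_of_mem_stoppingTimesUnit hτ) hτ.2
  have hbdd : ∀ y, BddAbove (expectedPayoffs P l b N B hNm hBm y) := by
    refine fun y => ⟨∫ ω, payoffBound l b X y ω ∂P, ?_⟩
    rintro _ ⟨τ, hτ, rfl⟩
    show ∫ ω, payoff l b N B y τ ω ∂P ≤ _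
    rw [integral_congr_ae (hV.payoff_ae_eq y τ)]
    refine integral_mono_ae (hint y τ hτ) (hV.integrable_payoffBound hB y) ?_
    filter_upwards [hV.abs_payoff_le (l := l) (b := b) hB y] with ω h
    exact (le_abs_self _).trans (h τ (hτ.2 ω))
  -- Stopping at once yields 0, so outside S the value function is exactly 0.
  have hv0 : ∀ y, 0 ≤ vAux P l b N B hNm hBm y := fun y =>
    le_csSup (hbdd y) (zero_mem_expectedPayoffs hBm hNm hN.zero y)
  set S : Set ℝ := {x : ℝ | 0 < vAux P l b N B hNm hBm x} with hS
  have hlow : ∀ x ∈ S, -(19 / 20 + l * b * (2 + Real.exp l)) ≤ x := by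
    intro x hx
    by_contra! h
    refine (show ¬ 0 < vAux P l b N B hNm hBm x from not_lt.2 ?_) hx
    refine Real.sSup_le ?_ le_rfl
    rintro _ ⟨τ, hτ, rfl⟩
    show ∫ ω, payoff l b N B x τ ω ∂P ≤ 0
    rw [integral_congr_ae (hV.payoff_ae_eq x τ)]
    exact hV.integral_payoff_nonpos hB hN hindep hτ h.le
  have hmem : -(1 / 16) ∈ S := by
    refine (hV.integral_payoff_halfwayTime_pos (b := b) hB hN hindep hBm hNm).trans_le ?_
    rw [← integral_congr_ae (hV.payoff_ae_eq _ _)]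
    exact le_csSup (hbdd _) ⟨_, halfwayTime_mem hBm hNm, rfl⟩
  -- Both this bound and the nonemptiness of S are needed: the real `sInf` has the default value 0
  -- for a set which is empty or unbounded below.
  have hSb : BddBelow S := ⟨_, hlow⟩
  have h1 : sInf S ≤ -(1 / 16) := csInf_le hSb hmem
  have h2 : -(19 / 20 + l * b * (2 + Real.exp l)) ≤ sInf S := le_csInf ⟨_, hmem⟩ hlow
  have hy : yThreshold P l b N B hNm hBm = -sInf S := rfl
  refine ⟨fun y => ⟨fun τ hτ => (hint y τ hτ).congr (hV.payoff_ae_eq y τ).symm, hbdd y⟩,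
    by linarith, by linarith, fun y hlt => ?_⟩
  rw [hy, neg_neg] at hlt
  exact le_antisymm (not_lt.1 fun h => notMem_of_lt_csInf hlt hSb h) (hv0 y)
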